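/- Let $X$ be an infinite, connected, locally finite graph with graph distance $d$, endowed with a symmetric weight $\mu_{xy}\ge 0$ such that $\mu_{xy}>0$ if and only if $x$ and $y$ are neighbors (written $x\sim y$). Put $\mu(x)=\sum_{y}\mu_{xy}$, $\mu(A)=\sum_{x\in A}\mu(x)$ for $A\subset X$, $B(x,r)=\{y: d(x,y)\le r\}$ and $V(x,r)=\mu(B(x,r))$. Let $P(x,y)=\mu_{xy}/\mu(x)$ be the transition probabilities of the natural random walk, $P_n(x,y)$ its $n$-step transition probabilities, and $p_n(x,y)=P_n(x,y)/\mu(y)$ its heat kernel. Assume: (1) there is $C_\mu\ge 1$ with $C_\mu^{-1}\le\mu(x)\le C_\mu$ for all $x\in X$; (2) there is $p_0>0$ with $P(x,y)\ge p_0$ whenever $x\sim y$; (3) ($V(d_f)$) there are $d_f>0$ and $C_V>0$ with $C_V^{-1}r^{d_f}\le V(x,r)\le C_V r^{d_f}$ for all $x\in X$ and all real $r\ge 1$; (4) ($\mathrm{USG}(d_f,d_w)$ and $\mathrm{LSG}(d_f,d_w)$) there are $d_w>2$ and $c,C>0$ such that for all $x,y\in X$ $$p_n(x,y)\le \frac{C}{n^{d_f/d_w}}\exp\left[-\left(\frac{d(x,y)^{d_w}}{Cn}\right)^{\frac1{d_w-1}}\right]\quad\text{for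 all integers } n\ge 1,$$ $$p_n(x,y)+p_{n+1}(x,y)\ge \frac{c}{n^{d_f/d_w}}\exp\left[-\left(\frac{d(x,y)^{d_w}}{cn}\right)^{\frac1{d_w-1}}\right]\quad\text{for all integers } n\ge \max(1,d(x,y)).$$ Let $\beta\in[2,d_w)$ and let $K$ be a $\mu$-symmetric Markov operator, $Kf(x)=\sum_y k(x,y)f(y)\mu(y)$ with $k(x,y)=k(y,x)\ge 0$ and $\sum_y k(x,y)\mu(y)=1$ for all $x,y\in X$, whose kernel satisfies $J(\beta)$: there is $C_J>0$ such that for all $x,y\in X$ $$C_J^{-1}(1+d(x,y))^{-(d_f+\beta)}\le k(x,y)\le C_J(1+d(x,y))^{-(d_f+\beta)}.$$ Let $k_n$ be the kernel of $K^n$ with respect to $\mu$. Then $K$ satisfies $\mathrm{HKP}(d_f,\beta)$: there is a constant $C'>0$ such that for all integers $n\ge 1$ and all $x,y\in X$ $$\frac1{C'}\min\left(\frac1{n^{d_f/\beta}},\frac{n}{d(x,y)^{d_f+\beta}}\right)\le k_n(x,y)\le C'\min\left(\frac1{n^{d_f/\beta}},\frac{n}{d(x,y)^{d_f+\beta}}\right),$$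 where for $x=y$ the second term of the minimum is read as $+\infty$. -/

import Mathlib

/-- The averaging operator `f ↦ (x ↦ ∑ y, P x y * f y)` with transition probabilities `P`. -/
noncomputable def transitionOp {X : Type*} (P : X → X → ℝ) (f : X → ℝ) (x : X) : ℝ :=
  ∑' y, P x y * f y

/-- The `n`-step transition probabilities: the `(x, y)` entry of the `n`-th power of the
operator with transition probabilities `P`, i.e. the probability that the Markov chain
started at `x` is at `y` at time `n`. -/
noncomputable def nStep {X : Type*} (P : X → X → ℝ) (n : ℕ) (x y : X) : ℝ :=
  (transitionOp P)^[n] (Set.indicator {y} 1) x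

/-- A connected, locally finite weighted graph. Two vertices are neighbours exactly when the
weight of the pair is positive, so the weight determines the graph (loops are allowed). -/
structure WeightedGraph (X : Type*) where
  weight : X → X → ℝ
  weight_nonneg : ∀ x y, 0 ≤ weight x y
  weight_symm : ∀ x y, weight x y = weight y x
  locallyFinite : ∀ x, {y | 0 < weight x y}.Finite
  connected : (SimpleGraph.fromRel fun x y => 0 < weight x y).Connected

namespace WeightedGraph

variable {X : Type*} (W : WeightedGraph X)

/-- `x ∼ y`. -/
def Neighbor (x y : X) : Prop := 0 < W.weight x y

/-- The underlying simple graph (loops, which do not affect distances, are dropped). -/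
def graph : SimpleGraph X := SimpleGraph.fromRel fun x y => 0 < W.weight x y

/-- The graph distance `d(x, y)`. -/
noncomputable def d (x y : X) : ℕ := W.graph.dist x y

/-- The vertex weight `μ(x)`; the sum has only finitely many non-zero terms. -/
noncomputable def vol (x : X) : ℝ := ∑' y, W.weight x y

/-- The closed ball `B(x, r)`. -/
def ball (x : X) (r : ℝ) : Set X := {y | (W.d x y : ℝ) ≤ r}

/-- `V(x, r) = μ(B(x, r))`; balls are finite since the graph is locally finite. -/
noncomputable def ballVol (x : X) (r : ℝ) : ℝ := ∑' y : W.ball x r, W.vol y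

/-- The measure `μ` is comparable to the counting measure. -/
def ComparableToCounting : Prop :=
  ∃ C : ℝ, 1 ≤ C ∧ ∀ x, C⁻¹ ≤ W.vol x ∧ W.vol x ≤ C

/-- Polynomial volume growth `V(d_f)`. -/
def VolumeGrowth (df : ℝ) : Prop :=
  ∃ C : ℝ, 0 < C ∧ ∀ (x : X) (r : ℝ), 1 ≤ r →
    C⁻¹ * r ^ df ≤ W.ballVol x r ∧ W.ballVol x r ≤ C * r ^ df

/-- One-step transition probabilities of the natural random walk. -/
noncomputable def walk (x y : X) : ℝ := W.weight x y / W.vol x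

/-- The one-step transition probabilities between neighbours are bounded below. -/
def UniformlyElliptic : Prop :=
  ∃ p₀ : ℝ, 0 < p₀ ∧ ∀ x y, W.Neighbor x y → p₀ ≤ W.walk x y

/-- The heat kernel `p_n(x, y) = P_n(x, y) / μ(y)` of the natural random walk. -/
noncomputable def heatKernel (n : ℕ) (x y : X) : ℝ := nStep W.walk n x y / W.vol y

/-- The sub-Gaussian upper bound `USG(d_f, d_w)`. -/
def USG (df dw : ℝ) : Prop :=
  ∃ C : ℝ, 0 < C ∧ ∀ (n : ℕ) (x y : X), 1 ≤ n →
    W.heatKernel n x y ≤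
      C / (n : ℝ) ^ (df / dw) *
        Real.exp (-(((W.d x y : ℝ) ^ dw / (C * n)) ^ (1 / (dw - 1))))

/-- The sub-Gaussian lower bound `LSG(d_f, d_w)`. -/
def LSG (df dw : ℝ) : Prop :=
  ∃ c : ℝ, 0 < c ∧ ∀ (n : ℕ) (x y : X), max 1 (W.d x y) ≤ n →
    c / (n : ℝ) ^ (df / dw) *
        Real.exp (-(((W.d x y : ℝ) ^ dw / (c * n)) ^ (1 / (dw - 1)))) ≤
      W.heatKernel n x y + W.heatKernel (n + 1) x y

/-- A `μ`-symmetric Markov operator `K f (x) = ∑ y, k(x, y) f(y) μ(y)`, given by its kernel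
`k` with respect to `μ`. -/
structure SymmMarkovOperator where
  kernel : X → X → ℝ
  nonneg : ∀ x y, 0 ≤ kernel x y
  symm : ∀ x y, kernel x y = kernel y x
  markov : ∀ x, HasSum (fun y => kernel x y * W.vol y) 1

namespace SymmMarkovOperator

variable {W} (K : W.SymmMarkovOperator)

/-- The kernel `k_n` of the power `K ^ n` with respect to `μ`. -/
noncomputable def iterKernel (n : ℕ) (x y : X) : ℝ :=
  nStep (fun u v => K.kernel u v * W.vol v) n x y / W.vol y

/-- The condition `J(β)`, on a graph with volume growth exponent `df`. -/
def J (df β : ℝ) : Prop :=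
  ∃ C : ℝ, 0 < C ∧ ∀ x y,
    C⁻¹ * (1 / (1 + (W.d x y : ℝ)) ^ (df + β)) ≤ K.kernel x y ∧
      K.kernel x y ≤ C * (1 / (1 + (W.d x y : ℝ)) ^ (df + β))

end SymmMarkovOperator

end WeightedGraph

/-- `min (1 / n^(df/β)) (n / d^(df+β))`, where the second term is `+∞` if `d = 0`. -/
noncomputable def hkpProfile (df β : ℝ) (n d : ℕ) : ℝ :=
  if d = 0 then 1 / (n : ℝ) ^ (df / β)
  else min (1 / (n : ℝ) ^ (df / β)) ((n : ℝ) / (d : ℝ) ^ (df + β))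

/-- The two-sided heat kernel bound `HKP(d_f, β)`. -/
def WeightedGraph.SymmMarkovOperator.HKP {X : Type*} {W : WeightedGraph X}
    (K : W.SymmMarkovOperator) (df β : ℝ) : Prop :=
  ∃ C : ℝ, 0 < C ∧ ∀ (n : ℕ) (x y : X), 1 ≤ n →
    C⁻¹ * hkpProfile df β n (W.d x y) ≤ K.iterKernel n x y ∧
      K.iterKernel n x y ≤ C * hkpProfile df β n (W.d x y)

/-! Everything is proved for the finite matrices obtained by killing the chain outside a finite set
Ω, with constants independent of Ω, and passed to the limit by
`IsTransition.tendsto_finiteOp_iterate`.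

On-diagonal upper bound. The lower half of J(β) says that the kernel is at least a multiple of
r^{-(df+β)} on pairs at distance at most r. Together with volume growth and a uniform holding
probability this is a Nash inequality (`IsSubMarkov.nash`), and iterating it (`decay_of_nash`) gives
n^{-df/β} decay, `J.killed_pow_le`.

Tails. This is the heart of the matter. For β ≥ 2, Lipschitz cutoffs have too much energy for a jump
kernel with this tail, so the cutoffs are built from the walk. Averaging P^n 1_E over about r^dw
times gives a potential u with P^m u - u ≤ min(m/(c r^dw), 1) (`exists_potential`). Subordination, ∑
m^{-1-β/dw} p_m, produces a reference kernel comparable to d^{-(df+β)}, up to distance r for the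
lower bound; β < dw makes the index less than one. For this kernel a truncation ψ of 3/4 - u
satisfies a one-sided generator bound of order r^{-β} where ψ > 0 (`exists_bump`). Such a bound
implies a cutoff Sobolev inequality (`energy_le_of_superharmonic`), and this inequality survives
replacing the kernel by a comparable one, hence holds for K (`exists_cutoff`).

Gluing these bumps on annuli of geometrically growing radii, with growth factor 1 + κ per annulus
and κ small, yields a weight v with v² comparable to (1+d(o,·))^{df+β} and with energy density small
up to a Hardy term (`exists_weight`). In L²(v² μ) one step of the local part of K is then almost
contractive (`caccioppoli`), the Hardy term is controlled by the on-diagonal decay, and non-local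
jumps cost a constant per step. So the weighted L² norm of the killed kernel grows at most linearly
(`J.killed_moment_le`), and Cauchy–Schwarz gives P(d(o, X_t) > r) ≤ (C (t+1) (1+r)^{-β})^{1/2}
(`J.tail_le`).

Off-diagonal upper bound. Suppress jumps longer than ρ, a small multiple of d(x,y). The remaining
process can travel far only by leaving many balls of radius 2ρ in succession, each with probability
at most 2α by Ottaviani's inequality, where α bounds the tail probability at distance ρ. The
suppressed jumps cost n times the kernel at distance ρ. Taking enough iterations makes the power of
the tail bound combine with n^{-df/β} to give n d^{-(df+β)} (`J.nStep_le_of_ne`).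

Lower bound. With R a large multiple of max(n^{1/β}, d(x,y)), the tail bound keeps the chain within
R of x, and of y, for time n with probability bounded below. Summing over the time of one jump
between the two balls gives n R^{-(df+β)} (`J.le_nStep`), which covers the near-diagonal and the
off-diagonal regimes together. -/

/-! ### Distances, finite balls and volume sums. -/

namespace WeightedGraph

variable {X : Type*} (W : WeightedGraph X)

lemma graph_connected : W.graph.Connected := W.connected

lemma d_self (x : X) : W.d x x = 0 := by simp [d]

lemma d_comm (x y : X) : W.d x y = W.d y x := SimpleGraph.dist_comm

lemma d_triangle (x y z : X) : W.d x z ≤ W.d x y + W.d y z :=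
  W.graph_connected.dist_triangle

lemma d_triangle_real (x y z : X) : (W.d x z : ℝ) ≤ W.d x y + W.d y z := by
  exact_mod_cast W.d_triangle x y z

lemma d_eq_zero {x y : X} : W.d x y = 0 ↔ x = y :=
  W.graph_connected.dist_eq_zero_iff

lemma one_le_d {x y : X} (h : x ≠ y) : (1 : ℝ) ≤ W.d x y := by
  have : W.d x y ≠ 0 := fun h0 => h (W.d_eq_zero.1 h0)
  exact_mod_cast Nat.one_le_iff_ne_zero.2 this

variable {W}

lemma ComparableToCounting.vol_pos (hμ : W.ComparableToCounting) (x : X) : 0 < W.vol x := by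
  obtain ⟨C, hC, h⟩ := hμ
  exact lt_of_lt_of_le (by positivity) (h x).1

lemma VolumeGrowth.summable_ball {df : ℝ} (hV : W.VolumeGrowth df) (x : X) {r : ℝ} (hr : 1 ≤ r) :
    Summable fun y : W.ball x r => W.vol y := by
  obtain ⟨C, hC, h⟩ := hV
  by_contra hs
  have h1 := (h x r hr).1
  -- A non-summable family has `tsum` zero, which the positive lower volume bound excludes.
  rw [ballVol, tsum_eq_zero_of_not_summable hs] at h1
  have : 0 < C⁻¹ * r ^ df := by have : 0 < r := by linarith
                                positivity
  linarith

lemma ball_finite {df : ℝ} (hμ : W.ComparableToCounting) (hV : W.VolumeGrowth df) (x : X) (r : ℝ) :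
    (W.ball x r).Finite := by
  have hs := hV.summable_ball x (le_max_right r 1)
  obtain ⟨C, hC, h⟩ := hμ
  have hfin : (W.ball x (max r 1)).Finite := by
    have hC' : 0 < C⁻¹ := by positivity
    have := hs.tendsto_cofinite_zero.eventually (gt_mem_nhds hC')
    rw [Filter.eventually_cofinite] at this
    have huniv : {y : W.ball x (max r 1) | ¬ W.vol y < C⁻¹} = Set.univ := by
      ext y; simpa using (h y).1
    rw [huniv] at this
    exact Set.finite_coe_iff.1 (Set.finite_univ_iff.1 this)
  exact hfin.subset fun y hy => le_trans (show (W.d x y : ℝ) ≤ r from hy) (le_max_left _ _)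

lemma VolumeGrowth.sum_le {df : ℝ} (hV : W.VolumeGrowth df) (hμ : W.ComparableToCounting) :
    ∃ C : ℝ, 0 < C ∧ ∀ (x : X) (r : ℝ), 1 ≤ r → ∀ S : Finset X, (∀ z ∈ S, (W.d x z : ℝ) ≤ r) →
      ∑ z ∈ S, W.vol z ≤ C * r ^ df := by
  classical
  have hV' := hV
  obtain ⟨C, hC, h⟩ := hV
  refine ⟨C, hC, fun x r hr S hS => le_trans ?_ (h x r hr).2⟩
  have hs := hV'.summable_ball x hr
  rw [ballVol]
  have := hs.sum_le_tsum (S.subtype (· ∈ W.ball x r)) (fun i _ => (hμ.vol_pos _).le)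
  refine le_trans (le_of_eq ?_) this
  rw [Finset.sum_subtype_of_mem (f := W.vol) (s := S) (p := (· ∈ W.ball x r))]
  exact hS

lemma VolumeGrowth.le_sum {df : ℝ} (hV : W.VolumeGrowth df) (hμ : W.ComparableToCounting) :
    ∃ c : ℝ, 0 < c ∧ ∀ (x : X) (r : ℝ), 1 ≤ r → 
      c * r ^ df ≤ ∑ z ∈ (ball_finite hμ hV x r).toFinset, W.vol z := by
  have hfin := ball_finite hμ hV
  obtain ⟨C, hC, h⟩ := hV
  refine ⟨C⁻¹, by positivity, fun x r hr => le_trans (h x r hr).1 (le_of_eq ?_)⟩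
  rw [ballVol, tsum_subtype, tsum_eq_sum (s := (hfin x r).toFinset)]
  · exact Finset.sum_congr rfl fun y hy => by
      rw [Set.indicator_of_mem]; simpa using hy
  · intro y hy
    rw [Set.indicator_of_notMem]; simpa using hy

/-- Volume growth makes `(1 + d)^{-(df+s)}` summable, with the expected tail. -/
lemma VolumeGrowth.tail_sum_le {df : ℝ} (hV : W.VolumeGrowth df) (hμ : W.ComparableToCounting)
    (hdf : 0 < df) {s : ℝ} (hs : 0 < s) :
    ∃ C : ℝ, 0 < C ∧ ∀ (x : X) (ρ : ℝ), 1 ≤ ρ → ∀ S : Finset X,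
      (∀ z ∈ S, ρ ≤ 1 + (W.d x z : ℝ)) →
      ∑ z ∈ S, W.vol z * (1 + (W.d x z : ℝ)) ^ (-(df + s)) ≤ C * ρ ^ (-s) := by
  obtain ⟨V, hVpos, hVle⟩ := hV.sum_le hμ
  have h2 : (2 : ℝ) ^ (-s) < 1 := Real.rpow_lt_one_of_one_lt_of_neg (by norm_num) (by linarith)
  -- The solution of C = V 2^df + 2^{-s} C, the recursion obtained by peeling off the dyadic shell ρ
  -- ≤ 1 + d < 2ρ and continuing from 2ρ.
  set C := V * 2 ^ df / (1 - 2 ^ (-s)) with hCdef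
  have hC1 : C * (1 - 2 ^ (-s)) = V * 2 ^ df := by
    rw [hCdef]; field_simp [(by linarith : (1 : ℝ) - 2 ^ (-s) ≠ 0)]
  have hC : 0 < C := by
    have : (0 : ℝ) < 1 - 2 ^ (-s) := by linarith
    positivity
  refine ⟨C, hC, ?_⟩
  have key : ∀ k : ℕ, ∀ (x : X) (ρ : ℝ), 1 ≤ ρ → ∀ S : Finset X,
      (∀ z ∈ S, ρ ≤ 1 + (W.d x z : ℝ) ∧ 1 + (W.d x z : ℝ) < 2 ^ k * ρ) →
      ∑ z ∈ S, W.vol z * (1 + (W.d x z : ℝ)) ^ (-(df + s)) ≤ C * ρ ^ (-s) := by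
    intro k
    induction k with
    | zero =>
      intro x ρ hρ S hS
      have : S = ∅ := by
        apply Finset.eq_empty_of_forall_notMem
        intro z hz
        have := hS z hz
        simp at this
        linarith
      subst this
      simp
      positivity
    | succ k ih =>
      intro x ρ hρ S hS
      have hρ0 : 0 < ρ := by linarith
      rw [← Finset.sum_filter_add_sum_filter_not S (fun z => 1 + (W.d x z : ℝ) < 2 * ρ)]
      have h1 : ∑ z ∈ S with 1 + (W.d x z : ℝ) < 2 * ρ,
          W.vol z * (1 + (W.d x z : ℝ)) ^ (-(df + s)) ≤ V * 2 ^ df * ρ ^ (-s) := by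
        calc _ ≤ ∑ z ∈ S with 1 + (W.d x z : ℝ) < 2 * ρ, W.vol z * ρ ^ (-(df + s)) := by
              apply Finset.sum_le_sum
              intro z hz
              simp only [Finset.mem_filter] at hz
              apply mul_le_mul_of_nonneg_left _ (hμ.vol_pos z).le
              exact Real.rpow_le_rpow_of_nonpos hρ0 (hS z hz.1).1 (by linarith)
          _ ≤ V * (2 * ρ) ^ df * ρ ^ (-(df + s)) := by
              rw [← Finset.sum_mul]
              gcongr
              apply hVle x _ (by linarith)
              intro z hz
              simp only [Finset.mem_filter] at hz
              linarith
          _ = V * 2 ^ df * ρ ^ (-s) := by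
              rw [Real.mul_rpow (by norm_num) hρ0.le, ← mul_assoc, mul_assoc,
                ← Real.rpow_add hρ0]
              congr 2; ring
      have h3 := ih x (2 * ρ) (by linarith) (S.filter fun z => ¬ 1 + (W.d x z : ℝ) < 2 * ρ) (by
        intro z hz
        simp only [Finset.mem_filter, not_lt] at hz
        refine ⟨hz.2, lt_of_lt_of_eq (hS z hz.1).2 (by ring)⟩)
      rw [Real.mul_rpow (by norm_num) hρ0.le] at h3
      calc _ ≤ V * 2 ^ df * ρ ^ (-s) + C * (2 ^ (-s) * ρ ^ (-s)) := add_le_add h1 h3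
        _ = C * ρ ^ (-s) := by rw [← hC1]; ring
  intro x ρ hρ S hS
  obtain ⟨k, hk⟩ : ∃ k : ℕ, ∀ z ∈ S, 1 + (W.d x z : ℝ) < 2 ^ k * ρ := by
    obtain ⟨k, hk⟩ := pow_unbounded_of_one_lt (∑ z ∈ S, (1 + (W.d x z : ℝ))) (one_lt_two)
    refine ⟨k, fun z hz => ?_⟩
    have h1 := Finset.single_le_sum (f := fun z => 1 + (W.d x z : ℝ))
      (fun i _ => by positivity) hz
    have h2 : (2 : ℝ) ^ k * 1 ≤ 2 ^ k * ρ := by gcongr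
    linarith
  exact key k x ρ hρ S fun z hz => ⟨hS z hz, hk z hz⟩

end WeightedGraph

/-! ### Power sums. -/

/-- Bernoulli's inequality with exponent 1 - a says that t^{1-a}/(1-a) increases by at least t^{-a}
from t - 1 to t; the sum telescopes. -/
lemma sum_rpow_neg_le {a : ℝ} (ha : 0 < a) (ha1 : a < 1) (M : ℕ) :
    ∑ m ∈ Finset.Icc 1 M, (m : ℝ) ^ (-a) ≤ (M : ℝ) ^ (1 - a) / (1 - a) := by
  have h1a : 0 < 1 - a := by linarith
  induction M with
  | zero => simp [Real.zero_rpow h1a.ne']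
  | succ M ih =>
    rw [Finset.sum_Icc_succ_top (by omega)]
    set t : ℝ := ((M + 1 : ℕ) : ℝ) with ht
    have ht0 : 0 < t := by rw [ht]; positivity
    have ht1 : 1 ≤ t := by rw [ht]; push_cast; linarith [Nat.cast_nonneg (α := ℝ) M]
    have hM : (M : ℝ) = t * (1 + -(1 / t)) := by rw [ht]; push_cast; field_simp; ring
    have hb : (1 + -(1 / t)) ^ (1 - a) ≤ 1 + (1 - a) * -(1 / t) := by
      apply rpow_one_add_le_one_add_mul_self _ h1a.le (by linarith)
      have : 1 / t ≤ 1 := by rw [div_le_one ht0]; exact ht1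
      linarith
    have h0 : 0 ≤ 1 + -(1 / t) := by
      have : 1 / t ≤ 1 := by rw [div_le_one ht0]; exact ht1
      linarith
    have h2 : (M : ℝ) ^ (1 - a) ≤ t ^ (1 - a) - (1 - a) * t ^ (-a) := by
      rw [hM, Real.mul_rpow ht0.le h0]
      calc _ ≤ t ^ (1 - a) * (1 + (1 - a) * -(1 / t)) := by gcongr
        _ = _ := by
          have : t ^ (-a) = t ^ (1 - a) * (1 / t) := by
            rw [show -a = (1 - a) - 1 by ring, Real.rpow_sub_one ht0.ne']; ring
          rw [this]; ring
    calc _ ≤ (M : ℝ) ^ (1 - a) / (1 - a) + t ^ (-a) := by linarith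
      _ ≤ (t ^ (1 - a) - (1 - a) * t ^ (-a)) / (1 - a) + t ^ (-a) := by gcongr
      _ = t ^ (1 - a) / (1 - a) := by field_simp; ring

lemma rpow_neg_bernoulli {x a : ℝ} (hx : 0 < x) (ha : 0 ≤ a) : 1 + a * (1 - x) ≤ x ^ (-a) := by
  rw [Real.rpow_def_of_pos hx]
  have h1 := Real.add_one_le_exp (Real.log x * -a)
  have h2 := Real.log_le_sub_one_of_pos hx
  nlinarith

/-- The same telescoping with the primitive -t^{-a}/a, whose increments are bounded below by
`rpow_neg_bernoulli`. -/
lemma sum_rpow_tail_le {a : ℝ} (ha : 0 < a) {n M : ℕ} (hn : 1 ≤ n) (hM : n ≤ M) :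
    ∑ m ∈ Finset.Ioc n M, (m : ℝ) ^ (-1 - a) ≤ ((n : ℝ) ^ (-a) - (M : ℝ) ^ (-a)) / a := by
  induction M, hM using Nat.le_induction with
  | base => simp
  | succ M hM ih =>
    rw [← Finset.insert_Ioc_right_eq_Ioc_add_one (by omega), Finset.sum_insert (by simp)]
    set t : ℝ := ((M + 1 : ℕ) : ℝ) with ht
    have ht0 : 0 < t := by rw [ht]; positivity
    have hMpos : (0 : ℝ) < M := by exact_mod_cast (by omega : 0 < M)
    have hM' : (M : ℝ) = t * (1 - 1 / t) := by rw [ht]; push_cast; field_simp; ring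
    have hx : 0 < 1 - 1 / t := by
      have : 0 < t * (1 - 1 / t) := by rw [← hM']; exact hMpos
      exact (mul_pos_iff_of_pos_left ht0).1 this
    have h2 : t ^ (-a) + a * t ^ (-1 - a) ≤ (M : ℝ) ^ (-a) := by
      rw [hM', Real.mul_rpow ht0.le hx.le]
      calc _ = t ^ (-a) * (1 + a * (1 - (1 - 1 / t))) := by
            have : t ^ (-1 - a) = t ^ (-a) * (1 / t) := by
              rw [show -1 - a = -a - 1 by ring, Real.rpow_sub_one ht0.ne']; ring
            rw [this]; ring
        _ ≤ _ := by gcongr; exact rpow_neg_bernoulli hx ha.le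
    calc _ ≤ t ^ (-1 - a) + ((n : ℝ) ^ (-a) - (M : ℝ) ^ (-a)) / a := by gcongr
      _ ≤ t ^ (-1 - a) + ((n : ℝ) ^ (-a) - (t ^ (-a) + a * t ^ (-1 - a))) / a := by gcongr
      _ = _ := by field_simp; ring

/-- `∑ m^{-1-a} min(m/D, 1) ≲ D^{-a}`. -/
lemma sum_rpow_min_le {a : ℝ} (ha : 0 < a) (ha1 : a < 1) :
    ∃ C : ℝ, 0 < C ∧ ∀ (D : ℝ), 1 ≤ D → ∀ M : ℕ,
      ∑ m ∈ Finset.Icc 1 M, (m : ℝ) ^ (-1 - a) * min (m / D) 1 ≤ C * D ^ (-a) := by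
  have h1a : 0 < 1 - a := by linarith
  refine ⟨1 / (1 - a) + 2 ^ a / a, by positivity, fun D hD M => ?_⟩
  have hD0 : 0 < D := by linarith
  -- The minimum changes regime at m = D. Below it the exponent is -a, and a < 1 makes the sum of
  -- order D^{1-a}; above it the exponent is -1 - a, and a > 0 makes the tail of order D^{-a}.
  set n := ⌊D⌋₊ with hn
  have hn1 : 1 ≤ n := Nat.le_floor (by simpa using hD)
  have hnD : (n : ℝ) ≤ D := Nat.floor_le hD0.le
  have hDn : D ≤ 2 * n := by
    have := Nat.lt_floor_add_one D
    have h1 : (1 : ℝ) ≤ n := by exact_mod_cast hn1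
    linarith
  have hsub : Finset.Icc 1 M ⊆ Finset.Icc 1 n ∪ Finset.Ioc n (max n M) := by
    intro m hm
    simp only [Finset.mem_Icc, Finset.mem_union, Finset.mem_Ioc] at hm ⊢
    omega
  have hdisj : Disjoint (Finset.Icc 1 n) (Finset.Ioc n (max n M)) := by
    rw [Finset.disjoint_left]
    intro m hm hm'
    simp only [Finset.mem_Icc, Finset.mem_Ioc] at hm hm'
    omega
  have hfirst : ∑ m ∈ Finset.Icc 1 n, (m : ℝ) ^ (-1 - a) * min (m / D) 1
      ≤ 1 / (1 - a) * D ^ (-a) := by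
    calc _ ≤ ∑ m ∈ Finset.Icc 1 n, (m : ℝ) ^ (-a) * (1 / D) := by
          apply Finset.sum_le_sum
          intro m hm
          have hm0 : (0 : ℝ) < m := by
            simp only [Finset.mem_Icc] at hm
            exact_mod_cast (by omega : 0 < m)
          calc _ ≤ (m : ℝ) ^ (-1 - a) * (m / D) := by gcongr; exact min_le_left _ _
            _ = _ := by
              rw [show -a = (-1 - a) + 1 by ring, Real.rpow_add_one hm0.ne']; ring
      _ ≤ (D ^ (1 - a) / (1 - a)) * (1 / D) := by
          rw [← Finset.sum_mul]
          gcongr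
          refine (sum_rpow_neg_le ha ha1 n).trans ?_
          gcongr
      _ = _ := by
          rw [show -a = (1 - a) - 1 by ring, Real.rpow_sub_one hD0.ne']; ring
  have hsecond : ∑ m ∈ Finset.Ioc n (max n M), (m : ℝ) ^ (-1 - a) * min (m / D) 1
      ≤ 2 ^ a / a * D ^ (-a) := by
    calc _ ≤ ∑ m ∈ Finset.Ioc n (max n M), (m : ℝ) ^ (-1 - a) := by
          apply Finset.sum_le_sum
          intro m _
          calc _ ≤ (m : ℝ) ^ (-1 - a) * 1 := by gcongr; exact min_le_right _ _
            _ = _ := mul_one _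
      _ ≤ ((n : ℝ) ^ (-a) - ((max n M : ℕ) : ℝ) ^ (-a)) / a :=
          sum_rpow_tail_le ha hn1 (le_max_left _ _)
      _ ≤ (D / 2) ^ (-a) / a := by
          have h1 : (0 : ℝ) ≤ ((max n M : ℕ) : ℝ) ^ (-a) := by positivity
          have h2 : (n : ℝ) ^ (-a) ≤ (D / 2) ^ (-a) :=
            Real.rpow_le_rpow_of_nonpos (by positivity) (by linarith) (by linarith)
          gcongr
          linarith
      _ = _ := by
          rw [Real.div_rpow hD0.le (by norm_num), Real.rpow_neg (by norm_num : (0 : ℝ) ≤ 2)]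
          field_simp
  calc _ ≤ ∑ m ∈ Finset.Icc 1 n ∪ Finset.Ioc n (max n M), (m : ℝ) ^ (-1 - a) * min (m / D) 1 := by
        apply Finset.sum_le_sum_of_subset_of_nonneg hsub
        intro m _ _
        positivity
    _ ≤ _ := by rw [Finset.sum_union hdisj]; linarith

/-! ### Transition kernels and their iterates. -/

/-- A transition kernel on a countable state space. -/
structure IsTransition {X : Type*} (P : X → X → ℝ) : Prop where
  nonneg : ∀ x y, 0 ≤ P x y
  hasSum : ∀ x, HasSum (P x) 1

namespace IsTransition

variable {X : Type*} {P : X → X → ℝ} (hP : IsTransition P)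
include hP

lemma le_one (x y : X) : P x y ≤ 1 :=
  le_hasSum (hP.hasSum x) y fun z _ => hP.nonneg x z

lemma summable_mul {g : X → ℝ} {B : ℝ} (hg : ∀ z, |g z| ≤ B) (x : X) :
    Summable fun z => P x z * g z := by
  refine Summable.of_norm_bounded ((hP.hasSum x).summable.mul_right B) fun z => ?_
  rw [Real.norm_eq_abs, abs_mul, abs_of_nonneg (hP.nonneg x z)]
  exact mul_le_mul_of_nonneg_left (hg z) (hP.nonneg x z)

lemma op_one : transitionOp P (fun _ => 1) = fun _ => 1 := by
  funext x
  simp [transitionOp, (hP.hasSum x).tsum_eq]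

lemma iterate_one (n : ℕ) : (transitionOp P)^[n] (fun _ => 1) = fun _ => 1 :=
  Function.iterate_fixed hP.op_one n

lemma op_abs_le {g : X → ℝ} {B : ℝ} (hg : ∀ z, |g z| ≤ B) (x : X) : |transitionOp P g x| ≤ B := by
  have h := hP.summable_mul hg x
  have h1 : HasSum (fun z => P x z * B) B := by simpa using (hP.hasSum x).mul_right B
  rw [transitionOp, abs_le]
  constructor
  · have h2 : HasSum (fun z => P x z * -B) (-B) := by simpa using (hP.hasSum x).mul_right (-B)
    exact hasSum_le (fun z => mul_le_mul_of_nonneg_left (abs_le.1 (hg z)).1 (hP.nonneg x z)) h2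
      h.hasSum
  · exact hasSum_le (fun z => mul_le_mul_of_nonneg_left (abs_le.1 (hg z)).2 (hP.nonneg x z))
      h.hasSum h1

lemma iterate_abs_le {g : X → ℝ} {B : ℝ} (hg : ∀ z, |g z| ≤ B) (n : ℕ) (x : X) :
    |(transitionOp P)^[n] g x| ≤ B := by
  induction n generalizing g with
  | zero => exact hg x
  | succ n ih => rw [Function.iterate_succ_apply]; exact ih fun z => hP.op_abs_le hg z

omit hP in
lemma op_nonneg (hP : ∀ x y, 0 ≤ P x y) {g : X → ℝ} (hg : ∀ z, 0 ≤ g z) (x : X) :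
    0 ≤ transitionOp P g x :=
  tsum_nonneg fun z => mul_nonneg (hP x z) (hg z)

lemma iterate_nonneg {g : X → ℝ} (hg : ∀ z, 0 ≤ g z) (n : ℕ) (x : X) :
    0 ≤ (transitionOp P)^[n] g x := by
  induction n generalizing g with
  | zero => exact hg x
  | succ n ih => rw [Function.iterate_succ_apply]; exact ih fun z => op_nonneg hP.nonneg hg z

omit hP in
lemma abs_indicator_le (S : Set X) (z : X) : |S.indicator (1 : X → ℝ) z| ≤ 1 := by
  by_cases h : z ∈ S <;> simp [h]

lemma nStep_nonneg (n : ℕ) (x y : X) : 0 ≤ nStep P n x y :=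
  hP.iterate_nonneg (fun z => Set.indicator_nonneg (fun _ _ => zero_le_one) z) n x

lemma iterate_indicator_nonneg (S : Set X) (n : ℕ) (x : X) :
    0 ≤ (transitionOp P)^[n] (S.indicator 1) x :=
  hP.iterate_nonneg (fun z => Set.indicator_nonneg (fun _ _ => zero_le_one) z) n x

lemma iterate_indicator_le_one (S : Set X) (n : ℕ) (x : X) :
    (transitionOp P)^[n] (S.indicator 1) x ≤ 1 :=
  (abs_le.1 (hP.iterate_abs_le (abs_indicator_le S) n x)).2

/-- Fubini: the double family is dominated by `P x y * (nStep P n y z * B)`, which is summable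
because the rows of `nStep P n` have mass one, by the induction hypothesis applied to the constant
function. -/
lemma hasSum_nStep_mul {u : X → ℝ} {B : ℝ} (hu : ∀ z, |u z| ≤ B) (n : ℕ) (x : X) :
    HasSum (fun z => nStep P n x z * u z) ((transitionOp P)^[n] u x) := by
  classical
  induction n generalizing u B x with
  | zero =>
    have : (fun z => nStep P 0 x z * u z) = fun z => if z = x then u x else 0 := by
      funext z
      by_cases h : z = x
      · subst h; simp [nStep]
      · simp [nStep, h, Ne.symm h]
    rw [this]
    exact hasSum_ite_eq x (u x)
  | succ n ih =>
    have h1 : ∀ y, HasSum (fun z => nStep P n y z) 1 := fun y => by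
      have := ih (u := fun _ => 1) (B := 1) (by simp) y
      rw [hP.iterate_one] at this
      simpa using this
    have hB : 0 ≤ B := (abs_nonneg _).trans (hu x)
    have hs : Summable fun p : X × X => P x p.1 * (nStep P n p.1 p.2 * u p.2) := by
      have h0 : Summable fun p : X × X => P x p.1 * (nStep P n p.1 p.2 * B) := by
        rw [summable_prod_of_nonneg]
        · have h2 : ∀ y, HasSum (fun z => P x y * (nStep P n y z * B)) (P x y * (1 * B)) :=
            fun y => ((h1 y).mul_right B).mul_left (P x y)
          refine ⟨fun y => (h2 y).summable, ?_⟩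
          have h3 : (fun y => ∑' z, P x y * (nStep P n y z * B)) = fun y => P x y * (1 * B) :=
            funext fun y => (h2 y).tsum_eq
          exact h3 ▸ (hP.hasSum x).summable.mul_right (1 * B)
        · intro p
          exact mul_nonneg (hP.nonneg _ _) (mul_nonneg (hP.nStep_nonneg _ _ _) hB)
      refine Summable.of_norm_bounded h0 fun p => ?_
      rw [Real.norm_eq_abs, abs_mul, abs_mul, abs_of_nonneg (hP.nonneg _ _),
        abs_of_nonneg (hP.nStep_nonneg _ _ _)]
      exact mul_le_mul_of_nonneg_left (mul_le_mul_of_nonneg_left (hu _) (hP.nStep_nonneg _ _ _))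
        (hP.nonneg _ _)
    have e1 := hs.hasSum.prod_fiberwise fun y => (ih hu y).mul_left (P x y)
    have e2 : HasSum (fun z => ∑' y, P x y * (nStep P n y z * u z)) _ :=
      hs.prod_symm.hasSum.prod_fiberwise fun z => (hs.prod_symm.prod_factor z).hasSum
    have e3 : (transitionOp P)^[n + 1] u x
        = ∑' p : X × X, P x p.1 * (nStep P n p.1 p.2 * u p.2) := by
      rw [Function.iterate_succ_apply', transitionOp]
      exact e1.tsum_eq
    rw [e3, show (∑' p : X × X, P x p.1 * (nStep P n p.1 p.2 * u p.2))
      = ∑' c : X × X, P x c.swap.1 * (nStep P n c.swap.1 c.swap.2 * u c.swap.2) from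
        ((Equiv.prodComm X X).tsum_eq
          (fun p : X × X => P x p.1 * (nStep P n p.1 p.2 * u p.2))).symm]
    convert e2 using 2 with z
    rw [nStep, Function.iterate_succ_apply', transitionOp, ← tsum_mul_right]
    exact tsum_congr fun y => by rw [nStep]; ring

lemma hasSum_nStep (n : ℕ) (x : X) : HasSum (nStep P n x) 1 := by
  have := hP.hasSum_nStep_mul (u := fun _ => 1) (B := 1) (by simp) n x
  rw [hP.iterate_one] at this
  simpa using this

omit hP in
lemma op_indicator_singleton (x y : X) : transitionOp P (Set.indicator {y} 1) x = P x y := by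
  classical
  rw [transitionOp, tsum_eq_single y]
  · simp
  · intro z hz; simp [hz]

lemma nStep_reversible {μ : X → ℝ} (hrev : ∀ x y, μ x * P x y = μ y * P y x) (n : ℕ) (x y : X) :
    μ x * nStep P n x y = μ y * nStep P n y x := by
  induction n generalizing x y with
  | zero =>
    by_cases h : x = y
    · subst h; rfl
    · simp [nStep, h, Ne.symm h]
  | succ n ih =>
    -- One side is expanded at its last step and the other at its first, so that detailed balance
    -- matches them term by term.
    have h1 : nStep P (n + 1) y x = ∑' z, nStep P n y z * P z x := by
      have := hP.hasSum_nStep_mul (u := fun z => P z x) (B := 1)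
        (fun z => by rw [abs_of_nonneg (hP.nonneg _ _)]; exact hP.le_one _ _) n y
      rw [this.tsum_eq, nStep, Function.iterate_succ_apply]
      exact congrArg (fun g => (transitionOp P)^[n] g y)
        (funext fun z => op_indicator_singleton z x)
    have h2 : nStep P (n + 1) x y = ∑' z, P x z * nStep P n z y := by
      rw [nStep, Function.iterate_succ_apply']; rfl
    rw [h1, h2, ← tsum_mul_left, ← tsum_mul_left]
    refine tsum_congr fun z => ?_
    calc _ = (μ x * P x z) * nStep P n z y := by ring
      _ = P z x * (μ z * nStep P n z y) := by rw [hrev]; ring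
      _ = _ := by rw [ih z y]; ring

end IsTransition

/-! ### Exhaustion by finite sets. -/

/-- The restriction of `transitionOp P` to a finite set of states. -/
noncomputable def finiteOp {X : Type*} (P : X → X → ℝ) (Ω : Finset X) (g : X → ℝ) (x : X) : ℝ :=
  ∑ z ∈ Ω, P x z * g z

namespace IsTransition

variable {X : Type*} {P : X → X → ℝ} (hP : IsTransition P)
include hP

lemma finiteOp_abs_le {g : X → ℝ} {B : ℝ} (hg : ∀ z, |g z| ≤ B) (Ω : Finset X) (x : X) :
    |finiteOp P Ω g x| ≤ B := by
  have hB : 0 ≤ B := (abs_nonneg _).trans (hg x)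
  calc |finiteOp P Ω g x| ≤ ∑ z ∈ Ω, |P x z * g z| := Finset.abs_sum_le_sum_abs _ _
    _ ≤ ∑ z ∈ Ω, P x z * B := by
      refine Finset.sum_le_sum fun z _ => ?_
      rw [abs_mul, abs_of_nonneg (hP.nonneg x z)]
      exact mul_le_mul_of_nonneg_left (hg z) (hP.nonneg x z)
    _ ≤ 1 * B := by
      rw [← Finset.sum_mul]
      gcongr
      exact sum_le_hasSum Ω (fun z _ => hP.nonneg x z) (hP.hasSum x)
    _ = B := one_mul B

lemma finiteOp_iterate_abs_le {g : X → ℝ} {B : ℝ} (hg : ∀ z, |g z| ≤ B) (Ω : Finset X) (n : ℕ)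
    (x : X) : |(finiteOp P Ω)^[n] g x| ≤ B := by
  induction n generalizing g with
  | zero => exact hg x
  | succ n ih => rw [Function.iterate_succ_apply]; exact ih fun z => hP.finiteOp_abs_le hg Ω z

/-- Dominated convergence at each step, with majorant `P x z * B`. It transfers estimates on finite
matrices, uniform in Ω, to the whole space. -/
lemma tendsto_finiteOp_iterate {g : X → ℝ} {B : ℝ} (hg : ∀ z, |g z| ≤ B) (n : ℕ) (x : X) :
    Filter.Tendsto (fun Ω : Finset X => (finiteOp P Ω)^[n] g x) Filter.atTop
      (nhds ((transitionOp P)^[n] g x)) := by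
  classical
  induction n generalizing x with
  | zero => exact tendsto_const_nhds
  | succ n ih =>
    simp only [Function.iterate_succ_apply']
    have hrw : ∀ Ω : Finset X, finiteOp P Ω ((finiteOp P Ω)^[n] g) x
        = ∑' z, if z ∈ Ω then P x z * (finiteOp P Ω)^[n] g z else 0 := by
      intro Ω
      rw [tsum_eq_sum (s := Ω) (fun z hz => by simp [hz]), finiteOp]
      exact Finset.sum_congr rfl fun z hz => by simp [hz]
    simp only [hrw]
    refine tendsto_tsum_of_dominated_convergence (bound := fun z => P x z * B)
      ((hP.hasSum x).summable.mul_right B) (fun z => ?_) (Filter.Eventually.of_forall fun Ω z => ?_)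
    · refine ((ih z).const_mul (P x z)).congr' ?_
      filter_upwards [Filter.eventually_ge_atTop {z}] with Ω hΩ
      simp [hΩ (Finset.mem_singleton_self z)]
    · have hB : 0 ≤ B := (abs_nonneg _).trans (hg x)
      split_ifs
      · rw [Real.norm_eq_abs, abs_mul, abs_of_nonneg (hP.nonneg x z)]
        exact mul_le_mul_of_nonneg_left (hP.finiteOp_iterate_abs_le hg Ω n z) (hP.nonneg x z)
      · simpa using mul_nonneg (hP.nonneg x z) hB

end IsTransition

/-! ### Polynomial consequences of the sub-Gaussian bound, and potentials. -/

lemma exists_rpow_mul_exp_neg_le (p : ℝ) (hp : 0 ≤ p) :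
    ∃ C : ℝ, 0 < C ∧ ∀ y : ℝ, 0 ≤ y → y ^ p * Real.exp (-y) ≤ C := by
  set n := ⌈p⌉₊ with hn
  refine ⟨1 + n.factorial, by positivity, fun y hy => ?_⟩
  have h1 : y ^ p ≤ 1 + y ^ n := by
    rcases le_total y 1 with h | h
    · have : y ^ p ≤ 1 := Real.rpow_le_one hy h hp
      have : 0 ≤ y ^ n := by positivity
      linarith
    · have : y ^ p ≤ y ^ (n : ℝ) := Real.rpow_le_rpow_of_exponent_le h (Nat.le_ceil p)
      rw [Real.rpow_natCast] at this
      linarith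
  have h2 := Real.pow_div_factorial_le_exp y hy n
  have h3 : y ^ n ≤ n.factorial * Real.exp y := by
    rw [div_le_iff₀ (by positivity)] at h2; linarith
  have h4 : 1 ≤ Real.exp y := Real.one_le_exp hy
  rw [Real.exp_neg, ← div_eq_mul_inv, div_le_iff₀ (Real.exp_pos y)]
  nlinarith

lemma exists_rpow_mul_exp_neg_rpow_le {b e C : ℝ} (hb : 0 ≤ b) (he : 0 < e) (hC : 0 < C) :
    ∃ C' : ℝ, 0 < C' ∧ ∀ x : ℝ, 0 ≤ x → x ^ b * Real.exp (-(x / C) ^ e) ≤ C' := by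
  obtain ⟨A, hA, h⟩ := exists_rpow_mul_exp_neg_le (b / e) (by positivity)
  refine ⟨C ^ b * A, by positivity, fun x hx => ?_⟩
  have h1 := h ((x / C) ^ e) (by positivity)
  rw [← Real.rpow_mul (by positivity), mul_div_cancel₀ _ he.ne', Real.div_rpow hx hC.le] at h1
  calc _ = C ^ b * (x ^ b / C ^ b * Real.exp (-(x / C) ^ e)) := by field_simp
    _ ≤ _ := by gcongr

namespace WeightedGraph

variable {X : Type*} {W : WeightedGraph X}

lemma one_add_d_le {x y : X} (h : x ≠ y) : 1 + (W.d x y : ℝ) ≤ 2 * W.d x y := by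
  linarith [W.one_le_d h]

lemma d_rpow_neg_le {x y : X} (h : x ≠ y) {s : ℝ} (hs : 0 ≤ s) :
    (W.d x y : ℝ) ^ (-s) ≤ 2 ^ s * (1 + (W.d x y : ℝ)) ^ (-s) := by
  have h1 := W.one_le_d h
  have h2 : ((2 : ℝ) * W.d x y) ^ (-s) ≤ (1 + (W.d x y : ℝ)) ^ (-s) :=
    Real.rpow_le_rpow_of_nonpos (by linarith) (one_add_d_le h) (by linarith)
  rw [Real.mul_rpow (by norm_num) (by linarith), Real.rpow_neg (by norm_num : (0 : ℝ) ≤ 2)] at h2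
  calc _ = 2 ^ s * ((2 ^ s)⁻¹ * (W.d x y : ℝ) ^ (-s)) := by field_simp
    _ ≤ _ := by gcongr

lemma one_add_d_rpow_neg_le {x y : X} (h : x ≠ y) {s : ℝ} (hs : 0 ≤ s) :
    (1 + (W.d x y : ℝ)) ^ (-s) ≤ (W.d x y : ℝ) ^ (-s) :=
  Real.rpow_le_rpow_of_nonpos (by linarith [W.one_le_d h]) (by linarith) (by linarith)

lemma isTransition_walk (hμ : W.ComparableToCounting) : IsTransition W.walk where
  nonneg x y := div_nonneg (W.weight_nonneg x y) (hμ.vol_pos x).le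
  hasSum x := by
    have hs : Summable (W.weight x) := by
      refine summable_of_hasFiniteSupport ((W.locallyFinite x).subset fun y hy => ?_)
      exact lt_of_le_of_ne (W.weight_nonneg x y) (Ne.symm hy)
    have := hs.hasSum.div_const (W.vol x)
    rwa [show (∑' y, W.weight x y) / W.vol x = 1 from div_self (hμ.vol_pos x).ne'] at this

lemma heatKernel_mul_vol (hμ : W.ComparableToCounting) (n : ℕ) (x y : X) :
    W.heatKernel n x y * W.vol y = nStep W.walk n x y :=
  div_mul_cancel₀ _ (hμ.vol_pos y).ne'

lemma heatKernel_nonneg (hμ : W.ComparableToCounting) (n : ℕ) (x y : X) :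
    0 ≤ W.heatKernel n x y :=
  div_nonneg ((isTransition_walk hμ).nStep_nonneg n x y) (hμ.vol_pos y).le

lemma heatKernel_symm (hμ : W.ComparableToCounting) (n : ℕ) (x y : X) :
    W.heatKernel n x y = W.heatKernel n y x := by
  have h := (isTransition_walk hμ).nStep_reversible (μ := W.vol) (fun x y => by
    rw [walk, walk, mul_div_cancel₀ _ (hμ.vol_pos x).ne', mul_div_cancel₀ _ (hμ.vol_pos y).ne',
      W.weight_symm]) n x y
  rw [heatKernel, heatKernel, div_eq_div_iff (hμ.vol_pos y).ne' (hμ.vol_pos x).ne']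
  linarith

/-- The sub-Gaussian upper bound implies a polynomial one. -/
lemma USG.heatKernel_le {df dw : ℝ} (hU : W.USG df dw) (hdf : 0 < df) (hdw : 1 < dw) :
    ∃ C : ℝ, 0 < C ∧ ∀ (m : ℕ) (x y : X), 1 ≤ m → x ≠ y →
      W.heatKernel m x y ≤ C * (W.d x y : ℝ) ^ (-df) * min (m / (W.d x y : ℝ) ^ dw) 1 := by
  obtain ⟨C, hC, h⟩ := hU
  -- With x = d^dw / m the prefactor m^{-df/dw} equals d^{-df} x^{df/dw}; the one further power of x
  -- pays for the factor 1/x = m / d^dw.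
  obtain ⟨A, hA, hexp⟩ := exists_rpow_mul_exp_neg_rpow_le (b := 1 + df / dw) (e := 1 / (dw - 1))
    (by positivity) (by apply one_div_pos.2; linarith) hC
  refine ⟨C * (A + 1), by positivity, fun m x y hm hxy => (h m x y hm).trans ?_⟩
  have hd1 := W.one_le_d hxy
  set t := (W.d x y : ℝ) with ht
  have ht0 : 0 < t := by linarith
  have hm0 : (0 : ℝ) < m := by exact_mod_cast (by omega : 0 < m)
  have hD : 0 < t ^ dw := by positivity
  have hdw0 : 0 < dw := by linarith
  have hDpow : (t ^ dw) ^ (df / dw) = t ^ df := by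
    rw [← Real.rpow_mul ht0.le, mul_div_cancel₀ _ hdw0.ne']
  have hbase : C / (m : ℝ) ^ (df / dw) = C * t ^ (-df) * (t ^ dw / m) ^ (df / dw) := by
    rw [Real.div_rpow hD.le hm0.le, hDpow, Real.rpow_neg ht0.le]
    field_simp
  rw [hbase, show t ^ dw / (C * m) = (t ^ dw / m) / C by field_simp]
  set x' := t ^ dw / m with hx'
  have hx0 : 0 < x' := by positivity
  have hmD : (m : ℝ) / t ^ dw = x'⁻¹ := by rw [hx', inv_div]
  rw [hmD, mul_assoc, show C * (A + 1) * t ^ (-df) * min x'⁻¹ 1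
    = C * t ^ (-df) * ((A + 1) * min x'⁻¹ 1) by ring]
  refine mul_le_mul_of_nonneg_left ?_ (by positivity)
  rcases le_total x' 1 with hx1 | hx1
  · rw [min_eq_right (one_le_inv₀ hx0 |>.2 hx1)]
    have h1 : x' ^ (df / dw) ≤ 1 := Real.rpow_le_one hx0.le hx1 (by positivity)
    have h2 : Real.exp (-(x' / C) ^ (1 / (dw - 1))) ≤ 1 :=
      Real.exp_le_one_iff.2 (neg_nonpos.2 (by positivity))
    have h3 := mul_le_one₀ h1 (Real.exp_pos _).le h2
    linarith
  · rw [min_eq_left (inv_le_one_of_one_le₀ hx1)]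
    have h1 := hexp x' hx0.le
    rw [Real.rpow_add hx0, Real.rpow_one] at h1
    rw [← div_eq_mul_inv, le_div_iff₀ hx0]
    linarith

/-- The polynomial bound p_m ≲ m d^{-(df+dw)} is enough: its sum over d ≥ r is a volume tail of
exponent dw. -/
lemma walk_tail_le {df dw : ℝ} (hμ : W.ComparableToCounting) (hV : W.VolumeGrowth df)
    (hU : W.USG df dw) (hdf : 0 < df) (hdw : 1 < dw) :
    ∃ C : ℝ, 0 < C ∧ ∀ (m : ℕ) (y : X) (r : ℝ), 1 ≤ r → ∀ F : Set X,
      (∀ z ∈ F, r ≤ (W.d y z : ℝ)) →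
      (transitionOp W.walk)^[m] (F.indicator 1) y ≤ C * m * r ^ (-dw) := by
  classical
  obtain ⟨A, hA, hheat⟩ := hU.heatKernel_le hdf hdw
  have hdw0 : 0 < dw := by linarith
  obtain ⟨B, hB, htail⟩ := hV.tail_sum_le hμ hdf hdw0
  refine ⟨A * 2 ^ (df + dw) * B, by positivity, fun m y r hr F hF => ?_⟩
  have hr0 : 0 < r := by linarith
  rcases Nat.eq_zero_or_pos m with rfl | hm
  · have : y ∉ F := fun h => by
      have := hF y h; rw [W.d_self] at this; simp at this; linarith
    simp [this]
  have hs := (isTransition_walk hμ).hasSum_nStep_mul (IsTransition.abs_indicator_le F) m y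
  refine hasSum_le_of_sum_le hs fun S => ?_
  have hne : ∀ z ∈ F, y ≠ z := fun z hz h => by
    have := hF z hz; rw [← h, W.d_self] at this; simp at this; linarith
  calc ∑ z ∈ S, nStep W.walk m y z * F.indicator 1 z
      = ∑ z ∈ S with z ∈ F, nStep W.walk m y z := by
        rw [Finset.sum_filter]
        exact Finset.sum_congr rfl fun z _ => by by_cases h : z ∈ F <;> simp [h]
    _ ≤ ∑ z ∈ S with z ∈ F, A * 2 ^ (df + dw) * m *
          (W.vol z * (1 + (W.d y z : ℝ)) ^ (-(df + dw))) := by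
        refine Finset.sum_le_sum fun z hz => ?_
        simp only [Finset.mem_filter] at hz
        have hyz := hne z hz.2
        have hd0 : (0 : ℝ) < W.d y z := by linarith [W.one_le_d hyz]
        rw [← heatKernel_mul_vol hμ]
        have h1 : W.heatKernel m y z ≤ A * (W.d y z : ℝ) ^ (-df) * (m / (W.d y z : ℝ) ^ dw) :=
          (hheat m y z hm hyz).trans (by gcongr; exact min_le_left _ _)
        have h2 : A * (W.d y z : ℝ) ^ (-df) * (m / (W.d y z : ℝ) ^ dw)
            = A * m * (W.d y z : ℝ) ^ (-(df + dw)) := by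
          rw [neg_add, Real.rpow_add hd0, Real.rpow_neg hd0.le dw]; field_simp
        have h3 := d_rpow_neg_le (W := W) hyz (s := df + dw) (by positivity)
        calc _ ≤ A * m * (2 ^ (df + dw) * (1 + (W.d y z : ℝ)) ^ (-(df + dw))) * W.vol z := by
              have := (hμ.vol_pos z).le
              gcongr
              rw [h2] at h1
              exact h1.trans (by gcongr)
          _ = _ := by ring
    _ ≤ A * 2 ^ (df + dw) * m * (B * r ^ (-dw)) := by
        rw [← Finset.mul_sum]
        gcongr
        apply htail y r hr
        intro z hz
        simp only [Finset.mem_filter] at hz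
        linarith [hF z hz.2]
    _ = _ := by ring

/-- A potential that separates a set from its complement at scale `r` and is nearly
superharmonic for the walk at that scale. -/
lemma exists_potential {df dw : ℝ} (hμ : W.ComparableToCounting) (hV : W.VolumeGrowth df)
    (hU : W.USG df dw) (hdf : 0 < df) (hdw : 1 < dw) :
    ∃ c : ℝ, 0 < c ∧ ∀ r : ℝ, 1 ≤ r → 1 ≤ c * r ^ dw → ∀ E : Set X, ∃ u : X → ℝ,
      (∀ y, 0 ≤ u y) ∧ (∀ y, u y ≤ 1) ∧
      (∀ y, (∀ z, (W.d y z : ℝ) < r → z ∈ E) → 3 / 4 ≤ u y) ∧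
      (∀ y, (∀ z, (W.d y z : ℝ) < r → z ∉ E) → u y ≤ 1 / 4) ∧
      ∀ (m : ℕ) (y : X), (transitionOp W.walk)^[m] u y - u y ≤ min (m / (c * r ^ dw)) 1 := by
  obtain ⟨A, hA, htail⟩ := walk_tail_le hμ hV hU hdf hdw
  have hP := isTransition_walk hμ
  refine ⟨1 / (8 * A), by positivity, fun r hr hcr E => ?_⟩
  have hr0 : 0 < r := by linarith
  -- During fewer than ⌈L⌉ steps the walk travels distance r with probability at most 1/4. Rounding
  -- L up costs a factor 2, hence 8A instead of 4A.
  set L := 1 / (8 * A) * r ^ dw with hL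
  set T := ⌈L⌉₊ with hT
  have hLT : L ≤ T := Nat.le_ceil L
  have hT0 : (0 : ℝ) < T := by linarith
  have hTL : (T : ℝ) ≤ 2 * L := by
    have := Nat.ceil_lt_add_one (a := L) (by linarith)
    linarith
  have hbound : ∀ n ∈ Finset.range T, A * (n : ℝ) * r ^ (-dw) ≤ 1 / 4 := by
    intro n hn
    have hn' : (n : ℝ) ≤ T := by exact_mod_cast (Finset.mem_range.1 hn).le
    calc A * (n : ℝ) * r ^ (-dw) ≤ A * (2 * L) * r ^ (-dw) := by gcongr; linarith
      _ = 1 / 4 := by rw [hL, Real.rpow_neg hr0.le]; field_simp; norm_num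
  set Q : ℕ → X → ℝ := fun n => (transitionOp W.walk)^[n] (E.indicator 1) with hQ
  have hQ0 : ∀ n y, 0 ≤ Q n y := fun n y => hP.iterate_indicator_nonneg E n y
  have hQ1 : ∀ n y, Q n y ≤ 1 := fun n y => hP.iterate_indicator_le_one E n y
  have havg_le : ∀ (y : X) (b : ℝ), (∀ n ∈ Finset.range T, Q n y ≤ b) →
      (1 / T) * ∑ n ∈ Finset.range T, Q n y ≤ b := by
    intro y b hb
    have := Finset.sum_le_card_nsmul _ _ _ hb
    rw [Finset.card_range, nsmul_eq_mul] at this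
    rw [one_div, inv_mul_le_iff₀ hT0]; exact this
  have havg_ge : ∀ (y : X) (b : ℝ), (∀ n ∈ Finset.range T, b ≤ Q n y) →
      b ≤ (1 / T) * ∑ n ∈ Finset.range T, Q n y := by
    intro y b hb
    have := Finset.card_nsmul_le_sum _ _ _ hb
    rw [Finset.card_range, nsmul_eq_mul] at this
    rw [one_div, le_inv_mul_iff₀ hT0]; exact this
  -- Each P^n 1_E with n < T already separates E from its complement at scale r. Averaging in time
  -- is what makes P^m u - u small.
  set u : X → ℝ := fun y => (1 / T) * ∑ n ∈ Finset.range T, Q n y with hu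
  have hu0 : ∀ y, 0 ≤ u y := fun y => havg_ge y 0 fun n _ => hQ0 n y
  have hu1 : ∀ y, u y ≤ 1 := fun y => havg_le y 1 fun n _ => hQ1 n y
  refine ⟨u, hu0, hu1, ?_, ?_, ?_⟩
  · intro y hy
    refine havg_ge y _ fun n hn => ?_
    have h1 := htail n y r hr Eᶜ (fun z hz => by
      by_contra h; exact hz (hy z (not_le.1 h)))
    have h2 : HasSum (fun z => nStep W.walk n y z * (E.indicator 1 z + Eᶜ.indicator 1 z))
        (Q n y + (transitionOp W.walk)^[n] (Eᶜ.indicator 1) y) := by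
      simp only [mul_add]
      exact (hP.hasSum_nStep_mul (IsTransition.abs_indicator_le E) n y).add
        (hP.hasSum_nStep_mul (IsTransition.abs_indicator_le Eᶜ) n y)
    have h3 : HasSum (fun z => nStep W.walk n y z * (E.indicator 1 z + Eᶜ.indicator 1 z)) 1 := by
      convert hP.hasSum_nStep n y using 2 with z
      have : E.indicator (1 : X → ℝ) z + Eᶜ.indicator 1 z = 1 := by
        by_cases h : z ∈ E <;> simp [h]
      rw [this, mul_one]
    have h4 := h2.unique h3
    linarith [hbound n hn]
  · intro y hy
    refine havg_le y _ fun n hn => (htail n y r hr E fun z hz => ?_).trans (hbound n hn)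
    by_contra h; exact hy z (not_le.1 h) hz
  · intro m y
    have hiter : (transitionOp W.walk)^[m] u y
        = (1 / T) * ∑ n ∈ Finset.range T, Q (m + n) y := by
      have h1 := hP.hasSum_nStep_mul (u := u) (B := 1)
        (fun z => abs_le.2 ⟨by linarith [hu0 z], hu1 z⟩) m y
      have h2 : HasSum (fun z => (1 / (T : ℝ)) * ∑ n ∈ Finset.range T, nStep W.walk m y z * Q n z)
          ((1 / T) * ∑ n ∈ Finset.range T, Q (m + n) y) := by
        refine HasSum.mul_left _ (hasSum_sum fun n _ => ?_)
        have := hP.hasSum_nStep_mul (u := Q n) (B := 1)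
          (fun z => abs_le.2 ⟨by linarith [hQ0 n z], hQ1 n z⟩) m y
        rwa [← Function.iterate_add_apply] at this
      refine h1.unique ?_
      convert h2 using 2 with z
      rw [hu, ← Finset.mul_sum]; ring
    refine le_min ?_ ?_
    · have h1 : ∑ n ∈ Finset.range T, Q (m + n) y - ∑ n ∈ Finset.range T, Q n y ≤ m := by
        have e1 := Finset.sum_range_add (fun n => Q n y) m T
        have e2 := Finset.sum_range_add (fun n => Q n y) T m
        rw [Nat.add_comm] at e2
        have e3 : 0 ≤ ∑ n ∈ Finset.range m, Q n y := Finset.sum_nonneg fun n _ => hQ0 n y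
        have e4 : ∑ n ∈ Finset.range m, Q (T + n) y ≤ m := by
          have := Finset.sum_le_card_nsmul (Finset.range m) (fun n => Q (T + n) y) 1
            fun n _ => hQ1 _ y
          simpa using this
        linarith
      rw [hiter, hu, ← mul_sub]
      calc _ ≤ (1 / (T : ℝ)) * m := by gcongr
        _ = m / T := by ring
        _ ≤ m / L := by gcongr
    · have h1 := (abs_le.1 (hP.iterate_abs_le (g := u) (B := 1)
        (fun z => abs_le.2 ⟨by linarith [hu0 z], hu1 z⟩) m y)).2
      linarith [hu0 y]

/-! ### The subordinated reference kernel and its bump functions. -/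

/-- A finite-range subordination of the walk. -/
noncomputable def refKernel (W : WeightedGraph X) (a : ℝ) (M : ℕ) (y z : X) : ℝ :=
  ∑ m ∈ Finset.Icc 1 M, (m : ℝ) ^ (-1 - a) * W.heatKernel m y z

lemma refKernel_nonneg (hμ : W.ComparableToCounting) (a : ℝ) (M : ℕ) (y z : X) :
    0 ≤ W.refKernel a M y z :=
  Finset.sum_nonneg fun m _ => mul_nonneg (by positivity) (heatKernel_nonneg hμ m y z)

lemma refKernel_symm (hμ : W.ComparableToCounting) (a : ℝ) (M : ℕ) (y z : X) :
    W.refKernel a M y z = W.refKernel a M z y :=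
  Finset.sum_congr rfl fun m _ => by rw [heatKernel_symm hμ]

/-- The weights m^{-1-β/dw} are those of a stable subordinator of index β/dw, less than one because
β < dw. Summing d^{-df} min(m/d^dw, 1) against them gives d^{-df} (d^dw)^{-β/dw}. -/
lemma refKernel_le {df dw β : ℝ} (hU : W.USG df dw) (hdf : 0 < df)
    (hdw : 1 < dw) (hβ : 0 < β) (hβw : β < dw) :
    ∃ C : ℝ, 0 < C ∧ ∀ (M : ℕ) (y z : X), y ≠ z →
      W.refKernel (β / dw) M y z ≤ C * (1 + (W.d y z : ℝ)) ^ (-(df + β)) := by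
  obtain ⟨A, hA, hheat⟩ := hU.heatKernel_le hdf hdw
  have hdw0 : 0 < dw := by linarith
  obtain ⟨B, hB, hsum⟩ := sum_rpow_min_le (a := β / dw) (by positivity)
    (by rw [div_lt_one hdw0]; exact hβw)
  refine ⟨A * B * 2 ^ (df + β), by positivity, fun M y z hyz => ?_⟩
  have hd1 := W.one_le_d hyz
  have hd0 : (0 : ℝ) < W.d y z := by linarith
  have hD : 1 ≤ (W.d y z : ℝ) ^ dw := Real.one_le_rpow hd1 hdw0.le
  calc W.refKernel (β / dw) M y z
      ≤ ∑ m ∈ Finset.Icc 1 M, A * (W.d y z : ℝ) ^ (-df) *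
          ((m : ℝ) ^ (-1 - β / dw) * min (m / (W.d y z : ℝ) ^ dw) 1) := by
        refine Finset.sum_le_sum fun m hm => ?_
        calc _ ≤ (m : ℝ) ^ (-1 - β / dw) *
              (A * (W.d y z : ℝ) ^ (-df) * min (m / (W.d y z : ℝ) ^ dw) 1) := by
              gcongr; exact hheat m y z (Finset.mem_Icc.1 hm).1 hyz
          _ = _ := by ring
    _ ≤ A * (W.d y z : ℝ) ^ (-df) * (B * ((W.d y z : ℝ) ^ dw) ^ (-(β / dw))) := by
        rw [← Finset.mul_sum]; gcongr; exact hsum _ hD M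
    _ = A * B * (W.d y z : ℝ) ^ (-(df + β)) := by
        rw [← Real.rpow_mul hd0.le, mul_neg, mul_div_cancel₀ _ hdw0.ne', neg_add,
          Real.rpow_add hd0]; ring
    _ ≤ A * B * (2 ^ (df + β) * (1 + (W.d y z : ℝ)) ^ (-(df + β))) := by
        gcongr; exact d_rpow_neg_le hyz (by positivity)
    _ = _ := by ring

/-- Times of order d^dw suffice: there the exponential in the lower bound is bounded below, and
about d^dw terms each contribute a multiple of d^{-dw-β-df}. -/
lemma le_refKernel {df dw β : ℝ} (hμ : W.ComparableToCounting) (hL : W.LSG df dw) (hdf : 0 < df)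
    (hdw : 1 < dw) (hβ : 0 < β) :
    ∃ c : ℝ, 0 < c ∧ ∀ (M : ℕ) (y z : X), y ≠ z → 2 * ⌈(W.d y z : ℝ) ^ dw⌉₊ + 1 ≤ M →
      c * (1 + (W.d y z : ℝ)) ^ (-(df + β)) ≤ W.refKernel (β / dw) M y z := by
  obtain ⟨c, hc, h⟩ := hL
  have hdw0 : 0 < dw := by linarith
  set e := 1 / (dw - 1) with he
  have he0 : 0 < e := one_div_pos.2 (by linarith)
  set a := β / dw with ha
  have ha0 : 0 < a := by positivity
  set g := Real.exp (-(1 / c) ^ e) with hg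
  have hg0 : 0 < g := Real.exp_pos _
  refine ⟨c * g * 5 ^ (-1 - a - df / dw) * 2⁻¹, by positivity, fun M y z hyz hM => ?_⟩
  have hd1 := W.one_le_d hyz
  have hd0 : (0 : ℝ) < W.d y z := by linarith
  set t := (W.d y z : ℝ) with ht
  have hD : 1 ≤ t ^ dw := Real.one_le_rpow hd1 hdw0.le
  set D := ⌈t ^ dw⌉₊ with hDdef
  have hDle : t ^ dw ≤ D := Nat.le_ceil _
  have hD2 : (D : ℝ) ≤ 2 * t ^ dw := by
    have := Nat.ceil_lt_add_one (a := t ^ dw) (by linarith)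
    linarith
  have hD1 : 1 ≤ D := by
    have : (1 : ℝ) ≤ D := by linarith
    exact_mod_cast this
  have hdD : W.d y z ≤ D := by
    have h1 : t ^ (1 : ℝ) ≤ t ^ dw := Real.rpow_le_rpow_of_exponent_le hd1 hdw.le
    rw [Real.rpow_one] at h1
    have : (W.d y z : ℝ) ≤ D := h1.trans hDle
    exact_mod_cast this
  have h5 : ∀ m ∈ Finset.Ico D (2 * D), (5 * t ^ dw) ^ (-1 - a - df / dw) * (c * g)
      ≤ ((m : ℝ) ^ (-1 - a) * W.heatKernel m y z
        + ((m + 1 : ℕ) : ℝ) ^ (-1 - a) * W.heatKernel (m + 1) y z) := by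
    intro m hm
    rw [Finset.mem_Ico] at hm
    have hmD : (D : ℝ) ≤ m := by exact_mod_cast hm.1
    have hm1 : ((m + 1 : ℕ) : ℝ) ≤ 5 * t ^ dw := by
      have : ((m + 1 : ℕ) : ℝ) ≤ 2 * D := by exact_mod_cast hm.2
      linarith
    have hm0 : (0 : ℝ) < m := by linarith
    have hmm : (m : ℝ) ≤ 5 * t ^ dw := by push_cast at hm1; linarith
    have h1 := h m y z (max_le (hD1.trans hm.1) (hdD.trans hm.1))
    have h2 : (5 * t ^ dw) ^ (-(df / dw)) * (c * g) ≤
        W.heatKernel m y z + W.heatKernel (m + 1) y z := by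
      refine le_trans ?_ h1
      have e1 : (5 * t ^ dw) ^ (-(df / dw)) ≤ ((m : ℝ) ^ (df / dw))⁻¹ := by
        rw [← Real.rpow_neg hm0.le]
        exact Real.rpow_le_rpow_of_nonpos hm0 hmm (neg_nonpos.2 (by positivity))
      have e2 : g ≤ Real.exp (-((t ^ dw / (c * m)) ^ e)) := by
        rw [hg]
        apply Real.exp_le_exp.2
        apply neg_le_neg
        apply Real.rpow_le_rpow (by positivity) _ he0.le
        rw [div_le_div_iff₀ (by positivity) hc]
        nlinarith
      calc _ ≤ ((m : ℝ) ^ (df / dw))⁻¹ * (c * Real.exp (-((t ^ dw / (c * m)) ^ e))) := by gcongr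
        _ = _ := by ring
    have e3 : (5 * t ^ dw) ^ (-1 - a) ≤ (m : ℝ) ^ (-1 - a) :=
      Real.rpow_le_rpow_of_nonpos hm0 hmm (by linarith)
    have e4 : (5 * t ^ dw) ^ (-1 - a) ≤ ((m + 1 : ℕ) : ℝ) ^ (-1 - a) :=
      Real.rpow_le_rpow_of_nonpos (by positivity) hm1 (by linarith)
    have p1 := heatKernel_nonneg hμ m y z
    have p2 := heatKernel_nonneg hμ (m + 1) y z
    calc _ = (5 * t ^ dw) ^ (-1 - a) * ((5 * t ^ dw) ^ (-(df / dw)) * (c * g)) := by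
          rw [sub_eq_add_neg (-1 - a), Real.rpow_add (by positivity)]; ring
      _ ≤ (5 * t ^ dw) ^ (-1 - a) * (W.heatKernel m y z + W.heatKernel (m + 1) y z) := by gcongr
      _ ≤ _ := by rw [mul_add]; gcongr
  have h6 := Finset.sum_le_sum h5
  rw [Finset.sum_const, Nat.card_Ico, nsmul_eq_mul, Finset.sum_add_distrib] at h6
  have hnn : ∀ m : ℕ, 0 ≤ (m : ℝ) ^ (-1 - a) * W.heatKernel m y z := fun m =>
    mul_nonneg (by positivity) (heatKernel_nonneg hμ m y z)
  -- The hypothesis bounds only p_m + p_{m+1} from below. The sum over m and its shift by one are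
  -- both parts of the reference kernel, whence the factor 2 below.
  have h7 : ∑ m ∈ Finset.Ico D (2 * D), (m : ℝ) ^ (-1 - a) * W.heatKernel m y z
      ≤ W.refKernel a M y z := by
    refine Finset.sum_le_sum_of_subset_of_nonneg ?_ fun m _ _ => hnn m
    intro m hm
    simp only [Finset.mem_Ico, Finset.mem_Icc] at hm ⊢
    omega
  have h8 : ∑ m ∈ Finset.Ico D (2 * D), ((m + 1 : ℕ) : ℝ) ^ (-1 - a) * W.heatKernel (m + 1) y z
      ≤ W.refKernel a M y z := by
    rw [Finset.sum_Ico_add' (fun m : ℕ => (m : ℝ) ^ (-1 - a) * W.heatKernel m y z) D (2 * D) 1]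
    refine Finset.sum_le_sum_of_subset_of_nonneg ?_ fun m _ _ => hnn m
    intro m hm
    simp only [Finset.mem_Ico, Finset.mem_Icc] at hm ⊢
    omega
  have h9 : t ^ dw * ((5 * t ^ dw) ^ (-1 - a - df / dw) * (c * g)) ≤ 2 * W.refKernel a M y z := by
    have : ((2 * D - D : ℕ) : ℝ) = D := by rw [show 2 * D - D = D by omega]
    rw [this] at h6
    calc _ ≤ (D : ℝ) * ((5 * t ^ dw) ^ (-1 - a - df / dw) * (c * g)) := by gcongr
      _ ≤ _ := by linarith
  have h10 : t ^ dw * (5 * t ^ dw) ^ (-1 - a - df / dw)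
      = 5 ^ (-1 - a - df / dw) * t ^ (-(df + β)) := by
    rw [Real.mul_rpow (by norm_num) (by positivity), ← Real.rpow_mul hd0.le, ← mul_assoc,
      mul_comm (t ^ dw), mul_assoc, ← Real.rpow_add hd0]
    congr 2
    rw [ha]; field_simp; ring
  calc _ ≤ c * g * 5 ^ (-1 - a - df / dw) * 2⁻¹ * t ^ (-(df + β)) := by
        exact mul_le_mul_of_nonneg_left (one_add_d_rpow_neg_le hyz (by positivity))
          (by positivity)
    _ = (t ^ dw * (5 * t ^ dw) ^ (-1 - a - df / dw)) * (c * g) * 2⁻¹ := by rw [h10]; ring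
    _ ≤ _ := by linarith

/-- The generator of the subordinated walk applied to u is ∑ m^{-1-a} (P^m u - u), so upper bounds
for the increments of u add up through `sum_rpow_min_le`. -/
lemma refKernel_op_le {a : ℝ} (hμ : W.ComparableToCounting) (ha : 0 < a) (ha1 : a < 1) :
    ∃ C : ℝ, 0 < C ∧ ∀ (M : ℕ) (D : ℝ) (u : X → ℝ) (y : X), 1 ≤ D → (∀ z, 0 ≤ u z) →
      (∀ z, u z ≤ 1) → (∀ m : ℕ, (transitionOp W.walk)^[m] u y - u y ≤ min (m / D) 1) →
      ∃ s ≤ C * D ^ (-a),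
        HasSum (fun z => W.refKernel a M y z * W.vol z * (u z - u y)) s := by
  obtain ⟨C, hC, hsum⟩ := sum_rpow_min_le ha ha1
  have hP := isTransition_walk hμ
  refine ⟨C, hC, fun M D u y hD hu0 hu1 hu => ⟨∑ m ∈ Finset.Icc 1 M,
    (m : ℝ) ^ (-1 - a) * ((transitionOp W.walk)^[m] u y - u y), ?_, ?_⟩⟩
  · refine le_trans (Finset.sum_le_sum fun m _ => ?_) (hsum D hD M)
    gcongr
    exact hu m
  · have h1 : ∀ m ∈ Finset.Icc 1 M, HasSum (fun z => (m : ℝ) ^ (-1 - a) *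
        (nStep W.walk m y z * u z - nStep W.walk m y z * u y))
        ((m : ℝ) ^ (-1 - a) * ((transitionOp W.walk)^[m] u y - u y)) := by
      intro m _
      have e1 := hP.hasSum_nStep_mul (u := u) (B := 1)
        (fun z => abs_le.2 ⟨by linarith [hu0 z], hu1 z⟩) m y
      have e2 := (hP.hasSum_nStep m y).mul_right (u y)
      rw [one_mul] at e2
      exact (e1.sub e2).mul_left _
    have h2 := hasSum_sum h1
    convert h2 using 2 with z
    rw [refKernel, Finset.sum_mul, Finset.sum_mul]
    exact Finset.sum_congr rfl fun m _ => by rw [← heatKernel_mul_vol hμ]; ring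

/-- Bump functions together with a reference kernel for which they are nearly superharmonic
where they do not vanish. -/
lemma exists_bump {df dw β : ℝ} (hμ : W.ComparableToCounting) (hV : W.VolumeGrowth df)
    (hU : W.USG df dw) (hL : W.LSG df dw) (hdf : 0 < df) (hdw : 1 < dw) (hβ : 0 < β)
    (hβw : β < dw) :
    ∃ C r₀ : ℝ, 0 < C ∧ 1 ≤ r₀ ∧ ∀ r : ℝ, r₀ ≤ r → ∀ E : Set X,
      ∃ (k₀ : X → X → ℝ) (ψ : X → ℝ),
        (∀ y z, 0 ≤ k₀ y z) ∧ (∀ y z, k₀ y z = k₀ z y) ∧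
        (∀ y z, y ≠ z → k₀ y z ≤ C * (1 + (W.d y z : ℝ)) ^ (-(df + β))) ∧
        (∀ y z, y ≠ z → (W.d y z : ℝ) ≤ r →
          (1 + (W.d y z : ℝ)) ^ (-(df + β)) ≤ C * k₀ y z) ∧
        (∀ y, 0 ≤ ψ y) ∧ (∀ y, ψ y ≤ 1) ∧
        (∀ y, (∀ z, (W.d y z : ℝ) < r → z ∈ E) → ψ y = 0) ∧
        (∀ y, (∀ z, (W.d y z : ℝ) < r → z ∉ E) → 1 / 2 ≤ ψ y) ∧
        ∀ y, 0 < ψ y → ∀ S : Finset X, (∀ z, z ∈ S ↔ (W.d y z : ℝ) ≤ r) →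
          ∑ z ∈ S, k₀ y z * W.vol z * (ψ y - ψ z) ≤ C * r ^ (-β) := by
  classical
  have hdw0 : 0 < dw := by linarith
  obtain ⟨c, hc, hpot⟩ := exists_potential hμ hV hU hdf hdw
  obtain ⟨A₁, hA₁, hup⟩ := refKernel_le hU hdf hdw hβ hβw
  obtain ⟨c₂, hc₂, hlow⟩ := le_refKernel hμ hL hdf hdw hβ
  obtain ⟨A₃, hA₃, hop⟩ := refKernel_op_le (a := β / dw) hμ (by positivity)
    (by rw [div_lt_one hdw0]; exact hβw)
  obtain ⟨A₄, hA₄, htail⟩ := hV.tail_sum_le hμ hdf hβ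
  set A₅ := A₃ * c ^ (-(β / dw)) + A₁ * A₄ with hA₅
  have hA₅0 : 0 < A₅ := by positivity
  refine ⟨A₁ + c₂⁻¹ + A₅, max 1 ((1 / c) ^ (1 / dw)), by positivity, le_max_left _ _, ?_⟩
  intro r hr E
  have hr1 : 1 ≤ r := (le_max_left _ _).trans hr
  have hr0 : 0 < r := by linarith
  have hcr : 1 ≤ c * r ^ dw := by
    have h1 : (1 / c) ^ (1 / dw) ≤ r := (le_max_right _ _).trans hr
    have h2 := Real.rpow_le_rpow (by positivity) h1 hdw0.le
    rw [← Real.rpow_mul (by positivity), one_div_mul_cancel hdw0.ne', Real.rpow_one,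
      div_le_iff₀ hc] at h2
    linarith
  obtain ⟨u, hu0, hu1, huE, huE', hum⟩ := hpot r hr1 hcr E
  -- Long enough for the lower bound `le_refKernel` at every distance up to r.
  set M := 2 * ⌈r ^ dw⌉₊ + 1 with hM
  have hA₁le : A₁ ≤ A₁ + c₂⁻¹ + A₅ := by
    have : 0 < c₂⁻¹ := by positivity
    linarith
  -- Where ψ(y) > 0 it equals 3/4 - u(y), whereas ψ(z) ≥ 3/4 - u(z) everywhere. So ψ(y) - ψ(z) ≤
  -- u(z) - u(y), and truncation keeps the one-sided bound.
  refine ⟨W.refKernel (β / dw) M, fun y => max (3 / 4 - u y) 0, refKernel_nonneg hμ _ _,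
    refKernel_symm hμ _ _, fun y z hyz => (hup M y z hyz).trans (by gcongr), ?_,
    fun y => le_max_right _ _, fun y => max_le (by linarith [hu0 y]) (by norm_num), ?_, ?_, ?_⟩
  · intro y z hyz hd
    have h1 := hlow M y z hyz (by
      rw [hM]
      have : ⌈(W.d y z : ℝ) ^ dw⌉₊ ≤ ⌈r ^ dw⌉₊ := Nat.ceil_mono (by gcongr)
      omega)
    have h2 : (1 + (W.d y z : ℝ)) ^ (-(df + β)) ≤ c₂⁻¹ * W.refKernel (β / dw) M y z := by
      rw [le_inv_mul_iff₀ hc₂]; exact h1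
    refine h2.trans ?_
    have := refKernel_nonneg hμ (β / dw) M y z
    gcongr
    linarith
  · intro y hy
    exact max_eq_right (by linarith [huE y hy])
  · intro y hy
    exact (by linarith [huE' y hy] : (1 : ℝ) / 2 ≤ 3 / 4 - u y).trans (le_max_left _ _)
  · intro y hy S hS
    have hψy : max (3 / 4 - u y) 0 = 3 / 4 - u y := by
      rcases le_total (3 / 4 - u y) 0 with h | h
      · simp only [max_eq_right h, lt_irrefl] at hy
      · exact max_eq_left h
    have hstep : ∑ z ∈ S, W.refKernel (β / dw) M y z * W.vol z *
        (max (3 / 4 - u y) 0 - max (3 / 4 - u z) 0)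
        ≤ ∑ z ∈ S, W.refKernel (β / dw) M y z * W.vol z * (u z - u y) := by
      refine Finset.sum_le_sum fun z _ => ?_
      rw [hψy]
      refine mul_le_mul_of_nonneg_left ?_
        (mul_nonneg (refKernel_nonneg hμ (β / dw) M y z) (hμ.vol_pos z).le)
      linarith [le_max_left (3 / 4 - u z) 0]
    obtain ⟨s, hs, hsum⟩ := hop M (c * r ^ dw) u y hcr hu0 hu1 fun m => hum m y
    have hlim : ∑ z ∈ S, W.refKernel (β / dw) M y z * W.vol z * (u z - u y)
        ≤ s + A₁ * A₄ * r ^ (-β) := by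
      -- The value s belongs to the sum over all z, while S is the ball of radius r. Since 0 ≤ u ≤
      -- 1, the terms outside S are bounded below by minus the kernel tail, of order r^{-β}.
      refine ge_of_tendsto (Filter.Tendsto.add_const _ hsum) ?_
      filter_upwards [Filter.eventually_ge_atTop S] with S' hS'
      rw [← Finset.sum_sdiff hS']
      have : -(A₁ * A₄ * r ^ (-β)) ≤
          ∑ z ∈ S' \ S, W.refKernel (β / dw) M y z * W.vol z * (u z - u y) := by
        rw [neg_le, ← Finset.sum_neg_distrib]
        calc _ ≤ ∑ z ∈ S' \ S, A₁ * (W.vol z * (1 + (W.d y z : ℝ)) ^ (-(df + β))) := by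
              refine Finset.sum_le_sum fun z hz => ?_
              have hyz : y ≠ z := by
                rintro rfl
                simp only [Finset.mem_sdiff, hS, W.d_self] at hz
                exact hz.2 (by simpa using hr0.le)
              have h1 := hup M y z hyz
              have h2 := refKernel_nonneg hμ (β / dw) M y z
              have h3 := (hμ.vol_pos z).le
              calc _ = W.refKernel (β / dw) M y z * W.vol z * (u y - u z) := by ring
                _ ≤ W.refKernel (β / dw) M y z * W.vol z * 1 := by
                    gcongr; linarith [hu1 y, hu0 z]
                _ ≤ A₁ * (1 + (W.d y z : ℝ)) ^ (-(df + β)) * W.vol z * 1 := by gcongr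
                _ = _ := by ring
          _ ≤ A₁ * (A₄ * r ^ (-β)) := by
              rw [← Finset.mul_sum]
              gcongr
              apply htail y r hr1
              intro z hz
              simp only [Finset.mem_sdiff, hS, not_le] at hz
              linarith [hz.2]
          _ = _ := by ring
      linarith
    have hpow : (c * r ^ dw) ^ (-(β / dw)) = c ^ (-(β / dw)) * r ^ (-β) := by
      rw [Real.mul_rpow hc.le (by positivity), ← Real.rpow_mul hr0.le, mul_neg,
        mul_div_cancel₀ _ hdw0.ne']
    rw [hpow] at hs
    have hfin : s + A₁ * A₄ * r ^ (-β) ≤ A₅ * r ^ (-β) := by rw [hA₅]; linarith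
    refine (hstep.trans (hlim.trans hfin)).trans ?_
    gcongr
    have : 0 < c₂⁻¹ := by positivity
    linarith

end WeightedGraph

/-! ### Energy inequalities on finite sets. -/

section FiniteEnergy

variable {ι : Type*} [Fintype ι]

/-- Recentre at f(i₀). The term i₀ then vanishes, so Cauchy–Schwarz uses only the mass m - a(i₀) of
the others, and the unused a(i₀) is the gain. The missing mass 1 - m multiplies the nonnegative
number ∑ a f². -/
lemma sq_sum_mul_add_le (a f : ι → ℝ) (ha : ∀ i, 0 ≤ a i) (h1 : ∑ i, a i ≤ 1) (i₀ : ι) :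
    (∑ i, a i * f i) ^ 2 + a i₀ * ∑ i, a i * (f i₀ - f i) ^ 2 ≤ ∑ i, a i * f i ^ 2 := by
  classical
  set m := ∑ i, a i with hm
  set g1 := ∑ i, a i * (f i - f i₀) with hg1
  set G2 := ∑ i, a i * (f i₀ - f i) ^ 2 with hG2
  have e1 : ∑ i, a i * f i = m * f i₀ + g1 := by
    rw [hm, hg1, Finset.sum_mul, ← Finset.sum_add_distrib]
    exact Finset.sum_congr rfl fun i _ => by ring
  have e2 : ∑ i, a i * f i ^ 2 = m * f i₀ ^ 2 + 2 * f i₀ * g1 + G2 := by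
    rw [hm, hg1, hG2, Finset.sum_mul, Finset.mul_sum, ← Finset.sum_add_distrib,
      ← Finset.sum_add_distrib]
    exact Finset.sum_congr rfl fun i _ => by ring
  have e3 : g1 ^ 2 ≤ (m - a i₀) * G2 := by
    have h := Finset.sum_sq_le_sum_mul_sum_of_sq_le_mul (Finset.univ.erase i₀)
      (r := fun i => a i * (f i - f i₀)) (f := a) (g := fun i => a i * (f i₀ - f i) ^ 2)
      (fun i _ => ha i) (fun i _ => mul_nonneg (ha i) (sq_nonneg _)) (fun i _ => le_of_eq (by ring))
    rw [Finset.sum_erase_eq_sub (Finset.mem_univ _), Finset.sum_erase_eq_sub (Finset.mem_univ _),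
      Finset.sum_erase_eq_sub (Finset.mem_univ _)] at h
    simpa using h
  have e4 : 0 ≤ ∑ i, a i * f i ^ 2 := Finset.sum_nonneg fun i _ => mul_nonneg (ha i) (sq_nonneg _)
  rw [e1, e2]
  rw [e2] at e4
  nlinarith [mul_nonneg (sub_nonneg.2 h1) e4]

lemma sum_sum_swap (F : ι → ι → ℝ) : ∑ y, ∑ z, F y z = ∑ y, ∑ z, F z y := Finset.sum_comm

/-- A holding probability of at least δ makes a single step dissipate δ times the weighted energy.
-/
lemma weighted_variance_le {A : ι → ι → ℝ} {μ w : ι → ℝ} {δ : ℝ} (hA : ∀ y z, 0 ≤ A y z)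
    (hμ : ∀ y, 0 < μ y) (hrow : ∀ y, ∑ z, A y z * μ z ≤ 1) (hδ : ∀ y, δ ≤ A y y * μ y)
    (hw : ∀ y, 0 ≤ w y) (f : ι → ℝ) :
    ∑ y, w y * μ y * (∑ z, A y z * μ z * f z) ^ 2
      + δ * ∑ y, ∑ z, μ y * A y z * μ z * (w y * (f y - f z) ^ 2)
      ≤ ∑ y, ∑ z, μ y * A y z * μ z * (w y * f z ^ 2) := by
  rw [Finset.mul_sum, ← Finset.sum_add_distrib]
  refine Finset.sum_le_sum fun y _ => ?_
  have h := sq_sum_mul_add_le (fun z => A y z * μ z) f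
    (fun z => mul_nonneg (hA y z) (hμ z).le) (hrow y) y
  have hG : 0 ≤ ∑ z, A y z * μ z * (f y - f z) ^ 2 :=
    Finset.sum_nonneg fun z _ => mul_nonneg (mul_nonneg (hA y z) (hμ z).le) (sq_nonneg _)
  have h2 := mul_le_mul_of_nonneg_right (hδ y) hG
  have h3 : (∑ z, A y z * μ z * f z) ^ 2 + δ * ∑ z, A y z * μ z * (f y - f z) ^ 2
      ≤ ∑ z, A y z * μ z * f z ^ 2 := by linarith
  have h4 := mul_le_mul_of_nonneg_left h3 (mul_nonneg (hw y) (hμ y).le)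
  calc _ = w y * μ y * ((∑ z, A y z * μ z * f z) ^ 2
        + δ * ∑ z, A y z * μ z * (f y - f z) ^ 2) := by
        rw [mul_add]
        congr 1
        rw [Finset.mul_sum, Finset.mul_sum, Finset.mul_sum]
        exact Finset.sum_congr rfl fun z _ => by ring
    _ ≤ _ := h4
    _ = _ := by
        rw [Finset.mul_sum]
        exact Finset.sum_congr rfl fun z _ => by ring

/-- One step of a symmetric sub-Markov operator, in an `L²` space whose weight `v ^ 2` has
controlled energy. -/
lemma caccioppoli {A : ι → ι → ℝ} {μ v : ι → ℝ} {δ R : ℝ} (hA : ∀ y z, 0 ≤ A y z)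
    (hsymm : ∀ y z, A y z = A z y)
    (hμ : ∀ y, 0 < μ y) (hrow : ∀ y, ∑ z, A y z * μ z ≤ 1) (hδ0 : 0 < δ)
    (hδ : ∀ y, δ ≤ A y y * μ y) (f : ι → ℝ)
    (hv : ∑ y, ∑ z, μ y * A y z * μ z * ((v y - v z) ^ 2 * f y ^ 2)
      ≤ δ ^ 2 / 4 * (∑ y, ∑ z, μ y * A y z * μ z * (v y ^ 2 * (f y - f z) ^ 2)) + R) :
    ∑ y, v y ^ 2 * μ y * (∑ z, A y z * μ z * f z) ^ 2
      ≤ ∑ y, v y ^ 2 * μ y * f y ^ 2 + 2 / δ * R := by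
  have h1 := weighted_variance_le hA hμ hrow hδ (fun y => sq_nonneg (v y)) f
  set S1 := ∑ y, ∑ z, μ y * A y z * μ z * (v y ^ 2 * (f y - f z) ^ 2) with hS1
  set S2 := ∑ y, ∑ z, μ y * A y z * μ z * ((v y - v z) ^ 2 * f y ^ 2) with hS2
  have hj : ∀ y z, 0 ≤ μ y * A y z * μ z := fun y z =>
    mul_nonneg (mul_nonneg (hμ y).le (hA y z)) (hμ z).le
  have hjs : ∀ y z, μ z * A z y * μ y = μ y * A y z * μ z := fun y z => by
    rw [hsymm z y]; ring
  have h2 : ∑ y, ∑ z, μ y * A y z * μ z * (v y ^ 2 * f y ^ 2) ≤ ∑ y, v y ^ 2 * μ y * f y ^ 2 := by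
    refine Finset.sum_le_sum fun y _ => ?_
    calc _ = (∑ z, A y z * μ z) * (v y ^ 2 * μ y * f y ^ 2) := by
          rw [Finset.sum_mul]; exact Finset.sum_congr rfl fun z _ => by ring
      _ ≤ 1 * (v y ^ 2 * μ y * f y ^ 2) := by
          have := (hμ y).le
          gcongr
          exact hrow y
      _ = _ := one_mul _
  set D := ∑ y, ∑ z, μ y * A y z * μ z * (v y ^ 2 * (f z ^ 2 - f y ^ 2)) with hD
  have h3 : ∑ y, ∑ z, μ y * A y z * μ z * (v y ^ 2 * f z ^ 2)
      = D + ∑ y, ∑ z, μ y * A y z * μ z * (v y ^ 2 * f y ^ 2) := by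
    rw [hD, ← Finset.sum_add_distrib]
    refine Finset.sum_congr rfl fun y _ => ?_
    rw [← Finset.sum_add_distrib]
    exact Finset.sum_congr rfl fun z _ => by ring
  have hDs : D = ∑ y, ∑ z, μ y * A y z * μ z * (v z ^ 2 * (f y ^ 2 - f z ^ 2)) := by
    rw [hD, sum_sum_swap]
    exact Finset.sum_congr rfl fun y _ => Finset.sum_congr rfl fun z _ => by rw [hjs]
  have hS1s : S1 = ∑ y, ∑ z, μ y * A y z * μ z * (v z ^ 2 * (f y - f z) ^ 2) := by
    rw [hS1, sum_sum_swap]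
    exact Finset.sum_congr rfl fun y _ => Finset.sum_congr rfl fun z _ => by rw [hjs]; ring
  have hS2s : S2 = ∑ y, ∑ z, μ y * A y z * μ z * ((v y - v z) ^ 2 * f z ^ 2) := by
    rw [hS2, sum_sum_swap]
    exact Finset.sum_congr rfl fun y _ => Finset.sum_congr rfl fun z _ => by rw [hjs]; ring
  -- One copy of each sum is written with y and z exchanged; only the symmetrised integrands satisfy
  -- a pointwise inequality, factoring as -((v y + v z)(f y - f z))((v y - v z)(f y + f z)).
  have h4 : D + D ≤ δ / 2 * (S1 + S1) + 2 / δ * (S2 + S2) := by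
    conv_lhs => rw [hDs]; arg 2; rw [← hDs, hD]
    conv_rhs => rw [hS1s, hS2s]
    conv_rhs => arg 1; arg 2; arg 2; rw [← hS1s, hS1]
    conv_rhs => arg 2; arg 2; arg 2; rw [← hS2s, hS2]
    simp only [← Finset.sum_add_distrib, Finset.mul_sum]
    refine Finset.sum_le_sum fun y _ => Finset.sum_le_sum fun z _ => ?_
    have key : v z ^ 2 * (f y ^ 2 - f z ^ 2) + v y ^ 2 * (f z ^ 2 - f y ^ 2)
        ≤ δ / 2 * (v z ^ 2 * (f y - f z) ^ 2 + v y ^ 2 * (f y - f z) ^ 2)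
          + 2 / δ * ((v y - v z) ^ 2 * f z ^ 2 + (v y - v z) ^ 2 * f y ^ 2) := by
      have e1 : v z ^ 2 * (f y ^ 2 - f z ^ 2) + v y ^ 2 * (f z ^ 2 - f y ^ 2)
          = -((v y + v z) * (f y - f z)) * ((v y - v z) * (f y + f z)) := by ring
      have e2 : -((v y + v z) * (f y - f z)) * ((v y - v z) * (f y + f z))
          ≤ δ / 4 * ((v y + v z) * (f y - f z)) ^ 2
            + 1 / δ * ((v y - v z) * (f y + f z)) ^ 2 := by
        set P := (v y + v z) * (f y - f z)
        set Q := (v y - v z) * (f y + f z)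
        have : δ / 4 * P ^ 2 + 1 / δ * Q ^ 2 - -P * Q = (δ / 2 * P + Q) ^ 2 / δ := by
          field_simp; ring
        have h0 : 0 ≤ (δ / 2 * P + Q) ^ 2 / δ := by positivity
        linarith
      have e3 : ((v y + v z) * (f y - f z)) ^ 2
          ≤ 2 * (v z ^ 2 * (f y - f z) ^ 2 + v y ^ 2 * (f y - f z) ^ 2) := by
        nlinarith [sq_nonneg ((v y - v z) * (f y - f z))]
      have e4 : ((v y - v z) * (f y + f z)) ^ 2
          ≤ 2 * ((v y - v z) ^ 2 * f z ^ 2 + (v y - v z) ^ 2 * f y ^ 2) := by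
        nlinarith [sq_nonneg ((v y - v z) * (f y - f z))]
      have e5 := mul_le_mul_of_nonneg_left e3 (by positivity : 0 ≤ δ / 4)
      have e6 := mul_le_mul_of_nonneg_left e4 (by positivity : 0 ≤ 1 / δ)
      rw [e1]
      calc _ ≤ _ := e2
        _ ≤ _ := add_le_add e5 e6
        _ = _ := by ring
    have := mul_le_mul_of_nonneg_left key (hj y z)
    calc _ = _ := by rw [← mul_add]
      _ ≤ _ := this
      _ = _ := by ring
  -- The gain δ S1 pays for two halves: δ/2 S1 from Young's inequality and δ/2 S1 from here. This
  -- dictates the factor δ²/4 in the hypothesis.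
  have h5 : 2 / δ * S2 ≤ 2 / δ * (δ ^ 2 / 4 * S1 + R) :=
    mul_le_mul_of_nonneg_left hv (by positivity)
  have h6 : 2 / δ * (δ ^ 2 / 4 * S1 + R) = δ / 2 * S1 + 2 / δ * R := by field_simp; ring
  linarith

/-- A function that is nearly superharmonic where it is positive has controlled energy against
squares. -/
lemma energy_le_of_superharmonic {j : ι → ι → ℝ} (hj : ∀ y z, 0 ≤ j y z)
    (hsymm : ∀ y z, j y z = j z y) {ψ Λ : ι → ℝ} (hψ : ∀ y, 0 ≤ ψ y)
    (hsup : ∀ y, 0 < ψ y → ∑ z, j y z * (ψ y - ψ z) ≤ Λ y) (f : ι → ℝ) :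
    ∑ y, ∑ z, j y z * ((ψ y - ψ z) ^ 2 * f y ^ 2)
      ≤ 4 * ∑ y, ∑ z, j y z * (ψ y ^ 2 * (f y - f z) ^ 2) + 4 * ∑ y, f y ^ 2 * ψ y * Λ y := by
  set S1 := ∑ y, ∑ z, j y z * (ψ y ^ 2 * (f y - f z) ^ 2) with hS1
  set S2 := ∑ y, ∑ z, j y z * ((ψ y - ψ z) ^ 2 * f y ^ 2) with hS2
  set L := ∑ y, ∑ z, j y z * (f y ^ 2 * ψ y * (ψ y - ψ z)) with hL
  set D := ∑ y, ∑ z, j y z * (f y ^ 2 * (ψ z ^ 2 - ψ y ^ 2)) with hD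
  -- (ψ y - ψ z)² = 2 ψ y (ψ y - ψ z) + (ψ z² - ψ y²). The factor ψ y in L is why the one-sided
  -- bound is needed only where ψ is positive.
  have h1 : S2 = 2 * L + D := by
    rw [hS2, hL, hD, Finset.mul_sum, ← Finset.sum_add_distrib]
    refine Finset.sum_congr rfl fun y _ => ?_
    rw [Finset.mul_sum, ← Finset.sum_add_distrib]
    exact Finset.sum_congr rfl fun z _ => by ring
  have h2 : L ≤ ∑ y, f y ^ 2 * ψ y * Λ y := by
    refine Finset.sum_le_sum fun y _ => ?_
    rcases (hψ y).eq_or_lt with h | h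
    · simp [← h]
    · calc _ = f y ^ 2 * ψ y * ∑ z, j y z * (ψ y - ψ z) := by
            rw [Finset.mul_sum]; exact Finset.sum_congr rfl fun z _ => by ring
        _ ≤ _ := mul_le_mul_of_nonneg_left (hsup y h) (mul_nonneg (sq_nonneg _) h.le)
  have hDs : D = ∑ y, ∑ z, j y z * (f z ^ 2 * (ψ y ^ 2 - ψ z ^ 2)) := by
    rw [hD, sum_sum_swap]
    exact Finset.sum_congr rfl fun y _ => Finset.sum_congr rfl fun z _ => by rw [hsymm]
  have hS1s : S1 = ∑ y, ∑ z, j y z * (ψ z ^ 2 * (f y - f z) ^ 2) := by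
    rw [hS1, sum_sum_swap]
    exact Finset.sum_congr rfl fun y _ => Finset.sum_congr rfl fun z _ => by rw [hsymm]; ring
  have hS2s : S2 = ∑ y, ∑ z, j y z * ((ψ y - ψ z) ^ 2 * f z ^ 2) := by
    rw [hS2, sum_sum_swap]
    exact Finset.sum_congr rfl fun y _ => Finset.sum_congr rfl fun z _ => by rw [hsymm]; ring
  -- Symmetrisation as in `caccioppoli`; the constant 1/2 lets half of S2 be absorbed on the left.
  have h4 : D + D ≤ 2 * (S1 + S1) + 1 / 2 * (S2 + S2) := by
    conv_lhs => rw [hDs]; arg 2; rw [← hDs, hD]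
    conv_rhs => rw [hS1s, hS2s]
    conv_rhs => arg 1; arg 2; arg 2; rw [← hS1s, hS1]
    conv_rhs => arg 2; arg 2; arg 2; rw [← hS2s, hS2]
    simp only [← Finset.sum_add_distrib, Finset.mul_sum]
    refine Finset.sum_le_sum fun y _ => Finset.sum_le_sum fun z _ => ?_
    have key : f z ^ 2 * (ψ y ^ 2 - ψ z ^ 2) + f y ^ 2 * (ψ z ^ 2 - ψ y ^ 2)
        ≤ 2 * (ψ z ^ 2 * (f y - f z) ^ 2 + ψ y ^ 2 * (f y - f z) ^ 2)
          + 1 / 2 * ((ψ y - ψ z) ^ 2 * f z ^ 2 + (ψ y - ψ z) ^ 2 * f y ^ 2) := by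
      set P := (ψ y + ψ z) * (f y - f z) with hP
      set Q := (ψ y - ψ z) * (f y + f z) with hQ
      have e1 : f z ^ 2 * (ψ y ^ 2 - ψ z ^ 2) + f y ^ 2 * (ψ z ^ 2 - ψ y ^ 2) = -P * Q := by
        rw [hP, hQ]; ring
      have e2 : -P * Q ≤ P ^ 2 + 1 / 4 * Q ^ 2 := by nlinarith [sq_nonneg (P + Q / 2)]
      have e3 : P ^ 2 ≤ 2 * (ψ z ^ 2 * (f y - f z) ^ 2 + ψ y ^ 2 * (f y - f z) ^ 2) := by
        rw [hP]; nlinarith [sq_nonneg ((ψ y - ψ z) * (f y - f z))]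
      have e4 : Q ^ 2 ≤ 2 * ((ψ y - ψ z) ^ 2 * f z ^ 2 + (ψ y - ψ z) ^ 2 * f y ^ 2) := by
        rw [hQ]; nlinarith [sq_nonneg ((ψ y - ψ z) * (f y - f z))]
      linarith
    have := mul_le_mul_of_nonneg_left key (hj y z)
    calc _ = _ := by rw [← mul_add]
      _ ≤ _ := this
      _ = _ := by ring
  linarith

end FiniteEnergy

lemma sum_le_of_subsingleton_support {c : ℕ → ℝ} {s : Finset ℕ} {B : ℝ} (hB : 0 ≤ B)
    (hc : ∀ i ∈ s, c i ≤ B) (h1 : ∀ i ∈ s, ∀ j ∈ s, c i ≠ 0 → c j ≠ 0 → i = j) :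
    ∑ i ∈ s, c i ≤ B := by
  by_cases h : ∃ i ∈ s, c i ≠ 0
  · obtain ⟨i, hi, hci⟩ := h
    rw [Finset.sum_eq_single_of_mem i hi fun j hj hji => ?_]
    · exact hc i hi
    · by_contra hcj; exact hji (h1 j hj i hi hcj hci)
  · push Not at h
    rw [Finset.sum_eq_zero h]; exact hB

/-! ### Layered weights. -/

/-- A weight that grows by the factor `1 + κ` across each layer. -/
noncomputable def layerWeight {X : Type*} (κ : ℝ) (s : ℕ → X → ℝ) (I : ℕ) (y : X) : ℝ :=
  1 + ∑ i ∈ Finset.range I, κ * (1 + κ) ^ i * s i y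

lemma one_add_sum_geom (κ : ℝ) (n : ℕ) :
    1 + ∑ i ∈ Finset.range n, κ * (1 + κ) ^ i = (1 + κ) ^ n := by
  induction n with
  | zero => simp
  | succ n ih => rw [Finset.sum_range_succ, ← add_assoc, ih]; ring

section LayerWeight

variable {X : Type*} {κ : ℝ} {s : ℕ → X → ℝ} {I : ℕ} {y : X}

lemma layerWeight_le (hκ : 0 ≤ κ) (hs : ∀ i, s i y ≤ 1) {i : ℕ}
    (h : ∀ j, i ≤ j → s j y = 0) : layerWeight κ s I y ≤ (1 + κ) ^ i := by
  rw [← one_add_sum_geom, layerWeight]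
  have h1 : ∑ j ∈ Finset.range I, κ * (1 + κ) ^ j * s j y
      = ∑ j ∈ Finset.range I with j < i, κ * (1 + κ) ^ j * s j y := by
    rw [Finset.sum_filter]
    refine Finset.sum_congr rfl fun j _ => ?_
    split_ifs with hj
    · rfl
    · rw [h j (not_lt.1 hj), mul_zero]
  have h2 : ∑ j ∈ Finset.range I with j < i, κ * (1 + κ) ^ j * s j y
      ≤ ∑ j ∈ Finset.range I with j < i, κ * (1 + κ) ^ j := by
    refine Finset.sum_le_sum fun j _ => ?_
    have : 0 ≤ κ * (1 + κ) ^ j := by positivity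
    nlinarith [hs j]
  have h3 : ∑ j ∈ Finset.range I with j < i, κ * (1 + κ) ^ j
      ≤ ∑ j ∈ Finset.range i, κ * (1 + κ) ^ j := by
    refine Finset.sum_le_sum_of_subset_of_nonneg (fun j hj => ?_) fun j _ _ => by positivity
    simp only [Finset.mem_filter, Finset.mem_range] at hj ⊢
    exact hj.2
  linarith

lemma layerWeight_le_top (hκ : 0 ≤ κ) (hs : ∀ i, s i y ≤ 1) :
    layerWeight κ s I y ≤ (1 + κ) ^ I := by
  rw [← one_add_sum_geom, layerWeight]
  refine add_le_add le_rfl (Finset.sum_le_sum fun j _ => ?_)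
  have : 0 ≤ κ * (1 + κ) ^ j := by positivity
  nlinarith [hs j]

lemma le_layerWeight (hκ : 0 ≤ κ) (hs : ∀ i, 0 ≤ s i y) {i : ℕ} (hi : i ≤ I)
    (h : ∀ j, j < i → s j y = 1) : (1 + κ) ^ i ≤ layerWeight κ s I y := by
  rw [← one_add_sum_geom, layerWeight]
  gcongr
  calc _ = ∑ j ∈ Finset.range i, κ * (1 + κ) ^ j * s j y :=
        Finset.sum_congr rfl fun j hj => by rw [h j (Finset.mem_range.1 hj), mul_one]
    _ ≤ _ := by
        refine Finset.sum_le_sum_of_subset_of_nonneg (Finset.range_mono hi) fun j _ _ => ?_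
        have := hs j
        positivity

end LayerWeight

/-! ### The cutoff Sobolev inequality for K. -/

namespace WeightedGraph

variable {X : Type*} {W : WeightedGraph X}

lemma SymmMarkovOperator.J.bounds {df β : ℝ} {K : W.SymmMarkovOperator} (hJ : K.J df β) :
    ∃ C : ℝ, 1 ≤ C ∧ ∀ x y, (1 + (W.d x y : ℝ)) ^ (-(df + β)) ≤ C * K.kernel x y ∧
      K.kernel x y ≤ C * (1 + (W.d x y : ℝ)) ^ (-(df + β)) := by
  obtain ⟨C, hC, h⟩ := hJ
  refine ⟨max C 1, le_max_right _ _, fun x y => ?_⟩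
  have e : (1 + (W.d x y : ℝ)) ^ (-(df + β)) = 1 / (1 + (W.d x y : ℝ)) ^ (df + β) := by
    rw [Real.rpow_neg (by positivity), one_div]
  rw [e]
  obtain ⟨h1, h2⟩ := h x y
  rw [inv_mul_le_iff₀ hC] at h1
  constructor
  · refine h1.trans (mul_le_mul_of_nonneg_right (le_max_left _ _) (K.nonneg x y))
  · exact h2.trans (mul_le_mul_of_nonneg_right (le_max_left _ _) (by positivity))

/-- Bump functions satisfy a cutoff Sobolev inequality for every kernel comparable to the
reference kernel. -/
lemma exists_cutoff {df dw β : ℝ} (hμ : W.ComparableToCounting) (hV : W.VolumeGrowth df)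
    (hU : W.USG df dw) (hL : W.LSG df dw) (hdf : 0 < df) (hdw : 1 < dw) (hβ : 0 < β)
    (hβw : β < dw) {K : W.SymmMarkovOperator} (hJ : K.J df β) :
    ∃ C r₀ : ℝ, 0 < C ∧ 1 ≤ r₀ ∧ ∀ r : ℝ, r₀ ≤ r → ∀ E : Set X, ∃ ψ : X → ℝ,
        (∀ y, 0 ≤ ψ y) ∧ (∀ y, ψ y ≤ 1) ∧
        (∀ y, (∀ z, (W.d y z : ℝ) < r → z ∈ E) → ψ y = 0) ∧
        (∀ y, (∀ z, (W.d y z : ℝ) < r → z ∉ E) → 1 / 2 ≤ ψ y) ∧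
        ∀ Ω : Finset X, (∀ y, 0 < ψ y → ∀ z, (W.d y z : ℝ) ≤ r → z ∈ Ω) → ∀ f : Ω → ℝ,
          ∑ y : Ω, ∑ z : Ω, (if (W.d y z : ℝ) ≤ r then W.vol y * K.kernel y z * W.vol z else 0) *
              ((ψ y - ψ z) ^ 2 * f y ^ 2)
          ≤ C * (∑ y : Ω, ∑ z : Ω,
              (if (W.d y z : ℝ) ≤ r then W.vol y * K.kernel y z * W.vol z else 0) *
              (ψ y ^ 2 * (f y - f z) ^ 2)) + C * r ^ (-β) * ∑ y : Ω, W.vol y * f y ^ 2 * ψ y := by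
  obtain ⟨A, r₀, hA, hr₀, h⟩ := exists_bump hμ hV hU hL hdf hdw hβ hβw
  obtain ⟨B, hB1, hk⟩ := hJ.bounds
  have hB : 0 < B := by linarith
  refine ⟨4 * (A * B) ^ 2 + 4 * A * (A * B), r₀, by positivity, hr₀, fun r hr E => ?_⟩
  have hr0 : 0 < r := by linarith
  obtain ⟨k₀, ψ, hk0, hks, hkup, hklow, hψ0, hψ1, hψE, hψE', hsup⟩ := h r hr E
  refine ⟨ψ, hψ0, hψ1, hψE, hψE', fun Ω hΩ f => ?_⟩
  have hvol := fun y => (hμ.vol_pos y).le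
  set j : Ω → Ω → ℝ := fun y z =>
    if (W.d y z : ℝ) ≤ r then W.vol y * K.kernel y z * W.vol z else 0 with hj
  set j₀ : Ω → Ω → ℝ := fun y z =>
    if (W.d y z : ℝ) ≤ r then W.vol y * k₀ y z * W.vol z else 0 with hj₀
  have hj₀0 : ∀ y z, 0 ≤ j₀ y z := fun y z => by
    simp only [hj₀]; split_ifs
    · exact mul_nonneg (mul_nonneg (hvol y) (hk0 y z)) (hvol z)
    · exact le_rfl
  -- Nothing is known about k₀ on the diagonal, and nothing is needed: differences vanish there.
  have hcomp : ∀ y z : Ω, y ≠ z → j y z ≤ A * B * j₀ y z ∧ j₀ y z ≤ A * B * j y z := by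
    intro y z hyz
    have hyz' : (y : X) ≠ z := fun h => hyz (Subtype.ext h)
    simp only [hj, hj₀]
    split_ifs with hd
    · have h1 : K.kernel y z ≤ A * B * k₀ y z := by
        calc _ ≤ B * (1 + (W.d y z : ℝ)) ^ (-(df + β)) := (hk y z).2
          _ ≤ B * (A * k₀ y z) := by gcongr; exact hklow y z hyz' hd
          _ = _ := by ring
      have h2 : k₀ y z ≤ A * B * K.kernel y z := by
        calc _ ≤ A * (1 + (W.d y z : ℝ)) ^ (-(df + β)) := hkup y z hyz'
          _ ≤ A * (B * K.kernel y z) := by gcongr; exact (hk y z).1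
          _ = _ := by ring
      have hvv : 0 ≤ W.vol y * W.vol z := mul_nonneg (hvol y) (hvol z)
      constructor
      · have := mul_le_mul_of_nonneg_left h1 hvv
        linarith
      · have := mul_le_mul_of_nonneg_left h2 hvv
        linarith
    · simp
  -- Ω contains the r-ball around each point where ψ is positive, so the row sums over Ω are the
  -- complete ones bounded by `exists_bump`.
  have hmain := energy_le_of_superharmonic (j := j₀) hj₀0 (fun y z => by
      simp only [hj₀, W.d_comm z y, hks z y]; split_ifs <;> ring)
    (ψ := fun y => ψ y) (Λ := fun y => W.vol y * (A * r ^ (-β))) (fun y => hψ0 y) (by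
      intro y hy
      have h1 := hsup y hy (Ω.filter fun z => (W.d y z : ℝ) ≤ r) (fun z => by
        simp only [Finset.mem_filter]
        exact ⟨fun h => h.2, fun h => ⟨hΩ y hy z h, h⟩⟩)
      have h2 := mul_le_mul_of_nonneg_left h1 (hvol y)
      refine le_trans (le_of_eq ?_) h2
      rw [Finset.sum_filter, Finset.mul_sum, ← Finset.sum_coe_sort Ω]
      refine Finset.sum_congr rfl fun z _ => ?_
      simp only [hj₀]
      split_ifs <;> ring) f
  have hL2 : ∑ y, ∑ z, j y z * ((ψ y - ψ z) ^ 2 * f y ^ 2)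
      ≤ A * B * ∑ y, ∑ z, j₀ y z * ((ψ y - ψ z) ^ 2 * f y ^ 2) := by
    rw [Finset.mul_sum]
    refine Finset.sum_le_sum fun y _ => ?_
    rw [Finset.mul_sum]
    refine Finset.sum_le_sum fun z _ => ?_
    by_cases hyz : y = z
    · subst hyz; simp
    · have := mul_le_mul_of_nonneg_right (hcomp y z hyz).1
        (by positivity : 0 ≤ (ψ y - ψ z) ^ 2 * f y ^ 2)
      linarith
  have hR2 : ∑ y, ∑ z, j₀ y z * (ψ y ^ 2 * (f y - f z) ^ 2)
      ≤ A * B * ∑ y, ∑ z, j y z * (ψ y ^ 2 * (f y - f z) ^ 2) := by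
    rw [Finset.mul_sum]
    refine Finset.sum_le_sum fun y _ => ?_
    rw [Finset.mul_sum]
    refine Finset.sum_le_sum fun z _ => ?_
    by_cases hyz : y = z
    · subst hyz; simp
    · have := mul_le_mul_of_nonneg_right (hcomp y z hyz).2
        (by positivity : 0 ≤ ψ y ^ 2 * (f y - f z) ^ 2)
      linarith
  have hΛ : ∑ y : Ω, f y ^ 2 * ψ y * (W.vol y * (A * r ^ (-β)))
      = A * r ^ (-β) * ∑ y : Ω, W.vol y * f y ^ 2 * ψ y := by
    rw [Finset.mul_sum]; exact Finset.sum_congr rfl fun y _ => by ring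
  rw [hΛ] at hmain
  have hj0 : 0 ≤ ∑ y, ∑ z, j y z * (ψ y ^ 2 * (f y - f z) ^ 2) :=
    Finset.sum_nonneg fun y _ => Finset.sum_nonneg fun z _ => by
      refine mul_nonneg ?_ (by positivity)
      simp only [hj]; split_ifs
      · exact mul_nonneg (mul_nonneg (hvol y) (K.nonneg y z)) (hvol z)
      · exact le_rfl
  have hM0 : 0 ≤ r ^ (-β) * ∑ y : Ω, W.vol y * f y ^ 2 * ψ y :=
    mul_nonneg (by positivity) (Finset.sum_nonneg fun y _ =>
      mul_nonneg (mul_nonneg (hvol y) (sq_nonneg _)) (hψ0 y))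
  set S := ∑ y, ∑ z, j y z * (ψ y ^ 2 * (f y - f z) ^ 2)
  set S₀ := ∑ y, ∑ z, j₀ y z * (ψ y ^ 2 * (f y - f z) ^ 2)
  set N := ∑ y : Ω, W.vol y * f y ^ 2 * ψ y
  have hAB : 0 < A * B := by positivity
  calc _ ≤ A * B * (4 * S₀ + 4 * (A * r ^ (-β) * N)) :=
        hL2.trans (mul_le_mul_of_nonneg_left hmain hAB.le)
    _ ≤ A * B * (4 * (A * B * S) + 4 * (A * r ^ (-β) * N)) := by gcongr
    _ = 4 * (A * B) ^ 2 * S + 4 * A * (A * B) * (r ^ (-β) * N) := by ring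
    _ ≤ (4 * (A * B) ^ 2 + 4 * A * (A * B)) * S
        + (4 * (A * B) ^ 2 + 4 * A * (A * B)) * (r ^ (-β) * N) := by
        gcongr
        · linarith [show 0 < 4 * A * (A * B) by positivity]
        · linarith [show 0 < 4 * (A * B) ^ 2 by positivity]
    _ = _ := by ring

end WeightedGraph

/-! ### Radial weights glued from bumps in annuli. -/

namespace WeightedGraph

variable {X : Type*} {W : WeightedGraph X}

/-- Pairs whose distance is small compared to their distances to the base point `o`. -/
def IsLocal (W : WeightedGraph X) (o y z : X) : Prop :=
  4 * (W.d y z : ℝ) ≤ 2 + W.d o y + W.d o z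

lemma IsLocal.symm {o y z : X} (h : W.IsLocal o y z) : W.IsLocal o z y := by
  unfold IsLocal at *; rw [W.d_comm z y]; linarith

lemma isLocal_self (o y : X) : W.IsLocal o y y := by
  unfold IsLocal; rw [W.d_self, Nat.cast_zero, mul_zero]; positivity

lemma IsLocal.d_le {o y z : X} (h : W.IsLocal o y z) :
    3 * (W.d o z : ℝ) ≤ 2 + 5 * W.d o y := by
  unfold IsLocal at h
  have := W.d_triangle_real o y z
  linarith

lemma abs_min_two_mul_sub_le (a b : ℝ) : |min (2 * a) 1 - min (2 * b) 1| ≤ 2 * |a - b| := by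
  have h := abs_min_sub_min_le_max (2 * a) 1 (2 * b) 1
  rw [sub_self, abs_zero, ← mul_sub, abs_mul, abs_two, max_eq_left (by positivity)] at h
  exact h

/-- Steps across the annuli `R i ≤ D ≤ R (i + 1)` glued from bump functions. -/
noncomputable def annulusStep (D : X → ℝ) (R : ℕ → ℝ) (ψ : ℕ → X → ℝ) (i : ℕ) (y : X) : ℝ :=
  open Classical in if D y ≤ (R i + R (i + 1)) / 2 then min (2 * ψ i y) 1 else 1

section AnnulusStep

variable {D : X → ℝ} {R : ℕ → ℝ} {ψ : ℕ → X → ℝ}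

lemma annulusStep_le_one (i : ℕ) (y : X) : annulusStep D R ψ i y ≤ 1 := by
  unfold annulusStep; split_ifs
  · exact min_le_right _ _
  · exact le_rfl

lemma annulusStep_nonneg (hψ : ∀ i y, 0 ≤ ψ i y) (i : ℕ) (y : X) : 0 ≤ annulusStep D R ψ i y := by
  unfold annulusStep; split_ifs
  · exact le_min (by linarith [hψ i y]) zero_le_one
  · exact zero_le_one

lemma annulusStep_eq_zero (hR : StrictMono R) (hψ : ∀ i y, D y ≤ R i → ψ i y = 0) {i : ℕ} {y : X}
    (h : D y ≤ R i) : annulusStep D R ψ i y = 0 := by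
  unfold annulusStep
  rw [if_pos (by linarith [hR (Nat.lt_succ_self i)]), hψ i y h]; simp

lemma annulusStep_eq_one (hR : StrictMono R) {i : ℕ} {y : X}
    (h : R (i + 1) ≤ D y) : annulusStep D R ψ i y = 1 := by
  unfold annulusStep
  rw [if_neg (by linarith [hR (Nat.lt_succ_self i)])]

/-- Within r of the middle of the annulus ψ ≥ 1/2, so min(2ψ, 1) is already 1 there: pairs that
straddle the junction see no difference. -/
lemma annulusStep_sub_le {i : ℕ} {y z : X} {r : ℝ} (hyz : |D y - D z| ≤ r)
    (hψ : ∀ y, |D y - (R i + R (i + 1)) / 2| ≤ r → 1 / 2 ≤ ψ i y) :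
    |annulusStep D R ψ i y - annulusStep D R ψ i z| ≤ 2 * |ψ i y - ψ i z| := by
  have hyz' := abs_le.1 hyz
  unfold annulusStep
  split_ifs with h1 h2 h2
  · exact abs_min_two_mul_sub_le _ _
  · have := hψ y (abs_le.2 ⟨by linarith, by linarith⟩)
    rw [min_eq_right (by linarith)]; simp
  · have := hψ z (abs_le.2 ⟨by linarith, by linarith⟩)
    rw [min_eq_right (by linarith)]; simp
  · simp

end AnnulusStep

lemma abs_d_sub_d_le (o y z : X) : |(W.d o y : ℝ) - W.d o z| ≤ W.d y z := by
  have h1 := W.d_triangle_real o y z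
  have h2 := W.d_triangle_real o z y
  rw [W.d_comm z y] at h2
  exact abs_le.2 ⟨by linarith, by linarith⟩

/-- Bump functions in a sequence of annuli with geometrically growing radii. -/
structure IsAnnular (W : WeightedGraph X) (o : X) (h : ℝ) (R : ℕ → ℝ) (ψ : ℕ → X → ℝ) : Prop where
  h_pos : 0 < h
  h_le_one : h ≤ 1
  R_succ : ∀ i, R (i + 1) = R i + h * R i
  one_le_R : ∀ i, 1 ≤ R i
  nonneg : ∀ i y, 0 ≤ ψ i y
  le_one : ∀ i y, ψ i y ≤ 1
  inner : ∀ i y, (W.d o y : ℝ) ≤ R i → ψ i y = 0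
  outer : ∀ i y, R (i + 1) ≤ (W.d o y : ℝ) → ψ i y = 0
  mid : ∀ i y, |(W.d o y : ℝ) - (R i + R (i + 1)) / 2| ≤ h * R i / 16 → 1 / 2 ≤ ψ i y

/-- The weight built from annular bump functions. -/
noncomputable def annularWeight (W : WeightedGraph X) (o : X) (κ : ℝ) (R : ℕ → ℝ)
    (ψ : ℕ → X → ℝ) (I : ℕ) : X → ℝ :=
  layerWeight κ (annulusStep (fun y => (W.d o y : ℝ)) R ψ) I

/-- Pairs at a distance comparable to their distances to `o`. -/
def IsFar (W : WeightedGraph X) (o : X) (h : ℝ) (y z : X) : Prop :=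
  h / 128 * ((W.d o y : ℝ) + W.d o z) < W.d y z

lemma IsFar.symm {o : X} {h : ℝ} {y z : X} (hf : W.IsFar o h y z) : W.IsFar o h z y := by
  unfold IsFar at *; rw [W.d_comm z y, add_comm]; exact hf

namespace IsAnnular

variable {o : X} {h κ : ℝ} {R : ℕ → ℝ} {ψ : ℕ → X → ℝ} (H : W.IsAnnular o h R ψ) {I : ℕ}
include H

lemma strictMono : StrictMono R := strictMono_nat_of_lt_succ fun i => by
  rw [H.R_succ]; nlinarith [H.one_le_R i, H.h_pos]

lemma R_eq (i : ℕ) : R i = R 0 * (1 + h) ^ i := by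
  induction i with
  | zero => simp
  | succ i ih => rw [H.R_succ, ih]; ring

lemma step_nonneg (i : ℕ) (y : X) :
    0 ≤ annulusStep (fun y => (W.d o y : ℝ)) R ψ i y := annulusStep_nonneg H.nonneg i y

lemma step_eq_zero {i : ℕ} {y : X} (hy : (W.d o y : ℝ) ≤ R i) :
    annulusStep (fun y => (W.d o y : ℝ)) R ψ i y = 0 :=
  annulusStep_eq_zero H.strictMono H.inner hy

lemma step_eq_one {i : ℕ} {y : X} (hy : R (i + 1) ≤ (W.d o y : ℝ)) :
    annulusStep (fun y => (W.d o y : ℝ)) R ψ i y = 1 :=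
  annulusStep_eq_one H.strictMono hy

lemma weight_le (hκ : 0 ≤ κ) {i : ℕ} {y : X} (hy : (W.d o y : ℝ) ≤ R i) :
    W.annularWeight o κ R ψ I y ≤ (1 + κ) ^ i :=
  layerWeight_le hκ (fun i => annulusStep_le_one i y) fun _ hj =>
    H.step_eq_zero (hy.trans (H.strictMono.monotone hj))

omit H in
lemma weight_le_top (hκ : 0 ≤ κ) (y : X) : W.annularWeight o κ R ψ I y ≤ (1 + κ) ^ I :=
  layerWeight_le_top hκ fun i => annulusStep_le_one i y

lemma le_weight (hκ : 0 ≤ κ) {i : ℕ} {y : X} (hi : i ≤ I) (hy : R i ≤ (W.d o y : ℝ)) :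
    (1 + κ) ^ i ≤ W.annularWeight o κ R ψ I y :=
  le_layerWeight hκ (fun i => H.step_nonneg i y) hi fun _ hj =>
    H.step_eq_one ((H.strictMono.monotone hj).trans hy)

lemma one_le_weight (hκ : 0 ≤ κ) (y : X) : 1 ≤ W.annularWeight o κ R ψ I y := by
  have := le_layerWeight (I := I) hκ (fun i => H.step_nonneg i y) (i := 0) (Nat.zero_le _)
    (fun j hj => absurd hj (Nat.not_lt_zero j))
  rwa [pow_zero] at this

lemma exists_index {y : X} (hy : R 0 ≤ (W.d o y : ℝ)) :
    ∃ i, R i ≤ (W.d o y : ℝ) ∧ (W.d o y : ℝ) < R (i + 1) := by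
  have hR0 : 0 < R 0 := by linarith [H.one_le_R 0]
  obtain ⟨i, h1, h2⟩ := exists_nat_pow_near (x := (W.d o y : ℝ) / R 0) (y := 1 + h)
    (by rw [le_div_iff₀ hR0]; linarith) (by linarith [H.h_pos])
  rw [le_div_iff₀ hR0] at h1
  rw [div_lt_iff₀ hR0] at h2
  exact ⟨i, by rw [H.R_eq]; linarith, by rw [H.R_eq]; linarith⟩

/-- In a local pair d(o,z) is at most (2 + 5 d(o,y))/3, so z lies at most 1 + p annuli beyond y,
each worth a factor 1 + κ. Beyond the last annulus the weight is constant. -/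
lemma weight_le_of_isLocal (hκ : 0 ≤ κ) {p : ℕ} (hp : 4 ≤ (1 + h) ^ p) {y z : X}
    (hyz : W.IsLocal o y z) :
    W.annularWeight o κ R ψ I z ≤ (1 + κ) ^ (1 + p) * W.annularWeight o κ R ψ I y := by
  have h3 := hyz.d_le
  have hvy := H.one_le_weight (I := I) hκ y
  have hCp : (1 : ℝ) ≤ (1 + κ) ^ (1 + p) := one_le_pow₀ (by linarith)
  rcases lt_or_ge (W.d o y : ℝ) (R 0) with hy | hy
  · have h4 : (W.d o z : ℝ) ≤ R (1 + p) := by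
      rw [H.R_eq, pow_add, pow_one]
      have h1 := H.one_le_R 0
      have h2 := H.h_pos
      have h5 : 4 ≤ (1 + h) * (1 + h) ^ p := by nlinarith
      nlinarith
    have := H.weight_le (I := I) hκ h4
    nlinarith
  · obtain ⟨i, hi1, hi2⟩ := H.exists_index hy
    rcases le_or_gt I i with hIi | hIi
    · have h5 := H.le_weight hκ le_rfl ((H.strictMono.monotone hIi).trans hi1)
      have h6 := weight_le_top (W := W) (o := o) (R := R) (ψ := ψ) (I := I) hκ z
      nlinarith
    · have h5 := H.le_weight hκ hIi.le hi1
      have h4 : (W.d o z : ℝ) ≤ R (i + (1 + p)) := by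
        have e : R (i + (1 + p)) = R (i + 1) * (1 + h) ^ p := by
          rw [H.R_eq (i + 1), H.R_eq (i + (1 + p))]; ring
        rw [e]
        have := H.one_le_R (i + 1)
        nlinarith
      have h6 := H.weight_le (I := I) hκ h4
      rw [pow_add] at h6
      nlinarith

/-- The relation `haq` is (1+h)^q = (1+κ)²: it matches the growth of v² per annulus with that of the
q-th power of the radius. -/
lemma weight_sq_le (hκ : 0 ≤ κ) (hκ1 : κ ≤ 1) {q : ℝ} (hq : 0 < q)
    (haq : ∀ i : ℕ, ((1 + h) ^ i) ^ q = ((1 + κ) ^ i) ^ 2) (y : X) :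
    W.annularWeight o κ R ψ I y ^ 2 ≤ 4 * (1 + (W.d o y : ℝ)) ^ q := by
  have hv1 := H.one_le_weight (I := I) hκ y
  have hpos : 1 ≤ (1 + (W.d o y : ℝ)) ^ q :=
    Real.one_le_rpow (by linarith [Nat.cast_nonneg (α := ℝ) (W.d o y)]) hq.le
  rcases lt_or_ge (W.d o y : ℝ) (R 0) with hy | hy
  · have := H.weight_le (I := I) hκ hy.le
    rw [pow_zero] at this
    nlinarith
  · obtain ⟨i, hi1, hi2⟩ := H.exists_index hy
    have h1 := H.weight_le (I := I) hκ hi2.le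
    have h2 : W.annularWeight o κ R ψ I y ≤ 2 * (1 + κ) ^ i := by
      rw [pow_succ] at h1
      have : 0 < (1 + κ) ^ i := by positivity
      nlinarith
    have h3 : ((1 + κ) ^ i) ^ 2 ≤ (1 + (W.d o y : ℝ)) ^ q := by
      have := H.h_pos
      rw [← haq]
      apply Real.rpow_le_rpow (by positivity) _ hq.le
      have : (1 + h) ^ i ≤ R i := by
        rw [H.R_eq]
        have : 0 < (1 + h) ^ i := by positivity
        nlinarith [H.one_le_R 0]
      linarith
    nlinarith

lemma le_weight_sq (hκ : 0 ≤ κ) {q : ℝ} (hq : 0 < q)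
    (haq : ∀ i : ℕ, ((1 + h) ^ i) ^ q = ((1 + κ) ^ i) ^ 2) {y : X}
    (hy : (W.d o y : ℝ) < R I) :
    (1 + (W.d o y : ℝ)) ^ q ≤ (4 * R 0) ^ q * W.annularWeight o κ R ψ I y ^ 2 := by
  have hvy := H.one_le_weight (I := I) hκ y
  have hR0 := H.one_le_R 0
  rcases lt_or_ge (W.d o y : ℝ) (R 0) with hy' | hy'
  · have h5 : (1 + (W.d o y : ℝ)) ^ q ≤ (4 * R 0) ^ q :=
      Real.rpow_le_rpow (by positivity) (by linarith) hq.le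
    have h6 : 0 < (4 * R 0) ^ q := by positivity
    have h7 : 1 ≤ W.annularWeight o κ R ψ I y ^ 2 := one_le_pow₀ hvy
    exact h5.trans (le_mul_of_one_le_right h6.le h7)
  · obtain ⟨i, hi1, hi2⟩ := H.exists_index hy'
    have hiI : i < I := H.strictMono.lt_iff_lt.1 (hi1.trans_lt hy)
    have h5 := H.le_weight hκ hiI.le hi1
    have hh := H.h_pos
    have h6 : (1 + (W.d o y : ℝ)) ^ q ≤ (4 * R 0) ^ q * ((1 + κ) ^ i) ^ 2 := by
      rw [← haq, ← Real.mul_rpow (by positivity) (by positivity)]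
      apply Real.rpow_le_rpow (by positivity) _ hq.le
      have e : R (i + 1) = (1 + h) * (R 0 * (1 + h) ^ i) := by rw [H.R_eq]; ring
      rw [e] at hi2
      have h7 : 0 < R 0 * (1 + h) ^ i := by positivity
      have h8 := H.h_le_one
      nlinarith
    refine h6.trans ?_
    gcongr

lemma mem_annulus {i : ℕ} {y : X} (hi : ψ i y ≠ 0) :
    R i < (W.d o y : ℝ) ∧ (W.d o y : ℝ) < R (i + 1) :=
  ⟨lt_of_not_ge fun hc => hi (H.inner i y hc), lt_of_not_ge fun hc => hi (H.outer i y hc)⟩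

lemma annulus_unique {i j : ℕ} {t : ℝ} (hi : R i < t ∧ t < R (i + 1))
    (hj : R j < t ∧ t < R (j + 1)) : i = j := by
  have h1 := H.strictMono.lt_iff_lt.1 (hi.1.trans hj.2)
  have h2 := H.strictMono.lt_iff_lt.1 (hj.1.trans hi.2)
  omega

/-- The constant 128 makes non-far pairs starting in an annulus shorter than the range of its bump,
and much shorter than its width, so that in `not_cross` they cannot jump over it. -/
lemma d_le_of_not_isFar {i : ℕ} {y z : X} (hyz : ¬ W.IsFar o h y z)
    (hi : R i < (W.d o y : ℝ) ∧ (W.d o y : ℝ) < R (i + 1)) : (W.d y z : ℝ) ≤ h * R i / 16 := by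
  simp only [IsFar, not_lt] at hyz
  have h1 := (abs_le.1 (W.abs_d_sub_d_le o y z)).1
  have h2 := H.R_succ i
  have h3 := H.one_le_R i
  have hh := H.h_pos
  have hh1 := H.h_le_one
  have h4 : (W.d o y : ℝ) + W.d o z ≤ 4 * R i + W.d y z := by nlinarith
  have h5 : (W.d y z : ℝ) ≤ h / 128 * (4 * R i + W.d y z) := hyz.trans (by gcongr)
  have h6 : h / 128 * (W.d y z : ℝ) ≤ 1 / 128 * (W.d y z : ℝ) := by gcongr
  nlinarith

lemma not_cross {i : ℕ} {y z : X} (hyz : ¬ W.IsFar o h y z) (h1 : (W.d o y : ℝ) ≤ R i)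
    (h2 : R (i + 1) ≤ (W.d o z : ℝ)) : False := by
  simp only [IsFar, not_lt] at hyz
  have h3 := (abs_le.1 (W.abs_d_sub_d_le o y z)).1
  rw [H.R_succ] at h2
  have h4 := H.one_le_R i
  have hh := H.h_pos
  have hh1 := H.h_le_one
  have h5 : (W.d o y : ℝ) + W.d o z ≤ 2 * R i + W.d y z := by linarith
  have h6 : (W.d y z : ℝ) ≤ h / 128 * (2 * R i + W.d y z) := hyz.trans (by gcongr)
  have h7 : h / 128 * (W.d y z : ℝ) ≤ 1 / 128 * (W.d y z : ℝ) := by gcongr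
  nlinarith

lemma mem_annulus_of_step_ne {i : ℕ} {y z : X} (hyz : ¬ W.IsFar o h y z)
    (hne : annulusStep (fun y => (W.d o y : ℝ)) R ψ i y
      ≠ annulusStep (fun y => (W.d o y : ℝ)) R ψ i z) :
    (R i < (W.d o y : ℝ) ∧ (W.d o y : ℝ) < R (i + 1)) ∨
      (R i < (W.d o z : ℝ) ∧ (W.d o z : ℝ) < R (i + 1)) := by
  by_contra hc
  push Not at hc
  obtain ⟨hc1, hc2⟩ := hc
  rcases le_or_gt (W.d o y : ℝ) (R i) with h1 | h1
  · rcases le_or_gt (W.d o z : ℝ) (R i) with h2 | h2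
    · exact hne (by rw [H.step_eq_zero h1, H.step_eq_zero h2])
    · exact H.not_cross hyz h1 (hc2 h2)
  · rcases le_or_gt (W.d o z : ℝ) (R i) with h2 | h2
    · exact H.not_cross (fun hf => hyz hf.symm) h2 (hc1 h1)
    · exact hne (by rw [H.step_eq_one (hc1 h1), H.step_eq_one (hc2 h2)])

/-- Only the annuli containing y or z contribute, so at most two terms. Cauchy–Schwarz on two terms
costs 2 and `annulusStep_sub_le` costs 4, together 8. -/
lemma weight_sub_sq_le {y z : X} (hyz : ¬ W.IsFar o h y z) :
    (W.annularWeight o κ R ψ I y - W.annularWeight o κ R ψ I z) ^ 2 ≤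
      8 * ∑ i ∈ Finset.range I, (κ * (1 + κ) ^ i) ^ 2 *
        ((if (W.d y z : ℝ) ≤ h * R i / 16 then 1 else 0) * (ψ i y - ψ i z) ^ 2) := by
  classical
  set s := annulusStep (fun y => (W.d o y : ℝ)) R ψ with hs
  set J := (Finset.range I).filter fun i => s i y ≠ s i z with hJdef
  have hsum : W.annularWeight o κ R ψ I y - W.annularWeight o κ R ψ I z
      = ∑ i ∈ J, κ * (1 + κ) ^ i * (s i y - s i z) := by
    rw [hJdef, Finset.sum_filter]
    simp only [annularWeight, layerWeight]
    rw [add_sub_add_left_eq_sub, ← Finset.sum_sub_distrib]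
    refine Finset.sum_congr rfl fun i _ => ?_
    split_ifs with hi
    · ring
    · push Not at hi; rw [← hs, hi]; ring
  have hcard : J.card ≤ 2 := by
    have hsub : J ⊆ (Finset.range I).filter
          (fun i => R i < (W.d o y : ℝ) ∧ (W.d o y : ℝ) < R (i + 1))
        ∪ (Finset.range I).filter (fun i => R i < (W.d o z : ℝ) ∧ (W.d o z : ℝ) < R (i + 1)) := by
      intro i hi
      simp only [hJdef, Finset.mem_filter, Finset.mem_union] at hi ⊢
      rcases H.mem_annulus_of_step_ne hyz hi.2 with h1 | h1
      · exact Or.inl ⟨hi.1, h1⟩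
      · exact Or.inr ⟨hi.1, h1⟩
    have hone : ∀ y, ((Finset.range I).filter
        (fun i => R i < (W.d o y : ℝ) ∧ (W.d o y : ℝ) < R (i + 1))).card ≤ 1 := fun y =>
      Finset.card_le_one.2 fun i hi j hj => by
        simp only [Finset.mem_filter] at hi hj
        exact H.annulus_unique hi.2 hj.2
    have h1 := Finset.card_le_card hsub
    have h2 := Finset.card_union_le
      ((Finset.range I).filter (fun i => R i < (W.d o y : ℝ) ∧ (W.d o y : ℝ) < R (i + 1)))
      ((Finset.range I).filter (fun i => R i < (W.d o z : ℝ) ∧ (W.d o z : ℝ) < R (i + 1)))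
    have h3 := hone y
    have h4 := hone z
    omega
  have hterm : ∀ i ∈ J, (κ * (1 + κ) ^ i * (s i y - s i z)) ^ 2 ≤
      4 * ((κ * (1 + κ) ^ i) ^ 2 *
        ((if (W.d y z : ℝ) ≤ h * R i / 16 then 1 else 0) * (ψ i y - ψ i z) ^ 2)) := by
    intro i hi
    simp only [hJdef, Finset.mem_filter] at hi
    have hd : (W.d y z : ℝ) ≤ h * R i / 16 := by
      rcases H.mem_annulus_of_step_ne hyz hi.2 with h1 | h1
      · exact H.d_le_of_not_isFar hyz h1
      · rw [W.d_comm]; exact H.d_le_of_not_isFar (fun hf => hyz hf.symm) h1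
    rw [if_pos hd, one_mul, mul_pow]
    have h1 := annulusStep_sub_le (D := fun y => (W.d o y : ℝ)) (R := R) (ψ := ψ) (i := i)
      (y := y) (z := z) ((W.abs_d_sub_d_le o y z).trans hd) (H.mid i)
    have h2 : (s i y - s i z) ^ 2 ≤ 4 * (ψ i y - ψ i z) ^ 2 := by
      have := pow_le_pow_left₀ (abs_nonneg _) h1 2
      rw [sq_abs, mul_pow, sq_abs] at this
      linarith
    have := mul_le_mul_of_nonneg_left h2 (sq_nonneg (κ * (1 + κ) ^ i))
    linarith
  have hnn : ∀ i, 0 ≤ (κ * (1 + κ) ^ i) ^ 2 *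
      ((if (W.d y z : ℝ) ≤ h * R i / 16 then (1 : ℝ) else 0) * (ψ i y - ψ i z) ^ 2) := fun i => by
    split_ifs <;> positivity
  rw [hsum]
  calc _ ≤ (J.card : ℝ) * ∑ i ∈ J, (κ * (1 + κ) ^ i * (s i y - s i z)) ^ 2 :=
        sq_sum_le_card_mul_sum_sq
    _ ≤ 2 * ∑ i ∈ J, (κ * (1 + κ) ^ i * (s i y - s i z)) ^ 2 :=
        mul_le_mul_of_nonneg_right (by exact_mod_cast hcard)
          (Finset.sum_nonneg fun i _ => sq_nonneg _)
    _ ≤ 2 * ∑ i ∈ J, 4 * ((κ * (1 + κ) ^ i) ^ 2 *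
          ((if (W.d y z : ℝ) ≤ h * R i / 16 then 1 else 0) * (ψ i y - ψ i z) ^ 2)) :=
        mul_le_mul_of_nonneg_left (Finset.sum_le_sum hterm) (by norm_num)
    _ = 8 * ∑ i ∈ J, (κ * (1 + κ) ^ i) ^ 2 *
          ((if (W.d y z : ℝ) ≤ h * R i / 16 then 1 else 0) * (ψ i y - ψ i z) ^ 2) := by
        rw [← Finset.mul_sum]; ring
    _ ≤ _ := by
        refine mul_le_mul_of_nonneg_left ?_ (by norm_num)
        exact Finset.sum_le_sum_of_subset_of_nonneg (Finset.filter_subset _ _)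
          fun i _ _ => hnn i

/-- Only one bump function is seen at each point, and there it is small relative to the weight. -/
lemma sum_bump_le (hκ : 0 ≤ κ) {c : ℕ → ℝ} {B : ℝ} (hB : 0 ≤ B) {y : X}
    (hc : ∀ i, R i < (W.d o y : ℝ) → (W.d o y : ℝ) < R (i + 1) → c i ≤ B)
    (hc0 : ∀ i, 0 ≤ c i) (e : ℕ) (he : e ≠ 0) :
    ∑ i ∈ Finset.range I, (κ * (1 + κ) ^ i) ^ 2 * (c i * ψ i y ^ e)
      ≤ κ ^ 2 * B * W.annularWeight o κ R ψ I y ^ 2 := by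
  refine sum_le_of_subsingleton_support (by positivity) (fun i hi => ?_) ?_
  · rcases eq_or_ne (ψ i y) 0 with h0 | h0
    · rw [h0, zero_pow he]; simp; positivity
    · obtain ⟨h1, h2⟩ := H.mem_annulus h0
      have h3 := H.le_weight hκ (Finset.mem_range.1 hi).le h1.le
      have h4 : ψ i y ^ e ≤ 1 := pow_le_one₀ (H.nonneg i y) (H.le_one i y)
      calc _ ≤ (κ * W.annularWeight o κ R ψ I y) ^ 2 * (B * 1) := by
            have := hc i h1 h2
            have := hc0 i
            have := H.nonneg i y
            gcongr
        _ = _ := by ring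
  · intro i _ j _ hi hj
    have hi' : ψ i y ≠ 0 := fun h => hi (by rw [h, zero_pow he]; simp)
    have hj' : ψ j y ≠ 0 := fun h => hj (by rw [h, zero_pow he]; simp)
    exact H.annulus_unique (H.mem_annulus hi') (H.mem_annulus hj')

end IsAnnular

end WeightedGraph

namespace WeightedGraph

variable {X : Type*} {W : WeightedGraph X}

namespace IsAnnular

variable {o : X} {h κ : ℝ} {R : ℕ → ℝ} {ψ : ℕ → X → ℝ} (H : W.IsAnnular o h R ψ) {I : ℕ}
include H

open Classical in
-- Non-far pairs are charged to the bump energies. For far pairs the difference is bounded by the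
-- weight itself, which is harmless because such pairs carry little kernel mass; a pair both far and
-- non-local contributes nothing.
lemma kernel_mul_weight_sub_sq_le (hκ : 0 ≤ κ) {p : ℕ} (hp : 4 ≤ (1 + h) ^ p)
    {k A : X → X → ℝ} (hk : ∀ y z, 0 ≤ k y z) (hAloc : ∀ y z, W.IsLocal o y z → A y z = k y z)
    (hAfar : ∀ y z, ¬ W.IsLocal o y z → A y z = 0) (y z : X) :
    A y z * (W.annularWeight o κ R ψ I y - W.annularWeight o κ R ψ I z) ^ 2 ≤
      8 * (∑ i ∈ Finset.range I, (κ * (1 + κ) ^ i) ^ 2 *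
        ((if (W.d y z : ℝ) ≤ h * R i / 16 then k y z else 0) * (ψ i y - ψ i z) ^ 2))
      + (if W.IsFar o h y z then k y z else 0) *
        (((1 + κ) ^ (1 + p)) ^ 2 * W.annularWeight o κ R ψ I y ^ 2) := by
  have hnn : 0 ≤ 8 * (∑ i ∈ Finset.range I, (κ * (1 + κ) ^ i) ^ 2 *
      ((if (W.d y z : ℝ) ≤ h * R i / 16 then k y z else 0) * (ψ i y - ψ i z) ^ 2)) := by
    refine mul_nonneg (by norm_num) (Finset.sum_nonneg fun i _ => ?_)
    have := hk y z
    split_ifs <;> positivity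
  have hAk : A y z ≤ k y z := by
    by_cases hyz : W.IsLocal o y z
    · rw [hAloc y z hyz]
    · rw [hAfar y z hyz]; exact hk y z
  have hvy := H.one_le_weight (I := I) hκ y
  have hvz := H.one_le_weight (I := I) hκ z
  by_cases hf : W.IsFar o h y z
  · rw [if_pos hf]
    refine le_add_of_nonneg_of_le hnn ?_
    by_cases hyz : W.IsLocal o y z
    · rw [hAloc y z hyz]
      refine mul_le_mul_of_nonneg_left ?_ (hk y z)
      rw [← mul_pow]
      have h1 := H.weight_le_of_isLocal (I := I) hκ hp hyz
      have hCp : (1 : ℝ) ≤ (1 + κ) ^ (1 + p) := one_le_pow₀ (by linarith)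
      apply sq_le_sq'
      · linarith
      · have := le_mul_of_one_le_left (by linarith : 0 ≤ W.annularWeight o κ R ψ I y) hCp
        linarith
    · rw [hAfar y z hyz, zero_mul]
      exact mul_nonneg (hk y z) (by positivity)
  · rw [if_neg hf, zero_mul, add_zero]
    calc _ ≤ k y z * (W.annularWeight o κ R ψ I y - W.annularWeight o κ R ψ I z) ^ 2 :=
          mul_le_mul_of_nonneg_right hAk (sq_nonneg _)
      _ ≤ k y z * _ := mul_le_mul_of_nonneg_left (H.weight_sub_sq_le hf) (hk y z)
      _ = _ := by
          rw [mul_left_comm, Finset.mul_sum]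
          congr 1
          refine Finset.sum_congr rfl fun i _ => ?_
          split_ifs <;> ring

lemma isLocal_of_mem {i : ℕ} {y z : X} (hi : ψ i y ≠ 0) (hd : (W.d y z : ℝ) ≤ h * R i / 16) :
    W.IsLocal o y z := by
  have h1 := (H.mem_annulus hi).1
  have h2 := (abs_le.1 (W.abs_d_sub_d_le o y z)).2
  have h3 : h * R i ≤ 1 * R i :=
    mul_le_mul_of_nonneg_right H.h_le_one (by linarith [H.one_le_R i])
  unfold IsLocal
  linarith

omit H in
open Classical in
lemma sum_sum_expand {Ω : Finset X} {μ : X → ℝ} (k : X → X → ℝ) (f : Ω → ℝ) (c : ℕ → ℝ)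
    (F : ℕ → X → X → ℝ) (r : ℕ → ℝ) :
    ∑ y : Ω, ∑ z : Ω, μ y * μ z * f y ^ 2 * (∑ i ∈ Finset.range I, c i *
        ((if (W.d y z : ℝ) ≤ r i then k y z else 0) * F i y z))
      = ∑ i ∈ Finset.range I, c i * ∑ y : Ω, ∑ z : Ω,
        (if (W.d y z : ℝ) ≤ r i then μ y * k y z * μ z else 0) * (F i y z * f y ^ 2) := by
  simp only [Finset.mul_sum]
  rw [Finset.sum_comm (s := Finset.range I)]
  refine Finset.sum_congr rfl fun y _ => ?_
  rw [Finset.sum_comm (s := Finset.range I)]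
  refine Finset.sum_congr rfl fun z _ => Finset.sum_congr rfl fun i _ => ?_
  split_ifs <;> ring

end IsAnnular

open Classical in
/-- Radial weights comparable to `(1 + d)^{q/2}` up to a prescribed radius whose energy against
squares is as small as we please, up to a Hardy term. -/
lemma exists_weight {df dw β : ℝ} (hμ : W.ComparableToCounting) (hV : W.VolumeGrowth df)
    (hU : W.USG df dw) (hL : W.LSG df dw) (hdf : 0 < df) (hdw : 1 < dw) (hβ : 2 ≤ β)
    (hβw : β < dw) {K : W.SymmMarkovOperator} (hJ : K.J df β) {ε : ℝ} (hε : 0 < ε) :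
    ∃ C : ℝ, 0 < C ∧ ∀ (o : X) (Rmax : ℝ), ∃ (v : X → ℝ) (L : ℝ),
      (∀ y, 1 ≤ v y) ∧ (∀ y, v y ^ 2 ≤ C * (1 + (W.d o y : ℝ)) ^ (df + β)) ∧
      (∀ y, (W.d o y : ℝ) ≤ Rmax → (1 + (W.d o y : ℝ)) ^ (df + β) ≤ C * v y ^ 2) ∧
      ∀ Ω : Finset X, (∀ z, (W.d o z : ℝ) ≤ L → z ∈ Ω) → ∀ (A : X → X → ℝ),
        (∀ y z, W.IsLocal o y z → A y z = K.kernel y z) →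
        (∀ y z, ¬ W.IsLocal o y z → A y z = 0) → ∀ f : Ω → ℝ,
        ∑ y : Ω, ∑ z : Ω, W.vol y * A y z * W.vol z * ((v y - v z) ^ 2 * f y ^ 2)
          ≤ ε * (∑ y : Ω, ∑ z : Ω, W.vol y * A y z * W.vol z * (v y ^ 2 * (f y - f z) ^ 2))
            + C * ∑ y : Ω, W.vol y * f y ^ 2 * (v y ^ 2 * (1 + (W.d o y : ℝ)) ^ (-β)) := by
  have hβ0 : 0 < β := by linarith
  obtain ⟨C₁, r₀, hC₁, hr₀, hcut⟩ := exists_cutoff hμ hV hU hL hdf hdw hβ0 hβw hJ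
  obtain ⟨B, hB1, hk⟩ := hJ.bounds
  have hB : 0 < B := by linarith
  obtain ⟨Ct, hCt, htail⟩ := hV.tail_sum_le hμ hdf hβ0
  have hq0 : 0 < df + β := by positivity
  have hq2 : 2 ≤ df + β := by linarith
  -- Relative increments of the weight have size κ, so its energy carries a factor κ²: smallness
  -- comes from slow growth, not from a small cutoff constant.
  obtain ⟨κ, hκ0, hκ1, hκε⟩ : ∃ κ : ℝ, 0 < κ ∧ κ ≤ 1 ∧ 8 * C₁ * κ ^ 2 ≤ ε := by
    refine ⟨min 1 (ε / (8 * C₁)), by positivity, min_le_left _ _, ?_⟩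
    have h0 : 0 < min 1 (ε / (8 * C₁)) := by positivity
    have h1 : min 1 (ε / (8 * C₁)) ≤ 1 := min_le_left _ _
    have h2 : min 1 (ε / (8 * C₁)) ≤ ε / (8 * C₁) := min_le_right _ _
    rw [le_div_iff₀ (by positivity)] at h2
    generalize min 1 (ε / (8 * C₁)) = κ at *
    nlinarith
  -- The relative width h of the annuli is fixed by (1+h)^{df+β} = (1+κ)²; df + β ≥ 2 gives 1 + h ≤
  -- 1 + κ ≤ 2.
  obtain ⟨h, hh0, hh1, haq⟩ : ∃ h : ℝ, 0 < h ∧ h ≤ 1 ∧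
      ∀ i : ℕ, ((1 + h) ^ i) ^ (df + β) = ((1 + κ) ^ i) ^ 2 := by
    have ha1 : 1 < (1 + κ) ^ (2 / (df + β)) := Real.one_lt_rpow (by linarith) (by positivity)
    have ha2 : (1 + κ) ^ (2 / (df + β)) ≤ 2 := by
      calc _ ≤ (1 + κ) ^ (1 : ℝ) :=
            Real.rpow_le_rpow_of_exponent_le (by linarith) (by rw [div_le_one hq0]; exact hq2)
        _ ≤ 2 := by rw [Real.rpow_one]; linarith
    refine ⟨(1 + κ) ^ (2 / (df + β)) - 1, by linarith, by linarith, fun i => ?_⟩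
    rw [add_sub_cancel, ← Real.rpow_natCast ((1 + κ) ^ (2 / (df + β))) i,
      ← Real.rpow_mul (by positivity), ← Real.rpow_mul (by positivity), ← pow_mul,
      ← Real.rpow_natCast]
    congr 1
    push_cast
    field_simp
  obtain ⟨R, hRsucc, hR1, hRr, hRunb⟩ : ∃ R : ℕ → ℝ, (∀ i, R (i + 1) = R i + h * R i) ∧
      (∀ i, 1 ≤ R i) ∧ (∀ i, r₀ ≤ h * R i / 16) ∧ ∀ t, ∃ I, t < R I := by
    have hR₀1 : 16 ≤ 16 * r₀ / h := by rw [le_div_iff₀ hh0]; nlinarith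
    have hpow : ∀ i : ℕ, (1 : ℝ) ≤ (1 + h) ^ i := fun i => one_le_pow₀ (by linarith)
    refine ⟨fun i => 16 * r₀ / h * (1 + h) ^ i, fun i => by ring, fun i => ?_, fun i => ?_,
      fun t => ?_⟩
    · nlinarith [hpow i]
    · have e : h * (16 * r₀ / h * (1 + h) ^ i) / 16 = r₀ * (1 + h) ^ i := by field_simp
      rw [e]
      exact le_mul_of_one_le_right (by linarith) (hpow i)
    · obtain ⟨I, hI⟩ := pow_unbounded_of_one_lt t (by linarith : 1 < 1 + h)
      exact ⟨I, by nlinarith [hpow I]⟩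
  obtain ⟨p, hp⟩ : ∃ p : ℕ, 4 ≤ (1 + h) ^ p := by
    obtain ⟨p, hp⟩ := pow_unbounded_of_one_lt 4 (by linarith : 1 < 1 + h)
    exact ⟨p, hp.le⟩
  set Cp := (1 + κ) ^ (1 + p) with hCp
  set Cr := Cp ^ 2 * (B * Ct * (h / 128) ^ (-β)) with hCr
  set Cs := 8 * C₁ * (κ ^ 2 * ((h / 16) ^ (-β) * 3 ^ β)) with hCs
  have hCr0 : 0 < Cr := by positivity
  have hCs0 : 0 < Cs := by positivity
  have hR00 : 0 < (4 * R 0) ^ (df + β) := by have := hR1 0; positivity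
  refine ⟨4 + (4 * R 0) ^ (df + β) + (Cr + Cs), by positivity, fun o Rmax => ?_⟩
  obtain ⟨I, hI⟩ := hRunb Rmax
  -- The excluded set is the complement of the middle half of the annulus. The range h R_i / 16
  -- leaves room for ψ to vanish at both edges and to be at least 1/2 around the middle.
  choose ψ hψ0 hψ1 hψE hψE' hψCS using fun i : ℕ => hcut (h * R i / 16) (hRr i)
    {z | (W.d o z : ℝ) ≤ R i + h * R i / 4 ∨ R i + 3 * (h * R i) / 4 ≤ (W.d o z : ℝ)}
  have hhR : ∀ i, 0 < h * R i := fun i => mul_pos hh0 (by linarith [hR1 i])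
  have H : W.IsAnnular o h R ψ :=
    { h_pos := hh0
      h_le_one := hh1
      R_succ := hRsucc
      one_le_R := hR1
      nonneg := hψ0
      le_one := hψ1
      inner := fun i y hy => hψE i y fun z hz => Or.inl (by
        have := (abs_le.1 (W.abs_d_sub_d_le o y z)).1
        have := hhR i
        linarith)
      outer := fun i y hy => hψE i y fun z hz => Or.inr (by
        have := (abs_le.1 (W.abs_d_sub_d_le o y z)).2
        have := hhR i
        rw [hRsucc] at hy
        linarith)
      mid := fun i y hy => hψE' i y fun z hz => by
        have hy' := abs_le.1 hy
        rw [hRsucc] at hy'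
        have h1 := abs_le.1 (W.abs_d_sub_d_le o y z)
        have h2 := hhR i
        rintro (h3 | h3)
        · linarith
        · linarith }
  -- Bumps with i < I live inside radius R_I and have range at most R_{i+1} ≤ R_I, so radius 2 R_I
  -- contains every point they interact with.
  refine ⟨W.annularWeight o κ R ψ I, 2 * R I, H.one_le_weight hκ0.le, fun y => ?_, fun y hy => ?_,
    ?_⟩
  · refine (H.weight_sq_le hκ0.le hκ1 hq0 haq y).trans ?_
    gcongr
    linarith
  · refine (H.le_weight_sq hκ0.le hq0 haq (hy.trans_lt hI)).trans ?_
    gcongr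
    linarith
  intro Ω hΩ A hAloc hAfar f
  have hvol := fun y => (hμ.vol_pos y).le
  set v := W.annularWeight o κ R ψ I with hv
  have hA0 : ∀ y z, 0 ≤ A y z := fun y z => by
    by_cases hyz : W.IsLocal o y z
    · rw [hAloc y z hyz]; exact K.nonneg y z
    · rw [hAfar y z hyz]
  set T : ℕ → ℝ := fun i => ∑ y : Ω, ∑ z : Ω,
    (if (W.d y z : ℝ) ≤ h * R i / 16 then W.vol y * K.kernel y z * W.vol z else 0) *
      ((ψ i y - ψ i z) ^ 2 * f y ^ 2) with hT
  set S : ℕ → ℝ := fun i => ∑ y : Ω, ∑ z : Ω,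
    (if (W.d y z : ℝ) ≤ h * R i / 16 then W.vol y * K.kernel y z * W.vol z else 0) *
      (ψ i y ^ 2 * (f y - f z) ^ 2) with hS
  set F := ∑ y : Ω, ∑ z : Ω, W.vol y * ((if W.IsFar o h y z then K.kernel y z else 0) * W.vol z) *
    (Cp ^ 2 * v y ^ 2 * f y ^ 2) with hF
  set N := ∑ y : Ω, W.vol y * f y ^ 2 * (v y ^ 2 * (1 + (W.d o y : ℝ)) ^ (-β)) with hN
  have hstep1 : ∑ y : Ω, ∑ z : Ω, W.vol y * A y z * W.vol z * ((v y - v z) ^ 2 * f y ^ 2)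
      ≤ 8 * ∑ i ∈ Finset.range I, (κ * (1 + κ) ^ i) ^ 2 * T i + F := by
    rw [hT, ← IsAnnular.sum_sum_expand (W := W) (μ := W.vol) K.kernel f
      (fun i => (κ * (1 + κ) ^ i) ^ 2) (fun i y z => (ψ i y - ψ i z) ^ 2), hF, Finset.mul_sum,
      ← Finset.sum_add_distrib]
    refine Finset.sum_le_sum fun y _ => ?_
    rw [Finset.mul_sum, ← Finset.sum_add_distrib]
    refine Finset.sum_le_sum fun z _ => ?_
    have h1 := mul_le_mul_of_nonneg_left
      (H.kernel_mul_weight_sub_sq_le (I := I) hκ0.le hp K.nonneg hAloc hAfar y z)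
      (mul_nonneg (mul_nonneg (hvol y) (hvol z)) (sq_nonneg (f y)))
    rw [← hv, ← hCp] at h1
    refine le_trans (le_of_eq (by ring)) (h1.trans (le_of_eq ?_))
    rw [mul_add]
    congr 1
    · ring
    · ring
  -- A far pair at y has length at least (h/128) d(o,y); the kernel mass of such pairs is of order
  -- (1 + d(o,y))^{-β}, the Hardy weight.
  have hstep2 : F ≤ Cr * N := by
    rw [hF, hN, Finset.mul_sum]
    refine Finset.sum_le_sum fun y _ => ?_
    have hDy : (0 : ℝ) ≤ W.d o y := Nat.cast_nonneg _
    have h1 : ∑ z : Ω, (if W.IsFar o h y z then K.kernel y z else 0) * W.vol z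
        ≤ B * Ct * (h / 128) ^ (-β) * (1 + (W.d o y : ℝ)) ^ (-β) := by
      rw [Finset.sum_coe_sort Ω (fun z => (if W.IsFar o h y z then K.kernel y z else 0) * W.vol z)]
      have e1 : ∑ z ∈ Ω, (if W.IsFar o h y z then K.kernel y z else 0) * W.vol z
          = ∑ z ∈ Ω with W.IsFar o h y z, K.kernel y z * W.vol z := by
        rw [Finset.sum_filter]
        exact Finset.sum_congr rfl fun z _ => by split_ifs <;> simp
      rw [e1]
      calc _ ≤ ∑ z ∈ Ω with W.IsFar o h y z,
            B * (W.vol z * (1 + (W.d y z : ℝ)) ^ (-(df + β))) := by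
            refine Finset.sum_le_sum fun z _ => ?_
            have := mul_le_mul_of_nonneg_right (hk y z).2 (hvol z)
            linarith
        _ ≤ B * (Ct * (1 + h / 128 * (W.d o y : ℝ)) ^ (-β)) := by
            rw [← Finset.mul_sum]
            refine mul_le_mul_of_nonneg_left (htail y _ ?_ _ fun z hz => ?_) hB.le
            · have : 0 ≤ h / 128 * (W.d o y : ℝ) := by positivity
              linarith
            · have hz2 : W.IsFar o h y z := (Finset.mem_filter.1 hz).2
              unfold IsFar at hz2
              have : 0 ≤ h / 128 * (W.d o z : ℝ) := by positivity
              linarith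
        _ ≤ B * (Ct * (h / 128 * (1 + (W.d o y : ℝ))) ^ (-β)) := by
            refine mul_le_mul_of_nonneg_left (mul_le_mul_of_nonneg_left ?_ hCt.le) hB.le
            apply Real.rpow_le_rpow_of_nonpos (by positivity) _ (by linarith)
            linarith
        _ = _ := by
            rw [Real.mul_rpow (by positivity) (by linarith)]; ring
    calc _ = (∑ z : Ω, (if W.IsFar o h y z then K.kernel y z else 0) * W.vol z) *
          (W.vol y * (Cp ^ 2 * v y ^ 2 * f y ^ 2)) := by
          rw [Finset.sum_mul]; exact Finset.sum_congr rfl fun z _ => by ring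
      _ ≤ (B * Ct * (h / 128) ^ (-β) * (1 + (W.d o y : ℝ)) ^ (-β)) *
          (W.vol y * (Cp ^ 2 * v y ^ 2 * f y ^ 2)) :=
          mul_le_mul_of_nonneg_right h1 (mul_nonneg (hvol y) (by positivity))
      _ = _ := by rw [hCr]; ring
  have hψT : ∀ i ∈ Finset.range I, T i ≤ C₁ * S i
      + C₁ * (h * R i / 16) ^ (-β) * ∑ y : Ω, W.vol y * f y ^ 2 * ψ i y := by
    intro i hi
    refine hψCS i Ω (fun y hy z hd => hΩ z ?_) f
    have h1 := (H.mem_annulus hy.ne').2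
    have h2 := H.strictMono.monotone (Nat.succ_le_of_lt (Finset.mem_range.1 hi))
    have h3 := W.d_triangle_real o y z
    have h4 : h * R i / 16 ≤ R (i + 1) := by rw [hRsucc]; linarith [hhR i, hR1 i]
    simp only [Nat.succ_eq_add_one] at h2
    linarith
  -- Pairs in the range of a nonzero bump are local, so A may replace the kernel. At most one bump
  -- is nonzero at y, and there κ (1+κ)^i ≤ κ v(y).
  have hSsum : ∑ i ∈ Finset.range I, (κ * (1 + κ) ^ i) ^ 2 * S i
      ≤ κ ^ 2 * ∑ y : Ω, ∑ z : Ω, W.vol y * A y z * W.vol z * (v y ^ 2 * (f y - f z) ^ 2) := by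
    calc _ ≤ ∑ i ∈ Finset.range I, ∑ y : Ω, ∑ z : Ω, W.vol y * A y z * W.vol z * (f y - f z) ^ 2 *
          ((κ * (1 + κ) ^ i) ^ 2 * (1 * ψ i y ^ 2)) := by
          refine Finset.sum_le_sum fun i _ => ?_
          simp only [hS, Finset.mul_sum]
          refine Finset.sum_le_sum fun y _ => Finset.sum_le_sum fun z _ => ?_
          have hnn : 0 ≤ W.vol y * A y z * W.vol z * (f y - f z) ^ 2 *
              ((κ * (1 + κ) ^ i) ^ 2 * (1 * ψ i y ^ 2)) :=
            mul_nonneg (mul_nonneg (mul_nonneg (mul_nonneg (hvol y) (hA0 y z)) (hvol z))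
              (sq_nonneg _)) (by positivity)
          split_ifs with hd
          · rcases eq_or_ne (ψ i y) 0 with h0 | h0
            · rw [h0]; simp
            · rw [hAloc y z (H.isLocal_of_mem h0 hd)]
              exact le_of_eq (by ring)
          · simpa using hnn
      _ = ∑ y : Ω, ∑ z : Ω, W.vol y * A y z * W.vol z * (f y - f z) ^ 2 *
          ∑ i ∈ Finset.range I, (κ * (1 + κ) ^ i) ^ 2 * (1 * ψ i y ^ 2) := by
          rw [Finset.sum_comm]
          refine Finset.sum_congr rfl fun y _ => ?_
          rw [Finset.sum_comm]
          exact Finset.sum_congr rfl fun z _ => by rw [Finset.mul_sum]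
      _ ≤ ∑ y : Ω, ∑ z : Ω, W.vol y * A y z * W.vol z * (f y - f z) ^ 2 *
          (κ ^ 2 * 1 * v y ^ 2) := by
          refine Finset.sum_le_sum fun y _ => Finset.sum_le_sum fun z _ => ?_
          refine mul_le_mul_of_nonneg_left ?_
            (mul_nonneg (mul_nonneg (mul_nonneg (hvol y) (hA0 y z)) (hvol z)) (sq_nonneg _))
          exact H.sum_bump_le hκ0.le zero_le_one (fun _ _ _ => le_rfl) (fun _ => zero_le_one) 2
            two_ne_zero
      _ = _ := by
          simp only [Finset.mul_sum]
          exact Finset.sum_congr rfl fun y _ => Finset.sum_congr rfl fun z _ => by ring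
  -- In the annulus i one has 1 + d(o,y) ≤ 3 R_i, so the error (h R_i / 16)^{-β} of the i-th bump is
  -- again the Hardy weight.
  have hNsum : ∑ i ∈ Finset.range I, (κ * (1 + κ) ^ i) ^ 2 *
      ((h * R i / 16) ^ (-β) * ∑ y : Ω, W.vol y * f y ^ 2 * ψ i y)
      ≤ κ ^ 2 * ((h / 16) ^ (-β) * 3 ^ β) * N := by
    calc _ = ∑ y : Ω, W.vol y * f y ^ 2 * ∑ i ∈ Finset.range I, (κ * (1 + κ) ^ i) ^ 2 *
          ((h * R i / 16) ^ (-β) * ψ i y ^ 1) := by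
          simp only [Finset.mul_sum]
          rw [Finset.sum_comm]
          exact Finset.sum_congr rfl fun y _ => Finset.sum_congr rfl fun i _ => by ring
      _ ≤ ∑ y : Ω, W.vol y * f y ^ 2 *
          (κ ^ 2 * ((h / 16) ^ (-β) * 3 ^ β * (1 + (W.d o y : ℝ)) ^ (-β)) * v y ^ 2) := by
          refine Finset.sum_le_sum fun y _ => ?_
          refine mul_le_mul_of_nonneg_left ?_ (mul_nonneg (hvol y) (sq_nonneg _))
          refine H.sum_bump_le hκ0.le (by positivity) (fun i h1 h2 => ?_) (fun i => ?_) 1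
            one_ne_zero
          · have hRi := hR1 i
            rw [hRsucc] at h2
            have h3 : (1 + (W.d o y : ℝ)) / 3 ≤ R i := by
              have : h * R i ≤ 1 * R i := mul_le_mul_of_nonneg_right hh1 (by linarith)
              linarith
            have h4 : R i ^ (-β) ≤ ((1 + (W.d o y : ℝ)) / 3) ^ (-β) :=
              Real.rpow_le_rpow_of_nonpos (by positivity) h3 (by linarith)
            rw [Real.div_rpow (by positivity) (by norm_num), Real.rpow_neg (by norm_num :
              (0 : ℝ) ≤ 3), div_inv_eq_mul] at h4
            rw [show h * R i / 16 = h / 16 * R i by ring,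
              Real.mul_rpow (by positivity) (by linarith)]
            calc _ ≤ (h / 16) ^ (-β) * ((1 + (W.d o y : ℝ)) ^ (-β) * 3 ^ β) := by gcongr
              _ = _ := by ring
          · have := hhR i
            positivity
      _ = _ := by
          rw [hN, Finset.mul_sum]
          exact Finset.sum_congr rfl fun y _ => by ring
  set E := ∑ y : Ω, ∑ z : Ω, W.vol y * A y z * W.vol z * (v y ^ 2 * (f y - f z) ^ 2) with hE
  have hE0 : 0 ≤ E := Finset.sum_nonneg fun y _ => Finset.sum_nonneg fun z _ =>
    mul_nonneg (mul_nonneg (mul_nonneg (hvol y) (hA0 y z)) (hvol z)) (by positivity)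
  have hN0 : 0 ≤ N := Finset.sum_nonneg fun y _ =>
    mul_nonneg (mul_nonneg (hvol y) (sq_nonneg _)) (by positivity)
  have hTsum : ∑ i ∈ Finset.range I, (κ * (1 + κ) ^ i) ^ 2 * T i
      ≤ C₁ * (κ ^ 2 * E) + C₁ * (κ ^ 2 * ((h / 16) ^ (-β) * 3 ^ β) * N) := by
    calc _ ≤ ∑ i ∈ Finset.range I, (C₁ * ((κ * (1 + κ) ^ i) ^ 2 * S i)
          + C₁ * ((κ * (1 + κ) ^ i) ^ 2 *
            ((h * R i / 16) ^ (-β) * ∑ y : Ω, W.vol y * f y ^ 2 * ψ i y))) := by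
          refine Finset.sum_le_sum fun i hi => ?_
          have := mul_le_mul_of_nonneg_left (hψT i hi) (sq_nonneg (κ * (1 + κ) ^ i))
          linarith
      _ ≤ _ := by
          rw [Finset.sum_add_distrib, ← Finset.mul_sum, ← Finset.mul_sum]
          gcongr
  calc _ ≤ 8 * (C₁ * (κ ^ 2 * E) + C₁ * (κ ^ 2 * ((h / 16) ^ (-β) * 3 ^ β) * N)) + Cr * N := by
        linarith
    _ = 8 * C₁ * κ ^ 2 * E + (Cr + Cs) * N := by rw [hCs]; ring
    _ ≤ ε * E + (4 + (4 * R 0) ^ (df + β) + (Cr + Cs)) * N := by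
        refine add_le_add (mul_le_mul_of_nonneg_right hκε hE0) ?_
        refine mul_le_mul_of_nonneg_right ?_ hN0
        linarith

end WeightedGraph

/-! ### Nash inequality and on-diagonal decay. -/

/-- A Nash-type difference inequality forces polynomial decay. -/
lemma decay_of_nash {c C C₀ df β : ℝ} (hc : 0 < c) (hC : 0 < C) (hC₀ : 0 < C₀) (hdf : 0 < df)
    (hβ : 0 < β) :
    ∃ A : ℝ, 0 < A ∧ ∀ F : ℕ → ℝ, (∀ n, 0 ≤ F n) → (∀ n, F (n + 1) ≤ F n) → F 0 ≤ C₀ →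
      (∀ n, ∀ r : ℝ, 1 ≤ r → c * r ^ df * F n ≤ 1 + C * r ^ (df + β) * (F n - F (n + 1))) →
      ∀ n : ℕ, F n ≤ A * ((n : ℝ) + 1) ^ (-(df / β)) := by
  set γ := df / β with hγ
  have hγ0 : 0 < γ := by positivity
  -- The inequality is used with r^β = s(n+1). This s makes the relative decrease exactly
  -- (γ+1)/(n+1), one unit of 1/(n+1) more than the decay rate γ requires.
  set s := c / (C * (γ + 1)) with hs
  have hs0 : 0 < s := by positivity
  set G := 1 / C * s ^ (-γ - 1) with hG
  have hG0 : 0 < G := by positivity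
  refine ⟨C₀ + 2 ^ γ * G + C₀ * (2 / s) ^ γ, by positivity, fun F hF0 hFanti hF hN n => ?_⟩
  set A := C₀ + 2 ^ γ * G + C₀ * (2 / s) ^ γ with hA
  have hanti : ∀ n, F n ≤ C₀ := fun n => by
    induction n with
    | zero => exact hF
    | succ n ih => exact (hFanti n).trans ih
  have hA1 : C₀ ≤ A := by
    have : 0 < 2 ^ γ * G := by positivity
    have : 0 < C₀ * (2 / s) ^ γ := by positivity
    linarith
  have hA2 : 2 ^ γ * G ≤ A := by
    have : 0 < C₀ * (2 / s) ^ γ := by positivity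
    linarith
  have hA3 : C₀ * (2 / s) ^ γ ≤ A := by
    have : 0 < 2 ^ γ * G := by positivity
    linarith
  have hA0 : 0 < A := by linarith
  have hAG : G ≤ A := le_trans (le_mul_of_one_le_left hG0.le
    (Real.one_le_rpow (by norm_num) hγ0.le)) hA2
  induction n with
  | zero => simpa using hF.trans hA1
  | succ n ih =>
    push_cast
    set t : ℝ := (n : ℝ) + 1 with ht
    have ht1 : 1 ≤ t := by rw [ht]; linarith [Nat.cast_nonneg (α := ℝ) n]
    have ht0 : 0 < t := by linarith
    have hhalf : t ^ (-γ) ≤ 2 ^ γ * (t + 1) ^ (-γ) := by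
      have h1 : (2 * t) ^ (-γ) ≤ (t + 1) ^ (-γ) :=
        Real.rpow_le_rpow_of_nonpos (by linarith) (by linarith) (by linarith)
      rw [Real.mul_rpow (by norm_num) ht0.le, Real.rpow_neg (by norm_num)] at h1
      calc t ^ (-γ) = 2 ^ γ * ((2 ^ γ)⁻¹ * t ^ (-γ)) := by field_simp
        _ ≤ _ := by gcongr
    rcases lt_or_ge (s * t) 1 with hst | hst
    · refine (hanti _).trans ?_
      have h1 : (2 / s) ^ (-γ) ≤ (t + 1) ^ (-γ) := by
        apply Real.rpow_le_rpow_of_nonpos (by linarith) _ (by linarith)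
        rw [le_div_iff₀ hs0]; nlinarith
      calc C₀ = C₀ * (2 / s) ^ γ * (2 / s) ^ (-γ) := by
            rw [Real.rpow_neg (by positivity)]; field_simp
        _ ≤ A * (t + 1) ^ (-γ) := by gcongr
    · have hr1 : 1 ≤ (s * t) ^ (1 / β) := Real.one_le_rpow hst (by positivity)
      have h1 := hN n _ hr1
      have hst0 : 0 < s * t := by positivity
      have e1 : ((s * t) ^ (1 / β)) ^ df = (s * t) ^ γ := by
        rw [← Real.rpow_mul hst0.le]; congr 1; rw [hγ]; ring
      have e2 : ((s * t) ^ (1 / β)) ^ (df + β) = (s * t) ^ γ * (s * t) := by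
        rw [← Real.rpow_mul hst0.le, ← Real.rpow_add_one hst0.ne']; congr 1; rw [hγ]; field_simp
      rw [e1, e2] at h1
      have hp : 0 < (s * t) ^ γ := by positivity
      have h2 : F (n + 1) ≤ F n * (1 - (γ + 1) / t) + G * (t ^ (-γ) / t) := by
        have e3 : G * (t ^ (-γ) / t) = 1 / (C * ((s * t) ^ γ * (s * t))) := by
          rw [hG, Real.rpow_sub_one hs0.ne', Real.mul_rpow hs0.le ht0.le, Real.rpow_neg hs0.le,
            Real.rpow_neg ht0.le]
          field_simp
        have e4 : (γ + 1) / t = c * (s * t) ^ γ / (C * ((s * t) ^ γ * (s * t))) := by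
          rw [hs]; field_simp
        rw [e3, e4]
        have hden : 0 < C * ((s * t) ^ γ * (s * t)) := by positivity
        rw [mul_sub, mul_one, ← sub_nonneg]
        have : F n - F n * (c * (s * t) ^ γ / (C * ((s * t) ^ γ * (s * t))))
            + 1 / (C * ((s * t) ^ γ * (s * t))) - F (n + 1)
            = (1 + C * ((s * t) ^ γ * (s * t)) * (F n - F (n + 1)) - c * (s * t) ^ γ * F n)
              / (C * ((s * t) ^ γ * (s * t))) := by
          field_simp
          ring
        rw [this]
        apply div_nonneg _ hden.le
        linarith
      have htg : 0 < t ^ (-γ) := by positivity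
      rcases le_or_gt 0 (1 - (γ + 1) / t) with hpos | hneg
      -- The spare 1/t in the factor 1 - (γ+1)/t absorbs the source term G t^{-γ-1}, since G ≤ A.
      · have hbern : t ^ (-γ) * (1 - γ / t) ≤ (t + 1) ^ (-γ) := by
          have h3 := rpow_neg_bernoulli (x := 1 + 1 / t) (a := γ) (by positivity) hγ0.le
          have e5 : (t + 1) ^ (-γ) = t ^ (-γ) * (1 + 1 / t) ^ (-γ) := by
            rw [← Real.mul_rpow ht0.le (by positivity)]; congr 1; field_simp
          rw [e5]
          gcongr
          calc _ = 1 + γ * (1 - (1 + 1 / t)) := by ring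
            _ ≤ _ := h3
        calc F (n + 1) ≤ A * t ^ (-γ) * (1 - (γ + 1) / t) + G * (t ^ (-γ) / t) :=
              h2.trans (by gcongr)
          _ ≤ A * t ^ (-γ) * (1 - (γ + 1) / t) + A * (t ^ (-γ) / t) := by gcongr
          _ = A * (t ^ (-γ) * (1 - γ / t)) := by field_simp; ring
          _ ≤ _ := by gcongr
      -- For small n the factor is negative; the source term alone then bounds F(n+1).
      · have h3 : F n * (1 - (γ + 1) / t) ≤ 0 :=
          mul_nonpos_of_nonneg_of_nonpos (hF0 n) hneg.le
        have h4 : t ^ (-γ) / t ≤ t ^ (-γ) := div_le_self htg.le ht1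
        calc F (n + 1) ≤ G * t ^ (-γ) := by nlinarith
          _ ≤ G * (2 ^ γ * (t + 1) ^ (-γ)) := by gcongr
          _ = 2 ^ γ * G * (t + 1) ^ (-γ) := by ring
          _ ≤ _ := by gcongr

/-- A symmetric sub-Markov kernel on a finite measure space. -/
structure IsSubMarkov {ι : Type*} [Fintype ι] (k : ι → ι → ℝ) (μ : ι → ℝ) : Prop where
  nonneg : ∀ y z, 0 ≤ k y z
  symm : ∀ y z, k y z = k z y
  pos : ∀ y, 0 < μ y
  row : ∀ y, ∑ z, k y z * μ z ≤ 1

/-- The matrix of transition probabilities. -/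
def kernelMatrix {ι : Type*} (k : ι → ι → ℝ) (μ : ι → ℝ) : Matrix ι ι ℝ :=
  Matrix.of fun y z => k y z * μ z

lemma kernelMatrix_apply {ι : Type*} (k : ι → ι → ℝ) (μ : ι → ℝ) (y z : ι) :
    kernelMatrix k μ y z = k y z * μ z := rfl

namespace IsSubMarkov

variable {ι : Type*} [Fintype ι] [DecidableEq ι] {k : ι → ι → ℝ} {μ : ι → ℝ}
  (H : IsSubMarkov k μ)
include H

omit [DecidableEq ι] in
lemma matrix_nonneg (y z : ι) : 0 ≤ kernelMatrix k μ y z := mul_nonneg (H.nonneg y z) (H.pos z).le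

lemma pow_nonneg (n : ℕ) (y z : ι) : 0 ≤ (kernelMatrix k μ ^ n) y z := by
  induction n generalizing y z with
  | zero => rw [pow_zero, Matrix.one_apply]; split_ifs <;> norm_num
  | succ n ih =>
    rw [pow_succ, Matrix.mul_apply]
    exact Finset.sum_nonneg fun w _ => mul_nonneg (ih y w) (H.matrix_nonneg w z)

omit H in
lemma pow_succ_apply (n : ℕ) (y z : ι) :
    (kernelMatrix k μ ^ (n + 1)) y z = ∑ w, k y w * μ w * (kernelMatrix k μ ^ n) w z := by
  rw [pow_succ', Matrix.mul_apply]; rfl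

lemma pow_row (n : ℕ) (y : ι) : ∑ z, (kernelMatrix k μ ^ n) y z ≤ 1 := by
  induction n generalizing y with
  | zero => simp [Matrix.one_apply]
  | succ n ih =>
    simp only [pow_succ_apply]
    rw [Finset.sum_comm]
    calc _ = ∑ w, k y w * μ w * ∑ z, (kernelMatrix k μ ^ n) w z := by
          simp only [Finset.mul_sum]
      _ ≤ ∑ w, k y w * μ w * 1 :=
          Finset.sum_le_sum fun w _ => mul_le_mul_of_nonneg_left (ih w) (H.matrix_nonneg y w)
      _ ≤ 1 := by simpa using H.row y

lemma pow_symm (n : ℕ) (y z : ι) :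
    μ y * (kernelMatrix k μ ^ n) y z = μ z * (kernelMatrix k μ ^ n) z y := by
  induction n generalizing y z with
  | zero =>
    rw [pow_zero, Matrix.one_apply, Matrix.one_apply]
    by_cases h : y = z
    · subst h; rfl
    · simp [h, Ne.symm h]
  | succ n ih =>
    rw [pow_succ_apply, pow_succ, Matrix.mul_apply, Finset.mul_sum, Finset.mul_sum]
    refine Finset.sum_congr rfl fun w _ => ?_
    rw [kernelMatrix_apply, H.symm w y]
    calc _ = μ y * k y w * (μ w * (kernelMatrix k μ ^ n) w z) := by ring
      _ = _ := by rw [ih w z]; ring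

lemma column_mass_le (n : ℕ) (x : ι) : ∑ y, μ y * (kernelMatrix k μ ^ n) y x ≤ μ x := by
  calc _ = μ x * ∑ y, (kernelMatrix k μ ^ n) x y := by
        rw [Finset.mul_sum]; exact Finset.sum_congr rfl fun y _ => H.pow_symm n y x
    _ ≤ μ x * 1 := mul_le_mul_of_nonneg_left (H.pow_row n x) (H.pos x).le
    _ = μ x := mul_one _

omit [DecidableEq ι] in
/-- Nash inequality for one function. -/
lemma nash {δ : ℝ} (hδ0 : 0 < δ) (hδ1 : δ ≤ 1) (hδ : ∀ y, δ ≤ k y y * μ y)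
    {near : ι → ι → Prop} [∀ y z, Decidable (near y z)] (hnear : ∀ y z, near y z → near z y)
    {V B : ℝ} (hB : 0 ≤ B)
    (hV : ∀ y, V ≤ (∑ z, if near y z then μ z else 0) + B * (1 - ∑ z, k y z * μ z))
    (hk : ∀ y z, near y z → 1 ≤ B * k y z) {f : ι → ℝ} (hf0 : ∀ y, 0 ≤ f y)
    (hf1 : ∑ y, μ y * f y ≤ 1) :
    V * ∑ y, μ y * f y ^ 2 ≤ 1 + B / δ *
      (∑ y, μ y * f y ^ 2 - ∑ y, μ y * (∑ z, k y z * μ z * f z) ^ 2) := by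
  set m : ι → ℝ := fun y => ∑ z, k y z * μ z with hm
  set E := ∑ y, ∑ z, μ y * k y z * μ z * (f y - f z) ^ 2 with hE
  set Q := ∑ y, μ y * f y ^ 2 * (1 - m y) with hQ
  have hQ0 : 0 ≤ Q := Finset.sum_nonneg fun y _ =>
    mul_nonneg (mul_nonneg (H.pos y).le (sq_nonneg _)) (by linarith [H.row y])
  have hE0 : 0 ≤ E := Finset.sum_nonneg fun y _ => Finset.sum_nonneg fun z _ =>
    mul_nonneg (mul_nonneg (mul_nonneg (H.pos y).le (H.nonneg y z)) (H.pos z).le) (sq_nonneg _)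
  have h1 := weighted_variance_le H.nonneg H.pos H.row hδ (w := fun _ => 1)
    (fun _ => zero_le_one) f
  simp only [one_mul] at h1
  have h2 : ∑ y, ∑ z, μ y * k y z * μ z * f z ^ 2 = ∑ y, μ y * f y ^ 2 - Q := by
    rw [sum_sum_swap, hQ, ← Finset.sum_sub_distrib]
    refine Finset.sum_congr rfl fun y _ => ?_
    simp only [hm]
    calc _ = μ y * f y ^ 2 * ∑ z, k y z * μ z := by
          rw [Finset.mul_sum]
          exact Finset.sum_congr rfl fun z _ => by rw [H.symm z y]; ring
      _ = _ := by ring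
  rw [h2] at h1
  -- The L² norm decreases both by the energy E and by the killing Q, the mass lost out of the
  -- finite set; δ ≤ 1 allows a common factor.
  have h3 : δ * (E / 2 + Q) ≤
      ∑ y, μ y * f y ^ 2 - ∑ y, μ y * (∑ z, k y z * μ z * f z) ^ 2 := by
    have : δ * Q ≤ 1 * Q := mul_le_mul_of_nonneg_right hδ1 hQ0
    have : 0 ≤ δ * E := by positivity
    linarith
  -- Sum f(y)² + f(z)² = (f(y) - f(z))² + 2 f(y) f(z) over near pairs: the squares are energy, and
  -- the products total at most the square of the L¹ norm.
  have h4 : ∑ y, ∑ z, (if near y z then μ y * μ z * f y ^ 2 else 0)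
      ≤ 1 + B * (E / 2) := by
    have hsw : ∑ y, ∑ z, (if near y z then μ y * μ z * f y ^ 2 else 0)
        = ∑ y, ∑ z, (if near y z then μ y * μ z * f z ^ 2 else 0) := by
      rw [sum_sum_swap]
      refine Finset.sum_congr rfl fun y _ => Finset.sum_congr rfl fun z _ => ?_
      by_cases h : near y z
      · rw [if_pos h, if_pos (hnear y z h)]; ring
      · rw [if_neg h, if_neg fun h' => h (hnear z y h')]
    have h5 : ∑ y, ∑ z, (if near y z then μ y * μ z * f y ^ 2 else 0)
        + ∑ y, ∑ z, (if near y z then μ y * μ z * f y ^ 2 else 0)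
        ≤ ∑ y, ∑ z, (2 * ((μ y * f y) * (μ z * f z))
          + B * (μ y * k y z * μ z * (f y - f z) ^ 2)) := by
      conv_lhs => arg 2; rw [hsw]
      simp only [← Finset.sum_add_distrib]
      refine Finset.sum_le_sum fun y _ => Finset.sum_le_sum fun z _ => ?_
      have hμμ : 0 ≤ μ y * μ z := mul_nonneg (H.pos y).le (H.pos z).le
      have hff : 0 ≤ f y * f z := mul_nonneg (hf0 y) (hf0 z)
      split_ifs with h
      · have := mul_le_mul_of_nonneg_right (hk y z h)
          (mul_nonneg hμμ (sq_nonneg (f y - f z)))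
        nlinarith
      · have := mul_nonneg hB (mul_nonneg (mul_nonneg (mul_nonneg (H.pos y).le (H.nonneg y z))
          (H.pos z).le) (sq_nonneg (f y - f z)))
        have := mul_nonneg hμμ hff
        nlinarith
    have h6 : ∑ y, ∑ z, (2 * ((μ y * f y) * (μ z * f z))
        + B * (μ y * k y z * μ z * (f y - f z) ^ 2))
        = 2 * (∑ y, μ y * f y) ^ 2 + B * E := by
      simp only [Finset.sum_add_distrib, ← Finset.mul_sum, hE]
      rw [← Finset.sum_mul]; ring
    have h7 : (∑ y, μ y * f y) ^ 2 ≤ 1 := by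
      have : 0 ≤ ∑ y, μ y * f y := Finset.sum_nonneg fun y _ => mul_nonneg (H.pos y).le (hf0 y)
      nlinarith
    linarith
  have h8 : V * ∑ y, μ y * f y ^ 2 ≤ 1 + B * (E / 2 + Q) := by
    calc V * ∑ y, μ y * f y ^ 2 ≤ ∑ y, ((∑ z, if near y z then μ y * μ z * f y ^ 2 else 0)
          + B * (μ y * f y ^ 2 * (1 - m y))) := by
          rw [Finset.mul_sum]
          refine Finset.sum_le_sum fun y _ => ?_
          have := mul_le_mul_of_nonneg_right (hV y) (mul_nonneg (H.pos y).le (sq_nonneg (f y)))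
          refine this.trans (le_of_eq ?_)
          rw [add_mul, Finset.sum_mul]
          congr 1
          · exact Finset.sum_congr rfl fun z _ => by split_ifs <;> ring
          · ring
      _ ≤ _ := by
          rw [Finset.sum_add_distrib, ← Finset.mul_sum]
          linarith
  have h9 : B * (E / 2 + Q) ≤ B / δ *
      (∑ y, μ y * f y ^ 2 - ∑ y, μ y * (∑ z, k y z * μ z * f z) ^ 2) := by
    calc _ = B / δ * (δ * (E / 2 + Q)) := by field_simp
      _ ≤ _ := by gcongr
  linarith

/-- On-diagonal decay controls the kernel everywhere. -/
lemma kernel_le_of_diag {A γ : ℝ} (hA : 0 ≤ A) (hγ : 0 ≤ γ)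
    (hF : ∀ (x : ι) (n : ℕ), ∑ y, μ y * ((kernelMatrix k μ ^ n) y x / μ x) ^ 2
      ≤ A * ((n : ℝ) + 1) ^ (-γ)) (n : ℕ) (x y : ι) :
    (kernelMatrix k μ ^ n) x y ≤ A * 2 ^ γ * ((n : ℝ) + 1) ^ (-γ) * μ y := by
  -- At even times split in the middle and apply symmetry and 2ab ≤ a² + b². An odd time is one
  -- further averaging step.
  have heven : ∀ (m : ℕ) (x y : ι),
      (kernelMatrix k μ ^ (2 * m)) x y ≤ A * ((m : ℝ) + 1) ^ (-γ) * μ y := by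
    intro m x y
    have hx := H.pos x
    have hy := H.pos y
    rw [two_mul, pow_add, Matrix.mul_apply]
    calc _ = ∑ z, μ y * (μ z * (((kernelMatrix k μ ^ m) z x / μ x) *
          ((kernelMatrix k μ ^ m) z y / μ y))) := by
          refine Finset.sum_congr rfl fun z _ => ?_
          have h1 : (kernelMatrix k μ ^ m) x z = μ z * (kernelMatrix k μ ^ m) z x / μ x := by
            rw [eq_div_iff hx.ne', ← H.pow_symm m x z]; ring
          rw [h1]; field_simp
      _ ≤ ∑ z, μ y * (μ z * (1 / 2 * ((kernelMatrix k μ ^ m) z x / μ x) ^ 2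
          + 1 / 2 * ((kernelMatrix k μ ^ m) z y / μ y) ^ 2)) := by
          refine Finset.sum_le_sum fun z _ => ?_
          refine mul_le_mul_of_nonneg_left (mul_le_mul_of_nonneg_left ?_ (H.pos z).le) hy.le
          nlinarith [sq_nonneg ((kernelMatrix k μ ^ m) z x / μ x
            - (kernelMatrix k μ ^ m) z y / μ y)]
      _ = μ y * (1 / 2 * ∑ z, μ z * ((kernelMatrix k μ ^ m) z x / μ x) ^ 2
          + 1 / 2 * ∑ z, μ z * ((kernelMatrix k μ ^ m) z y / μ y) ^ 2) := by
          simp only [Finset.mul_sum, ← Finset.sum_add_distrib]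
          exact Finset.sum_congr rfl fun z _ => by ring
      _ ≤ μ y * (1 / 2 * (A * ((m : ℝ) + 1) ^ (-γ)) + 1 / 2 * (A * ((m : ℝ) + 1) ^ (-γ))) := by
          have := hF x m
          have := hF y m
          gcongr
      _ = _ := by ring
  have hdbl : ∀ m : ℕ, n ≤ 2 * m + 1 →
      ((m : ℝ) + 1) ^ (-γ) ≤ 2 ^ γ * ((n : ℝ) + 1) ^ (-γ) := by
    intro m hm
    have hm' : (n : ℝ) + 1 ≤ 2 * ((m : ℝ) + 1) := by
      have : (n : ℝ) ≤ 2 * m + 1 := by exact_mod_cast hm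
      linarith
    have h1 : (2 * ((m : ℝ) + 1)) ^ (-γ) ≤ ((n : ℝ) + 1) ^ (-γ) :=
      Real.rpow_le_rpow_of_nonpos (by positivity) hm' (by linarith)
    rw [Real.mul_rpow (by norm_num) (by positivity), Real.rpow_neg (by norm_num)] at h1
    calc _ = 2 ^ γ * ((2 ^ γ)⁻¹ * ((m : ℝ) + 1) ^ (-γ)) := by field_simp
      _ ≤ _ := by gcongr
  have hμy := (H.pos y).le
  rcases Nat.even_or_odd' n with ⟨m, rfl | rfl⟩
  · refine (heven m x y).trans ?_
    have := hdbl m (by omega)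
    calc _ ≤ A * (2 ^ γ * (((2 * m : ℕ) : ℝ) + 1) ^ (-γ)) * μ y := by gcongr
      _ = _ := by ring
  · have := hdbl m (by omega)
    rw [pow_succ_apply]
    calc _ ≤ ∑ w, k x w * μ w * (A * ((m : ℝ) + 1) ^ (-γ) * μ y) :=
          Finset.sum_le_sum fun w _ =>
            mul_le_mul_of_nonneg_left (heven m w y) (H.matrix_nonneg x w)
      _ ≤ 1 * (A * ((m : ℝ) + 1) ^ (-γ) * μ y) := by
          rw [← Finset.sum_mul]
          gcongr
          exact H.row x
      _ ≤ 1 * (A * (2 ^ γ * (((2 * m + 1 : ℕ) : ℝ) + 1) ^ (-γ)) * μ y) := by gcongr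
      _ = _ := by ring

end IsSubMarkov

/-! ### The operator killed outside a finite set. -/

namespace WeightedGraph

namespace SymmMarkovOperator

variable {X : Type*} {W : WeightedGraph X} (K : W.SymmMarkovOperator)

lemma sum_kernel_le_one (hμ : W.ComparableToCounting) (Ω : Finset X) (x : X) :
    ∑ z ∈ Ω, K.kernel x z * W.vol z ≤ 1 :=
  sum_le_hasSum Ω (fun z _ => mul_nonneg (K.nonneg x z) (hμ.vol_pos z).le) (K.markov x)

lemma isSubMarkov (hμ : W.ComparableToCounting) (Ω : Finset X) :
    IsSubMarkov (fun y z : Ω => K.kernel y z) (fun y : Ω => W.vol y) where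
  nonneg y z := K.nonneg y z
  symm y z := K.symm y z
  pos y := hμ.vol_pos y
  row y := by
    rw [Finset.sum_coe_sort Ω (fun z => K.kernel y z * W.vol z)]
    exact K.sum_kernel_le_one hμ Ω y

lemma isTransition (hμ : W.ComparableToCounting) :
    IsTransition fun u v => K.kernel u v * W.vol v where
  nonneg x y := mul_nonneg (K.nonneg x y) (hμ.vol_pos y).le
  hasSum := K.markov

/-- The transition matrix of the operator killed outside `Ω`. -/
noncomputable def killed (Ω : Finset X) : Matrix Ω Ω ℝ :=
  kernelMatrix (fun y z : Ω => K.kernel y z) (fun y : Ω => W.vol y)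

variable {K}

/-- The value d = 0 in J(β) is a uniform holding probability, the δ of the dissipation estimates. -/
lemma J.exists_diag {df β : ℝ} (hμ : W.ComparableToCounting) (hJ : K.J df β) :
    ∃ δ : ℝ, 0 < δ ∧ δ ≤ 1 ∧ ∀ y, δ ≤ K.kernel y y * W.vol y := by
  obtain ⟨C, hC1, hC⟩ := hJ.bounds
  obtain ⟨D, hD1, hD⟩ := hμ
  have hC0 : 0 < C := by linarith
  have hD0 : 0 < D := by linarith
  refine ⟨C⁻¹ * D⁻¹, by positivity, ?_, fun y => ?_⟩
  · exact mul_le_one₀ (inv_le_one_of_one_le₀ hC1) (by positivity) (inv_le_one_of_one_le₀ hD1)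
  · have h := (hC y y).1
    rw [W.d_self] at h
    have h1 : C⁻¹ ≤ K.kernel y y := by
      rw [inv_le_iff_one_le_mul₀ hC0, mul_comm]; simpa using h
    exact mul_le_mul h1 (hD y).1 (by positivity) (K.nonneg y y)

/-- On-diagonal decay of the killed operators, uniformly in the domain. -/
lemma J.killed_pow_le [DecidableEq X] {df β : ℝ} (hμ : W.ComparableToCounting)
    (hV : W.VolumeGrowth df) (hdf : 0 < df) (hβ : 0 < β) (hJ : K.J df β) :
    ∃ C : ℝ, 0 < C ∧ ∀ (Ω : Finset X) (n : ℕ) (x y : Ω),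
      ∑ z : Ω, W.vol z * ((K.killed Ω ^ n) z x / W.vol x) ^ 2 ≤ C * ((n : ℝ) + 1) ^ (-(df / β)) ∧
      (K.killed Ω ^ n) x y ≤ C * ((n : ℝ) + 1) ^ (-(df / β)) * W.vol y := by
  obtain ⟨δ, hδ0, hδ1, hδ⟩ := hJ.exists_diag hμ
  obtain ⟨c, hc0, hc⟩ := hV.le_sum hμ
  obtain ⟨CJ, hCJ1, hCJ⟩ := hJ.bounds
  have hμ' := hμ
  obtain ⟨D, hD1, hD⟩ := hμ'
  have hCJ0 : 0 < CJ := by linarith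
  obtain ⟨A, hA0, hA⟩ := decay_of_nash (c := c) (C := CJ * 2 ^ (df + β) / δ) (C₀ := D) hc0
    (by positivity) (by linarith) hdf hβ
  have key : ∀ (Ω : Finset X) (x : Ω) (n : ℕ),
      ∑ z : Ω, W.vol z * ((K.killed Ω ^ n) z x / W.vol x) ^ 2
        ≤ A * ((n : ℝ) + 1) ^ (-(df / β)) := by
    intro Ω x
    have H := K.isSubMarkov hμ Ω
    have hx := hμ.vol_pos (x : X)
    set f : ℕ → Ω → ℝ := fun n z => (K.killed Ω ^ n) z x / W.vol x with hf
    have hf0 : ∀ n z, 0 ≤ f n z := fun n z => div_nonneg (H.pow_nonneg n z x) hx.le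
    have hf1 : ∀ n, ∑ z : Ω, W.vol z * f n z ≤ 1 := by
      intro n
      have := H.column_mass_le n x
      calc _ = (∑ z : Ω, W.vol z * (K.killed Ω ^ n) z x) / W.vol x := by
            rw [Finset.sum_div]; exact Finset.sum_congr rfl fun z _ => by rw [hf]; ring
        _ ≤ 1 := by rw [div_le_one hx]; exact this
    have hstep : ∀ n (y : Ω), ∑ z : Ω, K.kernel y z * W.vol z * f n z = f (n + 1) y := by
      intro n y
      simp only [hf]
      rw [show (K.killed Ω ^ (n + 1)) y x = _ from IsSubMarkov.pow_succ_apply n y x,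
        Finset.sum_div]
      exact Finset.sum_congr rfl fun z _ => by rw [mul_div_assoc]; rfl
    have hanti : ∀ n, ∑ z : Ω, W.vol z * f (n + 1) z ^ 2 ≤ ∑ z : Ω, W.vol z * f n z ^ 2 := by
      intro n
      by_contra hlt
      push Not at hlt
      set F := ∑ z : Ω, W.vol z * f n z ^ 2
      set F' := ∑ z : Ω, W.vol z * f (n + 1) z ^ 2 with hF'
      have hpos : 0 < F' - F := by linarith
      -- With no near pairs and V = 0 the inequality reads 0 ≤ 1 + (B/δ)(F - F') for every B ≥ 0. If
      -- F' > F, this B turns the right side into -1.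
      have := H.nash hδ0 hδ1 (fun y => hδ y) (near := fun _ _ => False) (fun _ _ h => h) (V := 0)
        (B := 2 * δ / (F' - F)) (by positivity)
        (fun y => by
          simp only [if_false, Finset.sum_const_zero, zero_add]
          exact mul_nonneg (by positivity) (by linarith [H.row y]))
        (fun _ _ h => h.elim) (hf0 n) (hf1 n)
      simp only [hstep] at this
      rw [← hF'] at this
      have e : 2 * δ / (F' - F) / δ * (F - F') = -2 := by field_simp; ring
      rw [zero_mul, e] at this
      linarith
    refine hA (fun n => ∑ z : Ω, W.vol z * f n z ^ 2)
      (fun n => Finset.sum_nonneg fun z _ => mul_nonneg (hμ.vol_pos _).le (sq_nonneg _))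
      (fun n => ?_) ?_ (fun n r hr => ?_)
    · exact hanti n
    · have h1 : ∀ z : Ω, W.vol z * f 0 z ^ 2 = if z = x then (W.vol x)⁻¹ else 0 := by
        intro z
        simp only [hf, pow_zero, Matrix.one_apply]
        split_ifs with h
        · subst h; field_simp
        · simp
      simp only [h1, Finset.sum_ite_eq', Finset.mem_univ, if_true]
      exact inv_le_of_inv_le₀ (by linarith) (hD x).1
    · have hr0 : 0 < r := by linarith
      have hnear : ∀ y z : X, (W.d y z : ℝ) ≤ r → 1 ≤ CJ * (1 + r) ^ (df + β) * K.kernel y z := by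
        intro y z h
        have h1 : (1 + r) ^ (-(df + β)) ≤ (1 + (W.d y z : ℝ)) ^ (-(df + β)) :=
          Real.rpow_le_rpow_of_nonpos (by positivity) (by linarith) (by linarith)
        have h2 := h1.trans (hCJ y z).1
        rw [Real.rpow_neg (by positivity), inv_le_iff_one_le_mul₀ (by positivity)] at h2
        linarith
      have hn := H.nash hδ0 hδ1 (fun y => hδ y) (near := fun y z : Ω => (W.d y z : ℝ) ≤ r)
        (fun y z h => by rwa [W.d_comm]) (V := c * r ^ df) (B := CJ * (1 + r) ^ (df + β))
        (by positivity) (fun y => ?_) (fun y z h => hnear y z h) (hf0 n) (hf1 n)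
      · simp only [hstep] at hn
        refine hn.trans ?_
        have hF := sub_nonneg.2 (hanti n)
        have h1 : (1 + r) ^ (df + β) ≤ 2 ^ (df + β) * r ^ (df + β) := by
          rw [← Real.mul_rpow (by norm_num) hr0.le]
          exact Real.rpow_le_rpow (by positivity) (by linarith) (by positivity)
        have h2 : CJ * (1 + r) ^ (df + β) / δ ≤ CJ * 2 ^ (df + β) / δ * r ^ (df + β) := by
          calc _ ≤ CJ * (2 ^ (df + β) * r ^ (df + β)) / δ := by gcongr
            _ = _ := by ring
        gcongr
      -- Near the boundary part of the r-ball lies outside Ω; its volume is at most B times the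
      -- kernel mass it carries, and that mass is lost to killing.
      · set S := (ball_finite hμ hV (y : X) r).toFinset with hS
        have hmem : ∀ z, z ∈ S ↔ (W.d y z : ℝ) ≤ r := fun z => by
          rw [hS, Set.Finite.mem_toFinset]; rfl
        rw [Finset.sum_coe_sort Ω (fun z => if (W.d y z : ℝ) ≤ r then W.vol z else 0),
          Finset.sum_coe_sort Ω (fun z => K.kernel y z * W.vol z)]
        have h1 := hc (y : X) r hr
        rw [← hS, ← Finset.sum_inter_add_sum_sdiff S Ω] at h1
        have h2 : ∑ z ∈ S ∩ Ω, W.vol z ≤ ∑ z ∈ Ω, if (W.d y z : ℝ) ≤ r then W.vol z else 0 := by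
          rw [← Finset.sum_filter]
          refine Finset.sum_le_sum_of_subset_of_nonneg (fun z hz => ?_)
            fun z _ _ => (hμ.vol_pos z).le
          rw [Finset.mem_inter, hmem] at hz
          exact Finset.mem_filter.2 ⟨hz.2, hz.1⟩
        have h3 : ∑ z ∈ S \ Ω, W.vol z
            ≤ CJ * (1 + r) ^ (df + β) * ∑ z ∈ S \ Ω, K.kernel y z * W.vol z := by
          rw [Finset.mul_sum]
          refine Finset.sum_le_sum fun z hz => ?_
          have := mul_le_mul_of_nonneg_right
            (hnear y z ((hmem z).1 (Finset.mem_sdiff.1 hz).1)) (hμ.vol_pos z).le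
          linarith
        have h4 : ∑ z ∈ S \ Ω, K.kernel y z * W.vol z + ∑ z ∈ Ω, K.kernel y z * W.vol z ≤ 1 := by
          rw [← Finset.sum_union Finset.sdiff_disjoint]
          exact K.sum_kernel_le_one hμ _ y
        refine h1.trans (add_le_add h2 (h3.trans ?_))
        gcongr
        linarith
  refine ⟨A * 2 ^ (df / β), by positivity, fun Ω n x y => ⟨?_, ?_⟩⟩
  · refine (key Ω x n).trans ?_
    gcongr
    exact le_mul_of_one_le_right hA0.le (Real.one_le_rpow (by norm_num) (by positivity))
  · exact (K.isSubMarkov hμ Ω).kernel_le_of_diag hA0.le (by positivity) (key Ω) n x y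

end SymmMarkovOperator

end WeightedGraph

/-! ### Weighted L² moments and tails. -/

/-- Under linear growth with slope C₀ + 2 C₁, the relative increment 1/(2(t+1)) contributes half the
slope, and the other half is at least C₁. -/
lemma linear_growth_of_step {N : ℕ → ℝ} {C₀ C₁ : ℝ} (hC₀ : 0 ≤ C₀) (hC₁ : 0 ≤ C₁) (h0 : N 0 ≤ C₀)
    (hstep : ∀ t : ℕ, N (t + 1) ≤ N t + 1 / (2 * ((t : ℝ) + 1)) * N t + C₁) (t : ℕ) :
    N t ≤ (C₀ + 2 * C₁) * ((t : ℝ) + 1) := by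
  induction t with
  | zero => simp; linarith
  | succ t ih =>
    have ht : (0 : ℝ) < (t : ℝ) + 1 := by positivity
    have h1 : 1 / (2 * ((t : ℝ) + 1)) * N t ≤ (C₀ + 2 * C₁) / 2 := by
      calc _ ≤ 1 / (2 * ((t : ℝ) + 1)) * ((C₀ + 2 * C₁) * ((t : ℝ) + 1)) := by gcongr
        _ = _ := by field_simp
    push_cast
    linarith [hstep t]

/-- Interpolation between a Hardy weight and a constant. -/
lemma mul_rpow_neg_le {a w C κ τ df β : ℝ} (ha : 0 < a) (hw0 : 0 ≤ w)
    (hw : w ≤ C * a ^ (df + β)) (hC : 0 ≤ C) (hκ : 0 < κ) (hτ : 0 < τ) (hdf : 0 < df)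
    (hβ : 0 < β) :
    w * a ^ (-β) ≤ κ / τ * w + C * (τ / κ) ^ (df / β) := by
  rcases le_total (τ / κ) (a ^ β) with h | h
  · have h1 : a ^ (-β) ≤ κ / τ := by
      rw [Real.rpow_neg ha.le]
      calc (a ^ β)⁻¹ ≤ (τ / κ)⁻¹ := inv_anti₀ (by positivity) h
        _ = _ := inv_div _ _
    calc w * a ^ (-β) ≤ κ / τ * w := by rw [mul_comm]; gcongr
      _ ≤ _ := by
        have : 0 ≤ C * (τ / κ) ^ (df / β) := by positivity
        linarith
  · have h1 : a ^ df ≤ (τ / κ) ^ (df / β) := by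
      calc a ^ df = (a ^ β) ^ (df / β) := by rw [← Real.rpow_mul ha.le]; congr 1; field_simp
        _ ≤ _ := by gcongr
    calc w * a ^ (-β) ≤ C * a ^ (df + β) * a ^ (-β) := by gcongr
      _ = C * a ^ df := by rw [mul_assoc, ← Real.rpow_add ha]; congr 2; ring
      _ ≤ C * (τ / κ) ^ (df / β) := by gcongr
      _ ≤ _ := by
        have : 0 ≤ κ / τ * w := by positivity
        linarith

namespace WeightedGraph

namespace SymmMarkovOperator

variable {X : Type*} {W : WeightedGraph X} {K : W.SymmMarkovOperator}

lemma killed_pow_apply [DecidableEq X] (Ω : Finset X) (n : ℕ) (x y : Ω) :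
    (K.killed Ω ^ n) x y
      = (finiteOp (fun u v => K.kernel u v * W.vol v) Ω)^[n] (Set.indicator {(y : X)} 1) x := by
  induction n generalizing x with
  | zero =>
    by_cases h : x = y
    · subst h; simp
    · have h' : (x : X) ∉ ({(y : X)} : Set X) := fun hxy => h (Subtype.ext hxy)
      rw [pow_zero, Matrix.one_apply_ne h, Function.iterate_zero_apply,
        Set.indicator_of_notMem h']
  | succ n ih =>
    rw [Function.iterate_succ_apply', finiteOp,
      show (K.killed Ω ^ (n + 1)) x y = _ from IsSubMarkov.pow_succ_apply n x y,
      ← Finset.sum_coe_sort Ω]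
    exact Finset.sum_congr rfl fun z _ => congrArg _ (ih z)

/-- The killed operators have moments of order `df + β` growing at most linearly in time, in
the `L²` sense. -/
lemma J.killed_moment_le [DecidableEq X] {df dw β : ℝ} (hμ : W.ComparableToCounting)
    (hV : W.VolumeGrowth df) (hU : W.USG df dw) (hL : W.LSG df dw) (hdf : 0 < df) (hβ : 2 ≤ β)
    (hβw : β < dw) (hJ : K.J df β) :
    ∃ C : ℝ, 0 < C ∧ ∀ (o : X) (Rmax : ℝ), ∃ L : ℝ, ∀ Ω : Finset X,
      (∀ z, (W.d o z : ℝ) ≤ L → z ∈ Ω) → ∀ (ho : o ∈ Ω) (t : ℕ),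
      ∑ z : Ω, (if (W.d o z : ℝ) ≤ Rmax then (1 + (W.d o z : ℝ)) ^ (df + β) else 0) * W.vol z *
        ((K.killed Ω ^ t) z ⟨o, ho⟩ / W.vol o) ^ 2 ≤ C * ((t : ℝ) + 1) := by
  have hβ0 : 0 < β := by linarith
  obtain ⟨δ, hδ0, hδ1, hδ⟩ := hJ.exists_diag hμ
  obtain ⟨A, hA0, hA⟩ := hJ.killed_pow_le hμ hV hdf hβ0
  obtain ⟨B, hB1, hB⟩ := hJ.bounds
  have hμ' := hμ
  obtain ⟨D, hD1, hD⟩ := hμ'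
  obtain ⟨Cv, hCv0, hCv⟩ := exists_weight hμ hV hU hL hdf (by linarith) hβ hβw hJ
    (ε := δ ^ 2 / 4) (by positivity)
  have hB0 : 0 < B := by linarith
  have hD0 : 0 < D := by linarith
  set C₁ := 2 / δ * Cv with hC₁
  have hC₁0 : 0 < C₁ := by positivity
  -- Makes the Hardy term contribute exactly the relative increment 1/(2(n+1)) that
  -- `linear_growth_of_step` allows.
  set κ := 1 / (2 * C₁) with hκ
  have hκ0 : 0 < κ := by positivity
  set C₂ := 2 * (Cv * (B * 4 ^ (df + β))) with hC₂
  set C₃ := C₁ * (Cv * κ ^ (-(df / β)) * A) + C₂ with hC₃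
  refine ⟨Cv * (Cv * D + 2 * C₃), by positivity, fun o Rmax => ?_⟩
  obtain ⟨v, L, hv1, hv2, hv3, hv⟩ := hCv o Rmax
  refine ⟨L, fun Ω hΩ ho t => ?_⟩
  have H := K.isSubMarkov hμ Ω
  have hx := hμ.vol_pos o
  set f : ℕ → Ω → ℝ := fun n z => (K.killed Ω ^ n) z ⟨o, ho⟩ / W.vol o with hf
  have hf0 : ∀ n z, 0 ≤ f n z := fun n z => div_nonneg (H.pow_nonneg n z _) hx.le
  have hf1 : ∀ n, ∑ z : Ω, W.vol z * f n z ≤ 1 := by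
    intro n
    have := H.column_mass_le n ⟨o, ho⟩
    calc _ = (∑ z : Ω, W.vol z * (K.killed Ω ^ n) z ⟨o, ho⟩) / W.vol o := by
          rw [Finset.sum_div]; exact Finset.sum_congr rfl fun z _ => by rw [hf]; ring
      _ ≤ 1 := by rw [div_le_one hx]; exact this
  have hstep : ∀ n (y : Ω), ∑ z : Ω, K.kernel y z * W.vol z * f n z = f (n + 1) y := by
    intro n y
    simp only [hf]
    rw [show (K.killed Ω ^ (n + 1)) y ⟨o, ho⟩ = _ from IsSubMarkov.pow_succ_apply n y _,
      Finset.sum_div]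
    exact Finset.sum_congr rfl fun z _ => by rw [mul_div_assoc]; rfl
  set N : ℕ → ℝ := fun n => ∑ z : Ω, v z ^ 2 * W.vol z * f n z ^ 2 with hN
  have hmain : ∀ n, N n ≤ (Cv * D + 2 * C₃) * ((n : ℝ) + 1) := by
    refine linear_growth_of_step (by positivity) (by positivity) ?_ fun n => ?_
    · have h1 : ∀ z : Ω, v z ^ 2 * W.vol z * f 0 z ^ 2
          = if z = ⟨o, ho⟩ then v o ^ 2 * (W.vol o)⁻¹ else 0 := by
        intro z
        simp only [hf, pow_zero, Matrix.one_apply]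
        split_ifs with h
        · subst h; field_simp
        · simp
      simp only [hN, h1, Finset.sum_ite_eq', Finset.mem_univ, if_true]
      have h2 := hv2 o
      rw [W.d_self] at h2
      have h3 : (W.vol o)⁻¹ ≤ D := inv_le_of_inv_le₀ hD0 (hD o).1
      gcongr
      simpa using h2
    · classical
      set Al : X → X → ℝ := fun y z => if W.IsLocal o y z then K.kernel y z else 0 with hAl
      have hAl1 : ∀ y z, W.IsLocal o y z → Al y z = K.kernel y z := fun y z h => if_pos h
      have hAl2 : ∀ y z, ¬ W.IsLocal o y z → Al y z = 0 := fun y z h => if_neg h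
      have hAl0 : ∀ y z, 0 ≤ Al y z := fun y z => by
        simp only [hAl]; split_ifs; exacts [K.nonneg y z, le_rfl]
      have hAlk : ∀ y z, Al y z ≤ K.kernel y z := fun y z => by
        simp only [hAl]; split_ifs; exacts [le_rfl, K.nonneg y z]
      have hc := caccioppoli (A := fun y z : Ω => Al y z) (μ := fun y : Ω => W.vol y)
        (v := fun y : Ω => v y) (δ := δ) (fun y z => hAl0 y z)
        (fun y z => by
          by_cases h : W.IsLocal o y z
          · rw [hAl1 _ _ h, hAl1 _ _ h.symm, K.symm]
          · rw [hAl2 _ _ h, hAl2 _ _ fun h' => h h'.symm])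
        H.pos (fun y => (Finset.sum_le_sum fun (z : Ω) _ =>
          mul_le_mul_of_nonneg_right (hAlk y z) (H.pos z).le).trans (H.row y)) hδ0
        (fun y => by rw [hAl1 _ _ (isLocal_self o y)]; exact hδ y) (f n)
        (hv Ω hΩ Al hAl1 hAl2 (f n))
      -- A non-local jump into y has length at least (1 + d(o,y))/4, so with total mass at most 1 it
      -- adds at most b = B 4^{df+β} (1 + d(o,y))^{-(df+β)}. From f ≤ a + b follows f² ≤ a² + 2bf,
      -- and v² b is bounded.
      have hpt : ∀ y : Ω, f (n + 1) y ^ 2 ≤ (∑ z : Ω, Al y z * W.vol z * f n z) ^ 2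
          + 2 * (B * 4 ^ (df + β) * (1 + (W.d o y : ℝ)) ^ (-(df + β))) * f (n + 1) y := by
        intro y
        have h1 : f (n + 1) y ≤ (∑ z : Ω, Al y z * W.vol z * f n z)
            + B * 4 ^ (df + β) * (1 + (W.d o y : ℝ)) ^ (-(df + β)) := by
          set b := B * 4 ^ (df + β) * (1 + (W.d o y : ℝ)) ^ (-(df + β)) with hb
          have hb0 : 0 ≤ b := by positivity
          rw [← hstep n y]
          calc _ ≤ ∑ z : Ω, (Al y z * W.vol z * f n z + b * (W.vol z * f n z)) := by
                refine Finset.sum_le_sum fun z _ => ?_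
                have hz := mul_nonneg (H.pos z).le (hf0 n z)
                by_cases h : W.IsLocal o y z
                · rw [hAl1 _ _ h]
                  have := mul_nonneg hb0 hz
                  linarith
                · have hkb : K.kernel y z ≤ b := by
                    refine (hB y z).2.trans ?_
                    rw [hb, mul_assoc]
                    gcongr
                    have h4 : (1 + (W.d o y : ℝ)) / 4 ≤ 1 + (W.d y z : ℝ) := by
                      unfold IsLocal at h
                      push Not at h
                      have : (2 + W.d o y + W.d o z : ℝ) < 4 * W.d y z := by exact_mod_cast h
                      have : (0 : ℝ) ≤ W.d o z := by positivity
                      linarith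
                    calc _ ≤ ((1 + (W.d o y : ℝ)) / 4) ^ (-(df + β)) :=
                          Real.rpow_le_rpow_of_nonpos (by positivity) h4 (by linarith)
                      _ = _ := by
                          rw [Real.div_rpow (by positivity) (by norm_num),
                            Real.rpow_neg (by norm_num : (0 : ℝ) ≤ 4), div_inv_eq_mul, mul_comm]
                  rw [hAl2 _ _ h]
                  have := mul_le_mul_of_nonneg_right hkb hz
                  linarith
            _ = (∑ z : Ω, Al y z * W.vol z * f n z) + b * ∑ z : Ω, W.vol z * f n z := by
                rw [Finset.sum_add_distrib, Finset.mul_sum]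
            _ ≤ _ := by
                have := mul_le_mul_of_nonneg_left (hf1 n) hb0
                linarith
        have h2 : 0 ≤ ∑ z : Ω, Al y z * W.vol z * f n z := Finset.sum_nonneg fun z _ =>
          mul_nonneg (mul_nonneg (hAl0 y z) (H.pos z).le) (hf0 n z)
        have h3 := hf0 (n + 1) y
        nlinarith [sq_nonneg (f (n + 1) y - ∑ z : Ω, Al y z * W.vol z * f n z)]
      have hfar : N (n + 1) ≤ ∑ y : Ω, v y ^ 2 * W.vol y *
          (∑ z : Ω, Al y z * W.vol z * f n z) ^ 2 + C₂ := by
        calc N (n + 1) ≤ ∑ y : Ω, (v y ^ 2 * W.vol y * (∑ z : Ω, Al y z * W.vol z * f n z) ^ 2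
              + C₂ * (W.vol y * f (n + 1) y)) := by
              refine Finset.sum_le_sum fun y _ => ?_
              have h0 : 0 ≤ v y ^ 2 * W.vol y := mul_nonneg (sq_nonneg _) (H.pos y).le
              refine (mul_le_mul_of_nonneg_left (hpt y) h0).trans ?_
              rw [mul_add]
              refine add_le_add le_rfl ?_
              have ha : (0 : ℝ) < 1 + (W.d o y : ℝ) := by positivity
              have h5 : v y ^ 2 * (1 + (W.d o y : ℝ)) ^ (-(df + β)) ≤ Cv := by
                calc _ ≤ Cv * (1 + (W.d o y : ℝ)) ^ (df + β) * (1 + (W.d o y : ℝ)) ^ (-(df + β)) := by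
                      gcongr; exact hv2 y
                  _ = Cv := by rw [mul_assoc, ← Real.rpow_add ha]; simp
              have h6 : 0 ≤ W.vol y * f (n + 1) y := mul_nonneg (H.pos y).le (hf0 _ y)
              calc _ = 2 * (B * 4 ^ (df + β)) * (v y ^ 2 * (1 + (W.d o y : ℝ)) ^ (-(df + β)))
                    * (W.vol y * f (n + 1) y) := by ring
                _ ≤ 2 * (B * 4 ^ (df + β)) * Cv * (W.vol y * f (n + 1) y) := by gcongr
                _ = _ := by rw [hC₂]; ring
          _ = ∑ y : Ω, v y ^ 2 * W.vol y * (∑ z : Ω, Al y z * W.vol z * f n z) ^ 2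
              + C₂ * ∑ y : Ω, W.vol y * f (n + 1) y := by
              rw [Finset.sum_add_distrib, Finset.mul_sum]
          _ ≤ _ := by
              have : 0 ≤ C₂ := by positivity
              have := mul_le_mul_of_nonneg_left (hf1 (n + 1)) this
              linarith
      have hτ : (0 : ℝ) < (n : ℝ) + 1 := by positivity
      -- Beyond distance about (n+1)^{1/β} the Hardy weight is at most κ/(n+1). Within it v²
      -- (1+d)^{-β} is at most of order (n+1)^{df/β}, cancelled exactly by the on-diagonal decay of
      -- the L² norm.
      have hhardy : ∑ y : Ω, W.vol y * f n y ^ 2 * (v y ^ 2 * (1 + (W.d o y : ℝ)) ^ (-β))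
          ≤ κ / ((n : ℝ) + 1) * N n + Cv * κ ^ (-(df / β)) * A := by
        calc _ ≤ ∑ y : Ω, (κ / ((n : ℝ) + 1) * (v y ^ 2 * W.vol y * f n y ^ 2)
              + Cv * (((n : ℝ) + 1) / κ) ^ (df / β) * (W.vol y * f n y ^ 2)) := by
              refine Finset.sum_le_sum fun y _ => ?_
              have h0 : 0 ≤ W.vol y * f n y ^ 2 := mul_nonneg (H.pos y).le (sq_nonneg _)
              have := mul_le_mul_of_nonneg_left (mul_rpow_neg_le
                (a := 1 + (W.d o y : ℝ)) (by positivity) (sq_nonneg (v y)) (hv2 y) hCv0.le hκ0 hτ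
                hdf hβ0) h0
              refine this.trans (le_of_eq ?_)
              ring
          _ = κ / ((n : ℝ) + 1) * N n + Cv * (((n : ℝ) + 1) / κ) ^ (df / β) *
              ∑ y : Ω, W.vol y * f n y ^ 2 := by
              rw [Finset.sum_add_distrib, Finset.mul_sum, Finset.mul_sum]
          _ ≤ κ / ((n : ℝ) + 1) * N n + Cv * (((n : ℝ) + 1) / κ) ^ (df / β) *
              (A * ((n : ℝ) + 1) ^ (-(df / β))) := by
              gcongr
              exact (hA Ω n ⟨o, ho⟩ ⟨o, ho⟩).1
          _ = _ := by
              rw [Real.div_rpow hτ.le hκ0.le, Real.rpow_neg hτ.le, Real.rpow_neg hκ0.le]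
              field_simp
      calc N (n + 1) ≤ _ := hfar
        _ ≤ N n + 2 / δ * (Cv * (κ / ((n : ℝ) + 1) * N n + Cv * κ ^ (-(df / β)) * A)) + C₂ := by
            refine add_le_add (hc.trans ?_) le_rfl
            gcongr
        _ = N n + C₁ * κ / ((n : ℝ) + 1) * N n + C₃ := by rw [hC₃, hC₁]; ring
        _ = _ := by rw [hκ]; field_simp
  calc _ ≤ ∑ z : Ω, Cv * (v z ^ 2 * W.vol z * f t z ^ 2) := by
        refine Finset.sum_le_sum fun z _ => ?_
        have h0 : 0 ≤ W.vol z * f t z ^ 2 := mul_nonneg (H.pos z).le (sq_nonneg _)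
        split_ifs with h
        · have := mul_le_mul_of_nonneg_right (hv3 z h) h0
          simp only [hf] at this ⊢
          linarith
        · have : 0 ≤ Cv * (v z ^ 2 * W.vol z * f t z ^ 2) :=
            mul_nonneg hCv0.le (mul_nonneg (mul_nonneg (sq_nonneg _) (H.pos z).le) (sq_nonneg _))
          simpa using this
    _ = Cv * N t := by rw [Finset.mul_sum]
    _ ≤ Cv * ((Cv * D + 2 * C₃) * ((t : ℝ) + 1)) := by gcongr; exact hmain t
    _ = _ := by ring

/-- Tail estimate for the `n`-step transition probabilities. -/
lemma J.tail_le {df dw β : ℝ} (hμ : W.ComparableToCounting)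
    (hV : W.VolumeGrowth df) (hU : W.USG df dw) (hL : W.LSG df dw) (hdf : 0 < df) (hβ : 2 ≤ β)
    (hβw : β < dw) (hJ : K.J df β) :
    ∃ C : ℝ, 0 < C ∧ ∀ (o : X) (r : ℝ) (t : ℕ), 0 ≤ r →
      (transitionOp fun u v => K.kernel u v * W.vol v)^[t]
        (Set.indicator {z | r < (W.d o z : ℝ)} 1) o
        ≤ √(C * ((t : ℝ) + 1) * (1 + r) ^ (-β)) := by
  classical
  have hβ0 : 0 < β := by linarith
  obtain ⟨C, hC0, hC⟩ := hJ.killed_moment_le hμ hV hU hL hdf hβ hβw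
  obtain ⟨Ct, hCt0, hCt⟩ := hV.tail_sum_le hμ hdf hβ0
  have hP := K.isTransition hμ
  set P : X → X → ℝ := fun u v => K.kernel u v * W.vol v with hPdef
  refine ⟨Ct * C, by positivity, fun o r t hr => ?_⟩
  have hfin : ∀ S : Finset X, (∀ z ∈ S, r < (W.d o z : ℝ)) →
      ∑ z ∈ S, nStep P t o z ≤ √(Ct * C * ((t : ℝ) + 1) * (1 + r) ^ (-β)) := by
    intro S hS
    -- The weight need only be faithful up to the largest distance in S; the moment bound does not
    -- depend on that radius.
    obtain ⟨L, hΩL⟩ := hC o (S.sup (W.d o) : ℕ)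
    refine le_of_tendsto (tendsto_finsetSum S fun z _ =>
      hP.tendsto_finiteOp_iterate (IsTransition.abs_indicator_le {z}) t o) ?_
    filter_upwards [Filter.eventually_ge_atTop (insert o (S ∪ (ball_finite hμ hV o L).toFinset))]
      with Ω hΩ
    have ho : o ∈ Ω := hΩ (Finset.mem_insert_self _ _)
    have hSΩ : S ⊆ Ω := fun z hz =>
      hΩ (Finset.mem_insert_of_mem (Finset.mem_union_left _ hz))
    have hball : ∀ z, (W.d o z : ℝ) ≤ L → z ∈ Ω := fun z hz =>
      hΩ (Finset.mem_insert_of_mem (Finset.mem_union_right _ (by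
        rw [Set.Finite.mem_toFinset]; exact hz)))
    have H := K.isSubMarkov hμ Ω
    have hx := hμ.vol_pos o
    set f : Ω → ℝ := fun z => (K.killed Ω ^ t) z ⟨o, ho⟩ / W.vol o with hf
    have hf0 : ∀ z, 0 ≤ f z := fun z => div_nonneg (H.pow_nonneg t z _) hx.le
    have h1 : ∑ z ∈ S, (finiteOp P Ω)^[t] (Set.indicator {z} 1) o
        = ∑ z : Ω, if (z : X) ∈ S then W.vol z * f z else 0 := by
      rw [← Finset.inter_eq_right.2 hSΩ, ← Finset.sum_ite_mem, ← Finset.sum_coe_sort Ω]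
      refine Finset.sum_congr rfl fun z _ => ?_
      simp only [Finset.mem_inter, z.2, true_and]
      split_ifs with h
      · rw [hPdef, ← killed_pow_apply (K := K) Ω t ⟨o, ho⟩ z, hf, mul_div_assoc', eq_div_iff hx.ne',
          mul_comm]
        exact H.pow_symm t ⟨o, ho⟩ z
      · rfl
    rw [h1]
    refine Real.le_sqrt_of_sq_le ?_
    -- Cauchy–Schwarz with the weights (1+d)^{∓(df+β)}: one factor is a volume tail, the other the
    -- moment.
    have h2 := Finset.sum_sq_le_sum_mul_sum_of_sq_le_mul (Finset.univ : Finset Ω)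
      (r := fun z => if (z : X) ∈ S then W.vol z * f z else 0)
      (f := fun z => if (z : X) ∈ S then W.vol z * (1 + (W.d o z : ℝ)) ^ (-(df + β)) else 0)
      (g := fun z => (if (W.d o z : ℝ) ≤ (S.sup (W.d o) : ℕ) then
        (1 + (W.d o z : ℝ)) ^ (df + β) else 0) * W.vol z * f z ^ 2)
      (fun z _ => by
        have := (hμ.vol_pos (z : X)).le
        split_ifs <;> positivity)
      (fun z _ => by
        have := (hμ.vol_pos (z : X)).le
        split_ifs <;> positivity)
      (fun z _ => by
        by_cases h : (z : X) ∈ S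
        · have hle : (W.d o z : ℝ) ≤ (S.sup (W.d o) : ℕ) := by
            exact_mod_cast Finset.le_sup (f := W.d o) h
          rw [if_pos h, if_pos h, if_pos hle]
          have ha : (0 : ℝ) < 1 + (W.d o z : ℝ) := by positivity
          have e : (1 + (W.d o z : ℝ)) ^ (-(df + β)) * (1 + (W.d o z : ℝ)) ^ (df + β) = 1 := by
            rw [← Real.rpow_add ha]; simp
          exact le_of_eq (by linear_combination (-(W.vol z ^ 2 * f z ^ 2)) * e)
        · simp [h])
    refine h2.trans ?_
    have h3 : ∑ z : Ω, (if (z : X) ∈ S then W.vol z * (1 + (W.d o z : ℝ)) ^ (-(df + β)) else 0)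
        ≤ Ct * (1 + r) ^ (-β) := by
      rw [Finset.sum_coe_sort Ω fun z =>
        if z ∈ S then W.vol z * (1 + (W.d o z : ℝ)) ^ (-(df + β)) else 0, Finset.sum_ite_mem,
        Finset.inter_eq_right.2 hSΩ]
      exact hCt o (1 + r) (by linarith) S fun z hz => by linarith [hS z hz]
    have h4 := hΩL Ω hball ho t
    calc _ ≤ (Ct * (1 + r) ^ (-β)) * (C * ((t : ℝ) + 1)) := by
          refine mul_le_mul h3 h4 (Finset.sum_nonneg fun z _ => ?_) (by positivity)
          have := (hμ.vol_pos (z : X)).le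
          split_ifs <;> positivity
      _ = _ := by ring
  refine hasSum_le_of_sum_le (hP.hasSum_nStep_mul
    (IsTransition.abs_indicator_le {z | r < (W.d o z : ℝ)}) t o) fun S => ?_
  calc _ = ∑ z ∈ S with r < (W.d o z : ℝ), nStep P t o z := by
        rw [Finset.sum_filter]
        refine Finset.sum_congr rfl fun z _ => ?_
        by_cases h : r < (W.d o z : ℝ) <;> simp [h]
    _ ≤ _ := hfin _ fun z hz => (Finset.mem_filter.1 hz).2

/-- On-diagonal upper bound. -/
lemma J.nStep_le {df β : ℝ} (hμ : W.ComparableToCounting)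
    (hV : W.VolumeGrowth df) (hdf : 0 < df) (hβ : 0 < β) (hJ : K.J df β) :
    ∃ C : ℝ, 0 < C ∧ ∀ (n : ℕ) (x y : X),
      nStep (fun u v => K.kernel u v * W.vol v) n x y
        ≤ C * ((n : ℝ) + 1) ^ (-(df / β)) * W.vol y := by
  classical
  obtain ⟨C, hC0, hC⟩ := hJ.killed_pow_le hμ hV hdf hβ
  refine ⟨C, hC0, fun n x y => le_of_tendsto ((K.isTransition hμ).tendsto_finiteOp_iterate
    (IsTransition.abs_indicator_le {y}) n x) ?_⟩
  filter_upwards [Filter.eventually_ge_atTop {x, y}] with Ω hΩ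
  have hx : x ∈ Ω := hΩ (by simp)
  have hy : y ∈ Ω := hΩ (by simp)
  have := (hC Ω n ⟨x, hx⟩ ⟨y, hy⟩).2
  rwa [killed_pow_apply] at this

end SymmMarkovOperator

end WeightedGraph

/-! ### Exit probabilities. -/

/-- A positive operator which is contractive on functions with values in `[0, 1]`. -/
structure IsSubMarkovOp {X : Type*} (T : (X → ℝ) → X → ℝ) : Prop where
  nonneg : ∀ g : X → ℝ, (∀ z, 0 ≤ g z) → ∀ y, 0 ≤ T g y
  le_one : ∀ g : X → ℝ, (∀ z, 0 ≤ g z) → (∀ z, g z ≤ 1) → ∀ y, T g y ≤ 1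
  mono : ∀ g h : X → ℝ, (∀ z, 0 ≤ g z) → (∀ z, g z ≤ h z) → (∀ z, h z ≤ 1) → ∀ y, T g y ≤ T h y

open Classical in
/-- The probability that the process with one-step operator `T` leaves `A` within `m` steps. -/
noncomputable def exitFn {X : Type*} (T : (X → ℝ) → X → ℝ) (A : Set X) : ℕ → X → ℝ
  | 0 => Set.indicator Aᶜ 1
  | m + 1 => fun y => if y ∈ A then T (exitFn T A m) y else 1

section exitFn

variable {X : Type*} {T T' : (X → ℝ) → X → ℝ} {A A' : Set X}

lemma exitFn_of_notMem {m : ℕ} {y : X} (hy : y ∉ A) : exitFn T A m y = 1 := by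
  cases m <;> simp [exitFn, hy]

lemma exitFn_zero_of_mem {y : X} (hy : y ∈ A) : exitFn T A 0 y = 0 := by
  simp [exitFn, hy]

lemma exitFn_succ_of_mem {m : ℕ} {y : X} (hy : y ∈ A) :
    exitFn T A (m + 1) y = T (exitFn T A m) y := by
  simp [exitFn, hy]

lemma exitFn_nonneg (hT : IsSubMarkovOp T) (m : ℕ) (y : X) : 0 ≤ exitFn T A m y := by
  induction m generalizing y with
  | zero => exact Set.indicator_nonneg (fun _ _ => zero_le_one) y
  | succ m ih =>
    by_cases hy : y ∈ A
    · rw [exitFn_succ_of_mem hy]; exact hT.nonneg _ ih y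
    · rw [exitFn_of_notMem hy]; exact zero_le_one

lemma exitFn_le_one (hT : IsSubMarkovOp T) (m : ℕ) (y : X) : exitFn T A m y ≤ 1 := by
  induction m generalizing y with
  | zero => exact Set.indicator_le_self' (fun _ _ => zero_le_one) y
  | succ m ih =>
    by_cases hy : y ∈ A
    · rw [exitFn_succ_of_mem hy]; exact hT.le_one _ (exitFn_nonneg hT m) ih y
    · rw [exitFn_of_notMem hy]

lemma exitFn_le_exitFn (hT : IsSubMarkovOp T) (hT' : IsSubMarkovOp T')
    (hTT : ∀ g : X → ℝ, (∀ z, 0 ≤ g z) → (∀ z, g z ≤ 1) → ∀ y, T g y ≤ T' g y) (m : ℕ) (y : X) :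
    exitFn T A m y ≤ exitFn T' A m y := by
  induction m generalizing y with
  | zero => exact le_rfl
  | succ m ih =>
    by_cases hy : y ∈ A
    · rw [exitFn_succ_of_mem hy, exitFn_succ_of_mem hy]
      exact (hTT _ (exitFn_nonneg hT m) (exitFn_le_one hT m) y).trans
        (hT'.mono _ _ (exitFn_nonneg hT m) ih (exitFn_le_one hT' m) y)
    · rw [exitFn_of_notMem hy, exitFn_of_notMem hy]

lemma exitFn_anti (hT : IsSubMarkovOp T) (hA : A ⊆ A') (m : ℕ) (y : X) :
    exitFn T A' m y ≤ exitFn T A m y := by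
  induction m generalizing y with
  | zero =>
    exact Set.indicator_le_indicator_of_subset (Set.compl_subset_compl.2 hA)
      (fun _ => zero_le_one) y
  | succ m ih =>
    by_cases hy : y ∈ A
    · rw [exitFn_succ_of_mem hy, exitFn_succ_of_mem (hA hy)]
      exact hT.mono _ _ (exitFn_nonneg hT m) ih (exitFn_le_one hT m) y
    · rw [exitFn_of_notMem hy]; exact exitFn_le_one hT _ y

lemma iterate_indicator_nonneg (hT : IsSubMarkovOp T) (m : ℕ) (y : X) :
    0 ≤ T^[m] (Set.indicator Aᶜ 1) y := by
  induction m generalizing y with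
  | zero => exact Set.indicator_nonneg (fun _ _ => zero_le_one) y
  | succ m ih => rw [Function.iterate_succ_apply']; exact hT.nonneg _ ih y

lemma iterate_indicator_le_exitFn (hT : IsSubMarkovOp T) (m : ℕ) (y : X) :
    T^[m] (Set.indicator Aᶜ 1) y ≤ exitFn T A m y := by
  induction m generalizing y with
  | zero => exact le_rfl
  | succ m ih =>
    have h1 : T^[m + 1] (Set.indicator Aᶜ 1) y ≤ T (exitFn T A m) y := by
      rw [Function.iterate_succ_apply']
      exact hT.mono _ _ (iterate_indicator_nonneg hT m) ih (exitFn_le_one hT m) y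
    by_cases hy : y ∈ A
    · rwa [exitFn_succ_of_mem hy]
    · rw [exitFn_of_notMem hy]
      exact h1.trans (hT.le_one _ (exitFn_nonneg hT m) (exitFn_le_one hT m) y)

/-- To leave `A'` the process has to leave `A` first. -/
lemma exitFn_finiteOp_le_mul {S : X → X → ℝ} (hS : ∀ y z, 0 ≤ S y z) {Ω : Finset X} {θ : ℝ}
    {n : ℕ} (hA : A ⊆ A')
    (hθ : ∀ y ∈ A, ∀ z ∉ A, S y z ≠ 0 → ∀ j ≤ n, exitFn (finiteOp S Ω) A' j z ≤ θ)
    {m : ℕ} (hm : m ≤ n) {y : X} (hy : y ∈ A) :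
    exitFn (finiteOp S Ω) A' m y ≤ θ * exitFn (finiteOp S Ω) A m y := by
  induction m generalizing y with
  | zero => rw [exitFn_zero_of_mem hy, exitFn_zero_of_mem (hA hy), mul_zero]
  | succ m ih =>
    rw [exitFn_succ_of_mem hy, exitFn_succ_of_mem (hA hy), finiteOp, finiteOp, Finset.mul_sum]
    refine Finset.sum_le_sum fun z _ => ?_
    rw [mul_left_comm]
    rcases eq_or_ne (S y z) 0 with h0 | h0
    · simp [h0]
    · refine mul_le_mul_of_nonneg_left ?_ (hS y z)
      by_cases hz : z ∈ A
      · exact ih (by omega) hz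
      · rw [exitFn_of_notMem hz, mul_one]
        exact hθ y hy z hz h0 m (by omega)

end exitFn

namespace IsTransition

variable {X : Type*} {P : X → X → ℝ} (hP : IsTransition P)
include hP

omit hP in
lemma abs_le_one_of_mem {g : X → ℝ} (h0 : ∀ z, 0 ≤ g z) (h1 : ∀ z, g z ≤ 1) (z : X) :
    |g z| ≤ 1 := by
  rw [abs_of_nonneg (h0 z)]; exact h1 z

lemma isSubMarkovOp : IsSubMarkovOp (transitionOp P) where
  nonneg _ hg y := op_nonneg hP.nonneg hg y
  le_one _ h0 h1 y := (abs_le.1 (hP.op_abs_le (IsTransition.abs_le_one_of_mem h0 h1) y)).2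
  mono _ _ h0 hgh h1 y :=
    (hP.summable_mul (IsTransition.abs_le_one_of_mem h0 fun z => (hgh z).trans (h1 z)) y).tsum_le_tsum
      (fun z => mul_le_mul_of_nonneg_left (hgh z) (hP.nonneg y z))
      (hP.summable_mul (IsTransition.abs_le_one_of_mem (fun z => (h0 z).trans (hgh z)) h1) y)

variable {S : X → X → ℝ} (hS0 : ∀ y z, 0 ≤ S y z) (hSP : ∀ y z, S y z ≤ P y z)
include hS0 hSP

omit hS0 in
lemma finiteOp_le_op (Ω : Finset X) (g : X → ℝ) (h0 : ∀ z, 0 ≤ g z) (h1 : ∀ z, g z ≤ 1) (y : X) :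
    finiteOp S Ω g y ≤ transitionOp P g y := by
  calc finiteOp S Ω g y ≤ ∑ z ∈ Ω, P y z * g z :=
        Finset.sum_le_sum fun z _ => mul_le_mul_of_nonneg_right (hSP y z) (h0 z)
    _ ≤ _ := (hP.summable_mul (IsTransition.abs_le_one_of_mem h0 h1) y).sum_le_tsum Ω
        fun z _ => mul_nonneg (hP.nonneg y z) (h0 z)

lemma isSubMarkovOp_finiteOp (Ω : Finset X) : IsSubMarkovOp (finiteOp S Ω) where
  nonneg _ hg y := Finset.sum_nonneg fun z _ => mul_nonneg (hS0 y z) (hg z)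
  le_one g h0 h1 y := (hP.finiteOp_le_op hSP Ω g h0 h1 y).trans
    (hP.isSubMarkovOp.le_one g h0 h1 y)
  mono _ _ _ hgh _ y := Finset.sum_le_sum fun z _ =>
    mul_le_mul_of_nonneg_left (hgh z) (hS0 y z)

end IsTransition

namespace WeightedGraph

variable {X : Type*} {W : WeightedGraph X}

/-- Ottaviani's maximal inequality. -/
lemma exitFn_ball_le {P : X → X → ℝ} (hP : IsTransition P) {ρ : ℝ} {n : ℕ}
    (hα : ∀ z, ∀ j ≤ n, (transitionOp P)^[j] (Set.indicator {w | ρ < (W.d z w : ℝ)} 1) z ≤ 1 / 2)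
    (x : X) {m : ℕ} (hm : m ≤ n) (y : X) :
    exitFn (transitionOp P) (W.ball x (2 * ρ)) m y
      ≤ 2 * (transitionOp P)^[m] (Set.indicator {w | ρ < (W.d x w : ℝ)} 1) y := by
  -- From outside B(x, 2ρ), returning to B(x, ρ) requires a displacement larger than ρ, of
  -- probability at most 1/2.
  have hout : ∀ j ≤ n, ∀ y ∉ W.ball x (2 * ρ),
      1 ≤ 2 * (transitionOp P)^[j] (Set.indicator {w | ρ < (W.d x w : ℝ)} 1) y := by
    intro j hj y hy
    have hy' : 2 * ρ < (W.d x y : ℝ) := not_le.1 hy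
    have h1 := (hP.hasSum_nStep_mul
      (IsTransition.abs_indicator_le {w | ρ < (W.d x w : ℝ)}) j y).add
      (hP.hasSum_nStep_mul (IsTransition.abs_indicator_le {w | ρ < (W.d y w : ℝ)}) j y)
    have h2 := hasSum_le (fun w => ?_) (hP.hasSum_nStep j y) h1
    · linarith [hα y j hj]
    · have h0 := hP.nStep_nonneg j y w
      have hw : 1 ≤ Set.indicator {w | ρ < (W.d x w : ℝ)} (1 : X → ℝ) w
          + Set.indicator {w | ρ < (W.d y w : ℝ)} (1 : X → ℝ) w := by
        by_cases h : ρ < (W.d y w : ℝ)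
        · have e : Set.indicator {w | ρ < (W.d y w : ℝ)} (1 : X → ℝ) w = 1 :=
            Set.indicator_of_mem (s := {w | ρ < (W.d y w : ℝ)}) h _
          rw [e]
          linarith [Set.indicator_nonneg (s := {w | ρ < (W.d x w : ℝ)}) (f := (1 : X → ℝ))
            (fun _ _ => zero_le_one) w]
        · have hx : ρ < (W.d x w : ℝ) := by
            have := W.d_triangle_real x w y
            rw [W.d_comm w y] at this
            linarith
          have e : Set.indicator {w | ρ < (W.d x w : ℝ)} (1 : X → ℝ) w = 1 :=
            Set.indicator_of_mem (s := {w | ρ < (W.d x w : ℝ)}) hx _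
          rw [e]
          linarith [Set.indicator_nonneg (s := {w | ρ < (W.d y w : ℝ)}) (f := (1 : X → ℝ))
            (fun _ _ => zero_le_one) w]
      rw [← mul_add]
      exact le_mul_of_one_le_right h0 hw
  induction m generalizing y with
  | zero =>
    by_cases hy : y ∈ W.ball x (2 * ρ)
    · rw [exitFn_zero_of_mem hy]
      exact mul_nonneg zero_le_two (hP.iterate_indicator_nonneg _ _ _)
    · rw [exitFn_of_notMem hy]; exact hout 0 hm y hy
  | succ m ih =>
    by_cases hy : y ∈ W.ball x (2 * ρ)
    · rw [exitFn_succ_of_mem hy, Function.iterate_succ_apply', transitionOp, transitionOp,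
        ← tsum_mul_left]
      refine (hP.summable_mul (IsTransition.abs_le_one_of_mem (exitFn_nonneg hP.isSubMarkovOp m)
        (exitFn_le_one hP.isSubMarkovOp m)) y).tsum_le_tsum (fun z => ?_)
        ((hP.summable_mul (IsTransition.abs_le_one_of_mem (hP.iterate_indicator_nonneg _ m)
          (hP.iterate_indicator_le_one _ m)) y).mul_left 2)
      rw [mul_left_comm]
      exact mul_le_mul_of_nonneg_left (ih (by omega) z) (hP.nonneg y z)
    · rw [exitFn_of_notMem hy]; exact hout _ hm y hy

/-- Leaving a large ball by short jumps requires leaving many small balls. -/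
lemma exitFn_finiteOp_ball_le_pow {S : X → X → ℝ} (hS : ∀ y z, 0 ≤ S y z) {Ω : Finset X}
    (hop : IsSubMarkovOp (finiteOp S Ω)) {ρ θ : ℝ} (hρ : 0 ≤ ρ) (hθ0 : 0 ≤ θ)
    (hSρ : ∀ y z, ρ < (W.d y z : ℝ) → S y z = 0) {n : ℕ}
    (hθ : ∀ z, ∀ j ≤ n, exitFn (finiteOp S Ω) (W.ball z (2 * ρ)) j z ≤ θ) (x : X) (k : ℕ) :
    ∀ m ≤ n, exitFn (finiteOp S Ω) (W.ball x (3 * ρ * k)) m x ≤ θ ^ k := by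
  induction k with
  | zero => intro m _; simpa using exitFn_le_one hop m x
  | succ k ih =>
    intro m hm
    have hx : x ∈ W.ball x (3 * ρ * k) := by
      show (W.d x x : ℝ) ≤ _
      rw [W.d_self, Nat.cast_zero]; positivity
    have hsub : W.ball x (3 * ρ * k) ⊆ W.ball x (3 * ρ * ((k + 1 : ℕ) : ℝ)) := fun y hy => by
      have : (W.d x y : ℝ) ≤ 3 * ρ * k := hy
      show (W.d x y : ℝ) ≤ _
      push_cast; linarith
    refine (exitFn_finiteOp_le_mul (n := n) (θ := θ) hS hsub ?_ hm hx).trans ?_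
    -- The exit jump has length at most ρ, so the landing point z is within 3ρk + ρ of x and the
    -- ball of radius 2ρ around z lies inside radius 3ρ(k+1).
    · intro y hy z _ hyz j hj
      have hy' : (W.d x y : ℝ) ≤ 3 * ρ * k := hy
      have hyz' : (W.d y z : ℝ) ≤ ρ := by
        by_contra h
        exact hyz (hSρ y z (not_le.1 h))
      refine (exitFn_anti hop (fun w hw => ?_) j z).trans (hθ z j hj)
      have hw' : (W.d z w : ℝ) ≤ 2 * ρ := hw
      show (W.d x w : ℝ) ≤ _
      have := W.d_triangle_real x y w
      have := W.d_triangle_real y z w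
      push_cast; linarith
    · rw [pow_succ']
      exact mul_le_mul_of_nonneg_left (ih m hm) hθ0

end WeightedGraph

/-! ### Truncation of long jumps and the off-diagonal upper bound. -/

namespace IsSubMarkov

variable {ι : Type*} [Fintype ι] [DecidableEq ι] {k k' : ι → ι → ℝ} {μ : ι → ℝ}
  (H : IsSubMarkov k μ)
include H

lemma mono (H' : IsSubMarkov k' μ) (hk : ∀ y z, k' y z ≤ k y z) (n : ℕ) (x y : ι) :
    (kernelMatrix k' μ ^ n) x y ≤ (kernelMatrix k μ ^ n) x y := by
  induction n generalizing x with
  | zero => exact le_rfl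
  | succ n ih =>
    rw [pow_succ_apply, pow_succ_apply]
    refine Finset.sum_le_sum fun w _ => mul_le_mul ?_ (ih w) (H'.pow_nonneg n w y)
      (H.matrix_nonneg x w)
    exact mul_le_mul_of_nonneg_right (hk x w) (H.pos w).le

/-- Removing jumps of intensity at most `b` changes the `n`-step kernel by at most `n * b`. -/
lemma pow_le_pow_add (H' : IsSubMarkov k' μ) {b : ℝ} (hb : 0 ≤ b)
    (hk : ∀ y z, k y z ≤ k' y z + b) (n : ℕ) (x y : ι) :
    (kernelMatrix k μ ^ n) x y ≤ (kernelMatrix k' μ ^ n) x y + n * b * μ y := by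
  induction n generalizing x with
  | zero => simp
  | succ n ih =>
    rw [pow_succ_apply, pow_succ_apply]
    have hc : 0 ≤ n * b * μ y := mul_nonneg (mul_nonneg n.cast_nonneg hb) (H.pos y).le
    calc _ ≤ ∑ w, (k' x w * μ w * (kernelMatrix k' μ ^ n) w y + k' x w * μ w * (n * b * μ y)
          + b * (μ w * (kernelMatrix k μ ^ n) w y)) := by
          refine Finset.sum_le_sum fun w _ => ?_
          have h1 := mul_le_mul_of_nonneg_right (hk x w)
            (mul_nonneg (H.pos w).le (H.pow_nonneg n w y))
          have h2 := mul_le_mul_of_nonneg_left (ih w) (H'.matrix_nonneg x w)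
          rw [kernelMatrix_apply] at h2
          linarith
      _ = ∑ w, k' x w * μ w * (kernelMatrix k' μ ^ n) w y
          + (∑ w, k' x w * μ w) * (n * b * μ y)
          + b * ∑ w, μ w * (kernelMatrix k μ ^ n) w y := by
          rw [Finset.sum_add_distrib, Finset.sum_add_distrib, ← Finset.sum_mul, ← Finset.mul_sum]
      _ ≤ ∑ w, k' x w * μ w * (kernelMatrix k' μ ^ n) w y + 1 * (n * b * μ y) + b * μ y := by
          have h1 := mul_le_mul_of_nonneg_right (H'.row x) hc
          have h2 := mul_le_mul_of_nonneg_left (H.column_mass_le n y) hb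
          linarith
      _ = _ := by push_cast; ring

/-- Splitting an `n`-step path at an intermediate time. -/
lemma pow_add_le {far : ι → ι → Prop} [∀ y z, Decidable (far y z)] {m₁ m₂ : ℕ} {x y : ι}
    (hfar : ∀ z, far x z ∨ far y z) {E p : ℝ} (hE : 0 ≤ E)
    (h₁ : ∀ z, (kernelMatrix k μ ^ m₁) x z ≤ E * μ z)
    (h₂ : ∀ z, (kernelMatrix k μ ^ m₂) z y ≤ E * μ y)
    (hx : ∑ z, (kernelMatrix k μ ^ m₁) x z * (if far x z then 1 else 0) ≤ p)
    (hy : ∑ z, (kernelMatrix k μ ^ m₂) y z * (if far y z then 1 else 0) ≤ p) :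
    (kernelMatrix k μ ^ (m₁ + m₂)) x y ≤ 2 * E * p * μ y := by
  rw [pow_add, Matrix.mul_apply]
  have hμy := (H.pos y).le
  calc _ ≤ ∑ z, (E * μ y * ((kernelMatrix k μ ^ m₁) x z * (if far x z then 1 else 0))
        + E * μ y * ((kernelMatrix k μ ^ m₂) y z * (if far y z then 1 else 0))) := by
        refine Finset.sum_le_sum fun z _ => ?_
        have h3 := H.pow_nonneg m₁ x z
        have h4 := H.pow_nonneg m₂ z y
        have h5 := H.pow_nonneg m₂ y z
        have hEy : 0 ≤ E * μ y := mul_nonneg hE hμy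
        by_cases hz : far x z
        · have h6 : 0 ≤ E * μ y * ((kernelMatrix k μ ^ m₂) y z * (if far y z then 1 else 0)) := by
            split_ifs <;> simp only [mul_one, mul_zero, le_refl]
            exact mul_nonneg hEy h5
          rw [if_pos hz]
          have := mul_le_mul_of_nonneg_left (h₂ z) h3
          linarith
        · have hz' : far y z := (hfar z).resolve_left hz
          rw [if_neg hz, if_pos hz']
          have h6 := mul_le_mul_of_nonneg_right (h₁ z) h4
          have h7 := H.pow_symm m₂ z y
          calc _ ≤ _ := h6
            _ = E * (μ z * (kernelMatrix k μ ^ m₂) z y) := by ring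
            _ = _ := by rw [h7]; ring
    _ = E * μ y * ∑ z, (kernelMatrix k μ ^ m₁) x z * (if far x z then 1 else 0)
        + E * μ y * ∑ z, (kernelMatrix k μ ^ m₂) y z * (if far y z then 1 else 0) := by
        rw [Finset.sum_add_distrib, ← Finset.mul_sum, ← Finset.mul_sum]
    _ ≤ E * μ y * p + E * μ y * p := by gcongr
    _ = _ := by ring

end IsSubMarkov

lemma sum_kernelMatrix_pow_mul {X : Type*} [DecidableEq X] (Ω : Finset X) (k : X → X → ℝ)
    (μ : X → ℝ) (g : X → ℝ) (n : ℕ) (x : Ω) :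
    ∑ z : Ω, (kernelMatrix (fun y z : Ω => k y z) (fun y : Ω => μ y) ^ n) x z * g z
      = (finiteOp (fun u v => k u v * μ v) Ω)^[n] g x := by
  induction n generalizing x with
  | zero => simp [Matrix.one_apply]
  | succ n ih =>
    rw [Function.iterate_succ_apply', finiteOp, ← Finset.sum_coe_sort Ω]
    simp only [IsSubMarkov.pow_succ_apply, Finset.sum_mul]
    rw [Finset.sum_comm]
    refine Finset.sum_congr rfl fun w _ => ?_
    rw [← ih w, Finset.mul_sum]
    exact Finset.sum_congr rfl fun z _ => by ring

namespace WeightedGraph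

namespace SymmMarkovOperator

variable {X : Type*} {W : WeightedGraph X} {K : W.SymmMarkovOperator}

/-- Off-diagonal bound in terms of the tails of the process, by truncating the jumps at `ρ`. -/
lemma killed_pow_le_of_tail [DecidableEq X] (hμ : W.ComparableToCounting) {ρ α b E : ℝ} {n p : ℕ}
    (hρ : 0 ≤ ρ) (hα0 : 0 ≤ α) (hα1 : α ≤ 1 / 2) (hb0 : 0 ≤ b) (hE : 0 ≤ E)
    (hα : ∀ z, ∀ j ≤ n, (transitionOp fun u v => K.kernel u v * W.vol v)^[j]
      (Set.indicator {w | ρ < (W.d z w : ℝ)} 1) z ≤ α)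
    (hb : ∀ y z, ρ < (W.d y z : ℝ) → K.kernel y z ≤ b) {Ω : Finset X}
    (hEn : ∀ m, n ≤ 2 * m + 1 → ∀ x y : Ω, (K.killed Ω ^ m) x y ≤ E * W.vol y) (x y : Ω)
    (hxy : 6 * ρ * p < (W.d x y : ℝ)) :
    (K.killed Ω ^ n) x y ≤ (2 * E * (2 * α) ^ p + n * b) * W.vol y := by
  classical
  have hP := K.isTransition hμ
  set P : X → X → ℝ := fun u v => K.kernel u v * W.vol v with hPdef
  -- Without jumps longer than ρ, travelling further than 3ρp takes p successive escapes from balls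
  -- of radius 2ρ, each of probability at most 2α since the truncated chain is dominated by the full
  -- one.
  set s : X → X → ℝ := fun u v => if (W.d u v : ℝ) ≤ ρ then K.kernel u v else 0 with hs
  have hs0 : ∀ u v, 0 ≤ s u v := fun u v => by
    simp only [hs]; split_ifs; exacts [K.nonneg u v, le_rfl]
  have hsk : ∀ u v, s u v ≤ K.kernel u v := fun u v => by
    simp only [hs]; split_ifs; exacts [le_rfl, K.nonneg u v]
  have H := K.isSubMarkov hμ Ω
  have H' : IsSubMarkov (fun u v : Ω => s u v) (fun u : Ω => W.vol u) :=
    ⟨fun u v => hs0 u v, fun u v => by simp only [hs, W.d_comm (v : X) u, K.symm (v : X) u],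
      H.pos, fun u => (Finset.sum_le_sum fun (v : Ω) _ =>
        mul_le_mul_of_nonneg_right (hsk u v) (hμ.vol_pos v).le).trans (H.row u)⟩
  set S : X → X → ℝ := fun u v => s u v * W.vol v with hS
  have hS0 : ∀ u v, 0 ≤ S u v := fun u v => mul_nonneg (hs0 u v) (hμ.vol_pos v).le
  have hSP : ∀ u v, S u v ≤ P u v := fun u v =>
    mul_le_mul_of_nonneg_right (hsk u v) (hμ.vol_pos v).le
  have hop := hP.isSubMarkovOp_finiteOp hS0 hSP Ω
  have hexit : ∀ (z : Ω), ∀ m ≤ n, ∑ w : Ω,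
      (kernelMatrix (fun u v : Ω => s u v) (fun u : Ω => W.vol u) ^ m) z w *
        (if 3 * ρ * p < (W.d z w : ℝ) then 1 else 0) ≤ (2 * α) ^ p := by
    intro z m hm
    have h1 := exitFn_finiteOp_ball_le_pow (W := W) hS0 hop hρ (θ := 2 * α) (by positivity)
      (fun u v huv => by simp only [hS, hs, if_neg (not_le.2 huv), zero_mul]) (n := n)
      (fun w j hj => (exitFn_le_exitFn hop hP.isSubMarkovOp (hP.finiteOp_le_op hSP Ω) j w).trans
        ((exitFn_ball_le hP (fun u i hi => (hα u i hi).trans hα1) w hj w).trans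
          (mul_le_mul_of_nonneg_left (hα w j hj) zero_le_two))) (z : X) p m hm
    refine le_trans (le_of_eq ?_) ((iterate_indicator_le_exitFn hop m (z : X)).trans h1)
    rw [hS, ← sum_kernelMatrix_pow_mul Ω s W.vol]
    refine Finset.sum_congr rfl fun w _ => ?_
    congr 1
    by_cases h : 3 * ρ * p < (W.d z w : ℝ)
    · rw [if_pos h, Set.indicator_of_mem (show (w : X) ∈ (W.ball z (3 * ρ * p))ᶜ from not_le.2 h)]
      rfl
    · rw [if_neg h, Set.indicator_of_notMem]
      exact fun h' => h' (not_lt.1 h)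
  have h1 := H.pow_le_pow_add H' hb0 (fun u v => by
    by_cases h : (W.d u v : ℝ) ≤ ρ
    · simp only [hs, if_pos h]; linarith
    · simp only [hs, if_neg h]; linarith [hb u v (not_le.1 h)]) n x y
  have hhalf : n / 2 + (n - n / 2) = n := by omega
  -- Since d(x,y) > 6ρp, the midpoint of a path is far from x or from y. The other half of the path
  -- supplies the on-diagonal factor E.
  have h2 := H'.pow_add_le (far := fun z w : Ω => 3 * ρ * p < (W.d z w : ℝ))
    (m₁ := n / 2) (m₂ := n - n / 2) (x := x) (y := y)
    (fun z => by
      by_contra! hcon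
      have := W.d_triangle_real x z y
      rw [W.d_comm (z : X) y] at this
      linarith [hcon.1, hcon.2]) hE
    (fun z => (H.mono H' (fun u v => hsk u v) _ x z).trans (hEn _ (by omega) x z))
    (fun z => (H.mono H' (fun u v => hsk u v) _ z y).trans (hEn _ (by omega) z y))
    (hexit x _ (by omega)) (hexit y _ (by omega))
  rw [hhalf] at h2
  calc _ ≤ _ := h1
    _ ≤ 2 * E * (2 * α) ^ p * W.vol y + n * b * W.vol y := by gcongr
    _ = _ := by ring

end SymmMarkovOperator

end WeightedGraph

namespace WeightedGraph

namespace SymmMarkovOperator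

variable {X : Type*} {W : WeightedGraph X} {K : W.SymmMarkovOperator}

/-- Off-diagonal upper bound. -/
lemma J.nStep_le_of_ne {df dw β : ℝ} (hμ : W.ComparableToCounting)
    (hV : W.VolumeGrowth df) (hU : W.USG df dw) (hL : W.LSG df dw) (hdf : 0 < df) (hβ : 2 ≤ β)
    (hβw : β < dw) (hJ : K.J df β) :
    ∃ C : ℝ, 0 < C ∧ ∀ (n : ℕ) (x y : X), 1 ≤ n → x ≠ y →
      nStep (fun u v => K.kernel u v * W.vol v) n x y
        ≤ C * (n * (W.d x y : ℝ) ^ (-(df + β))) * W.vol y := by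
  classical
  have hβ0 : 0 < β := by linarith
  obtain ⟨Ct, hCt0, hCt⟩ := hJ.tail_le hμ hV hU hL hdf hβ hβw
  obtain ⟨A, hA0, hA⟩ := hJ.killed_pow_le hμ hV hdf hβ0
  obtain ⟨B, hB1, hB⟩ := hJ.bounds
  have hB0 : 0 < B := by linarith
  set γ := df / β with hγ
  have hγ0 : 0 < γ := by positivity
  obtain ⟨p, hp⟩ := exists_nat_ge (1 + γ)
  -- With ρ = d(x,y)/c, the 2p iterations used below cover distance 6ρ·2p = 12pρ < d(x,y).
  set c : ℝ := 12 * p + 1 with hc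
  have hc0 : 0 < c := by positivity
  set G : ℝ := 8 * Ct * c ^ β with hG
  have hG0 : 0 < G := by positivity
  set C : ℝ := 2 * (A * 2 ^ γ) * G ^ (1 + γ) + B * c ^ (df + β) with hC
  have h2γ : (1 : ℝ) ≤ 2 ^ γ := Real.one_le_rpow (by norm_num) hγ0.le
  refine ⟨C, by positivity, fun n x y hn hxy => ?_⟩
  have hn1 : (1 : ℝ) ≤ n := by exact_mod_cast hn
  have hn0 : (0 : ℝ) < n := by linarith
  have hd1 : (1 : ℝ) ≤ W.d x y := by exact_mod_cast W.one_le_d hxy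
  set D : ℝ := (W.d x y : ℝ) with hD
  have hD0 : 0 < D := by linarith
  set ρ : ℝ := D / c with hρ
  have hρ0 : 0 < ρ := by positivity
  have hvy := hμ.vol_pos y
  have hscale : ∀ s : ℝ, 0 ≤ s → (1 + ρ) ^ (-s) ≤ c ^ s * D ^ (-s) := by
    intro s hs
    calc (1 + ρ) ^ (-s) ≤ ρ ^ (-s) :=
          Real.rpow_le_rpow_of_nonpos hρ0 (by linarith) (by linarith)
      _ = _ := by
          rw [hρ, Real.div_rpow hD0.le hc0.le, Real.rpow_neg hc0.le, div_inv_eq_mul, mul_comm]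
  -- The power 1 + γ of the tail n D^{-β} converts the on-diagonal factor n^{-γ} into n D^{-(df+β)};
  -- hence the requirement p ≥ 1 + γ.
  have hid : (n : ℝ) ^ (-γ) * (G * (n * D ^ (-β))) ^ (1 + γ)
      = G ^ (1 + γ) * (n * D ^ (-(df + β))) := by
    rw [Real.mul_rpow hG0.le (by positivity), Real.mul_rpow hn0.le (by positivity),
      ← Real.rpow_mul hD0.le, Real.rpow_add hn0, Real.rpow_one, Real.rpow_neg hn0.le,
      show -β * (1 + γ) = -(df + β) by rw [hγ]; field_simp; ring]
    field_simp
  set σ : ℝ := 4 * (Ct * ((n : ℝ) + 1) * (1 + ρ) ^ (-β)) with hσ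
  have hσ0 : 0 < σ := by positivity
  have hσG : σ ≤ G * (n * D ^ (-β)) := by
    calc σ ≤ 4 * (Ct * (2 * (n : ℝ)) * (c ^ β * D ^ (-β))) := by
          rw [hσ]
          have := hscale β hβ0.le
          gcongr
          linarith
      _ = _ := by rw [hG]; ring
  have hlim : ∀ M : ℝ, (∀ (Ω : Finset X) (hx : x ∈ Ω) (hy : y ∈ Ω),
      (K.killed Ω ^ n) ⟨x, hx⟩ ⟨y, hy⟩ ≤ M) →
      nStep (fun u v => K.kernel u v * W.vol v) n x y ≤ M := by
    intro M hM
    refine le_of_tendsto ((K.isTransition hμ).tendsto_finiteOp_iterate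
      (IsTransition.abs_indicator_le {y}) n x) ?_
    filter_upwards [Filter.eventually_ge_atTop {x, y}] with Ω hΩ
    have := hM Ω (hΩ (by simp)) (hΩ (by simp))
    rwa [killed_pow_apply] at this
  refine hlim _ fun Ω hx hy => ?_
  have hdiag : ∀ m, n ≤ 2 * m + 1 → ∀ u v : Ω,
      (K.killed Ω ^ m) u v ≤ A * 2 ^ γ * (n : ℝ) ^ (-γ) * W.vol v := by
    intro m hm u v
    refine (hA Ω m u v).2.trans ?_
    have hv := hμ.vol_pos (v : X)
    have h1 : (n : ℝ) / 2 ≤ (m : ℝ) + 1 := by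
      have : (n : ℝ) ≤ 2 * m + 1 := by exact_mod_cast hm
      linarith
    have h2 : ((m : ℝ) + 1) ^ (-γ) ≤ 2 ^ γ * (n : ℝ) ^ (-γ) := by
      calc _ ≤ ((n : ℝ) / 2) ^ (-γ) :=
            Real.rpow_le_rpow_of_nonpos (by positivity) h1 (by linarith)
        _ = _ := by
            rw [Real.div_rpow hn0.le (by norm_num), Real.rpow_neg (by norm_num : (0 : ℝ) ≤ 2),
              div_inv_eq_mul, mul_comm]
    calc _ ≤ A * (2 ^ γ * (n : ℝ) ^ (-γ)) * W.vol v := by gcongr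
      _ = _ := by ring
  -- σ = (2α)² is the square of the escape probability bound. If σ > 1, then G n D^{-β} > 1 and the
  -- on-diagonal bound is already sufficient.
  rcases le_or_gt σ 1 with h | h
  · set α : ℝ := √(Ct * ((n : ℝ) + 1) * (1 + ρ) ^ (-β)) with hα
    have hα2 : (2 * α) ^ 2 = σ := by
      rw [mul_pow, hα, Real.sq_sqrt (by positivity), hσ]; norm_num
    have hα0 : 0 ≤ α := Real.sqrt_nonneg _
    have hα1 : α ≤ 1 / 2 := by nlinarith
    have hmain := killed_pow_le_of_tail (K := K) hμ (ρ := ρ) (α := α)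
      (b := B * (c ^ (df + β) * D ^ (-(df + β)))) (E := A * 2 ^ γ * (n : ℝ) ^ (-γ)) (n := n)
      (p := 2 * p) hρ0.le hα0 hα1 (by positivity) (by positivity)
      (fun z j hj => (hCt z ρ j hρ0.le).trans (by
        rw [hα]
        apply Real.sqrt_le_sqrt
        have : (j : ℝ) ≤ n := by exact_mod_cast hj
        gcongr))
      (fun u v huv => by
        refine (hB u v).2.trans ?_
        refine mul_le_mul_of_nonneg_left ?_ hB0.le
        exact (Real.rpow_le_rpow_of_nonpos (by positivity) (by linarith) (by linarith)).trans
          (hscale (df + β) (by positivity)))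
      hdiag ⟨x, hx⟩ ⟨y, hy⟩ (by
        show 6 * ρ * ((2 * p : ℕ) : ℝ) < D
        have e : D = ρ * c := by rw [hρ]; field_simp
        rw [e, hc]; push_cast; nlinarith)
    refine hmain.trans ?_
    have h3 : (2 * α) ^ (2 * p) ≤ (G * (n * D ^ (-β))) ^ (1 + γ) := by
      rw [pow_mul, hα2, ← Real.rpow_natCast]
      exact (Real.rpow_le_rpow_of_exponent_ge hσ0 h hp).trans
        (Real.rpow_le_rpow hσ0.le hσG (by positivity))
    refine mul_le_mul_of_nonneg_right ?_ hvy.le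
    calc _ ≤ 2 * (A * 2 ^ γ * (n : ℝ) ^ (-γ)) * (G * (n * D ^ (-β))) ^ (1 + γ)
          + n * (B * (c ^ (df + β) * D ^ (-(df + β)))) := by gcongr
      _ = 2 * (A * 2 ^ γ) * ((n : ℝ) ^ (-γ) * (G * (n * D ^ (-β))) ^ (1 + γ))
          + B * c ^ (df + β) * (n * D ^ (-(df + β))) := by ring
      _ = C * (n * D ^ (-(df + β))) := by rw [hid, hC]; ring
  · refine (hdiag n (by omega) _ _).trans ?_
    refine mul_le_mul_of_nonneg_right ?_ hvy.le
    have h1 : 1 ≤ (G * (n * D ^ (-β))) ^ (1 + γ) :=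
      Real.one_le_rpow (h.le.trans hσG) (by positivity)
    calc _ ≤ A * 2 ^ γ * ((n : ℝ) ^ (-γ) * (G * (n * D ^ (-β))) ^ (1 + γ)) := by
          have : (n : ℝ) ^ (-γ) ≤ (n : ℝ) ^ (-γ) * (G * (n * D ^ (-β))) ^ (1 + γ) :=
            le_mul_of_one_le_right (by positivity) h1
          gcongr
      _ = A * 2 ^ γ * G ^ (1 + γ) * (n * D ^ (-(df + β))) := by rw [hid]; ring
      _ ≤ _ := by
          have h2 : 0 ≤ A * 2 ^ γ * G ^ (1 + γ) := by positivity
          have h3 : 0 ≤ B * c ^ (df + β) := by positivity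
          refine mul_le_mul_of_nonneg_right ?_ (by positivity)
          rw [hC]; linarith

end SymmMarkovOperator

end WeightedGraph

/-! ### The lower bound by a single jump. -/

namespace IsSubMarkov

variable {ι : Type*} [Fintype ι] [DecidableEq ι] {k k' : ι → ι → ℝ} {μ : ι → ℝ}
  (H : IsSubMarkov k μ) (H' : IsSubMarkov k' μ)
include H H'

/-- Passing from k to k' loses mass at most ζ at each step, and test functions are bounded by 1, so
n steps cost at most nζ. -/
lemma sum_pow_mul_le {ζ : ℝ} (hζ0 : 0 ≤ ζ) (hk : ∀ y z, k' y z ≤ k y z)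
    (hζ : ∀ y, ∑ z, (k y z - k' y z) * μ z ≤ ζ) {g : ι → ℝ} (hg0 : ∀ z, 0 ≤ g z)
    (hg1 : ∀ z, g z ≤ 1) (n : ℕ) (x : ι) :
    ∑ z, (kernelMatrix k μ ^ n) x z * g z ≤ ∑ z, (kernelMatrix k' μ ^ n) x z * g z + n * ζ := by
  have hsucc : ∀ (κ : ι → ι → ℝ) (n : ℕ) (x : ι), ∑ z, (kernelMatrix κ μ ^ (n + 1)) x z * g z
      = ∑ w, κ x w * μ w * ∑ z, (kernelMatrix κ μ ^ n) w z * g z := by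
    intro κ n x
    simp only [pow_succ_apply, Finset.sum_mul, Finset.mul_sum]
    rw [Finset.sum_comm]
    exact Finset.sum_congr rfl fun w _ => Finset.sum_congr rfl fun z _ => by ring
  have hle : ∀ (n : ℕ) (x : ι), ∑ z, (kernelMatrix k μ ^ n) x z * g z ≤ 1 := fun n x =>
    (Finset.sum_le_sum fun z _ => mul_le_of_le_one_right (H.pow_nonneg n x z) (hg1 z)).trans
      (H.pow_row n x)
  have h0 : ∀ (n : ℕ) (x : ι), 0 ≤ ∑ z, (kernelMatrix k μ ^ n) x z * g z := fun n x =>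
    Finset.sum_nonneg fun z _ => mul_nonneg (H.pow_nonneg n x z) (hg0 z)
  induction n generalizing x with
  | zero => simp
  | succ n ih =>
    rw [hsucc, hsucc]
    have hnζ : 0 ≤ n * ζ := by positivity
    calc _ ≤ ∑ w, (k' x w * μ w * (∑ z, (kernelMatrix k' μ ^ n) w z * g z)
          + k' x w * μ w * (n * ζ) + (k x w - k' x w) * μ w) := by
          refine Finset.sum_le_sum fun w _ => ?_
          have h1 := mul_le_mul_of_nonneg_left (ih w) (H'.matrix_nonneg x w)
          have h2 := mul_le_of_le_one_right
            (mul_nonneg (sub_nonneg.2 (hk x w)) (H.pos w).le) (hle n w)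
          rw [kernelMatrix_apply] at h1
          linarith
      _ = ∑ w, k' x w * μ w * (∑ z, (kernelMatrix k' μ ^ n) w z * g z)
          + (∑ w, k' x w * μ w) * (n * ζ) + ∑ w, (k x w - k' x w) * μ w := by
          rw [Finset.sum_add_distrib, Finset.sum_add_distrib, ← Finset.sum_mul]
      _ ≤ ∑ w, k' x w * μ w * (∑ z, (kernelMatrix k' μ ^ n) w z * g z) + 1 * (n * ζ) + ζ := by
          have h1 := mul_le_mul_of_nonneg_right (H'.row x) hnζ
          linarith [hζ x]
      _ = _ := by push_cast; ring

/-- Paths with exactly one distinguished jump. -/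
lemma sum_pow_mul_jump_mul_pow_le {j : Matrix ι ι ℝ} (hj : ∀ y z, 0 ≤ j y z)
    (hk : ∀ y z, kernelMatrix k' μ y z + j y z ≤ kernelMatrix k μ y z) (n : ℕ) (x y : ι) :
    ∑ i ∈ Finset.range n, (kernelMatrix k' μ ^ i * j * kernelMatrix k' μ ^ (n - 1 - i)) x y
      ≤ (kernelMatrix k μ ^ n) x y := by
  have hk' : ∀ y z, k' y z ≤ k y z := fun y z => by
    have := (le_add_of_nonneg_right (hj y z)).trans (hk y z)
    exact le_of_mul_le_mul_right this (H.pos z)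
  induction n generalizing x with
  | zero => simpa using H.pow_nonneg 0 x y
  | succ n ih =>
    rw [Finset.sum_range_succ']
    calc _ = ∑ w, kernelMatrix k' μ x w *
          ∑ i ∈ Finset.range n, (kernelMatrix k' μ ^ i * j * kernelMatrix k' μ ^ (n - 1 - i)) w y
          + ∑ w, j x w * (kernelMatrix k' μ ^ n) w y := by
          congr 1
          · simp only [Finset.mul_sum]
            rw [Finset.sum_comm]
            refine Finset.sum_congr rfl fun i _ => ?_
            rw [← Matrix.mul_apply, show n + 1 - 1 - (i + 1) = n - 1 - i by omega, pow_succ',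
              ← Matrix.mul_assoc, ← Matrix.mul_assoc]
          · simp [Matrix.mul_apply]
      _ ≤ ∑ w, kernelMatrix k' μ x w * (kernelMatrix k μ ^ n) w y
          + ∑ w, j x w * (kernelMatrix k μ ^ n) w y := by
          refine add_le_add (Finset.sum_le_sum fun w _ => ?_) (Finset.sum_le_sum fun w _ => ?_)
          · exact mul_le_mul_of_nonneg_left (ih w) (H'.matrix_nonneg x w)
          · exact mul_le_mul_of_nonneg_left (H.mono H' hk' n w y) (hj x w)
      _ = ∑ w, (kernelMatrix k' μ x w + j x w) * (kernelMatrix k μ ^ n) w y := by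
          rw [← Finset.sum_add_distrib]
          exact Finset.sum_congr rfl fun w _ => by ring
      _ ≤ ∑ w, kernelMatrix k μ x w * (kernelMatrix k μ ^ n) w y :=
          Finset.sum_le_sum fun w _ =>
            mul_le_mul_of_nonneg_right (hk x w) (H.pow_nonneg n w y)
      _ = _ := by rw [pow_succ', Matrix.mul_apply]

/-- Lower bound for the `n`-step kernel by a single big jump. -/
lemma le_pow_of_jump {near : ι → ι → Prop} [∀ y z, Decidable (near y z)] {b a : ℝ} (hb : 0 ≤ b)
    (ha : 0 ≤ a) (hk : ∀ y z, k' y z + (if near y z then b else 0) ≤ k y z) {x y : ι}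
    {g h : ι → ℝ} (hgh : ∀ z w, g z * h w ≤ if near z w then 1 else 0) {n : ℕ}
    (hx : ∀ i < n, a ≤ ∑ z, (kernelMatrix k' μ ^ i) x z * g z)
    (hy : ∀ i < n, a ≤ ∑ z, (kernelMatrix k' μ ^ i) y z * h z) :
    n * (b * a ^ 2) * μ y ≤ (kernelMatrix k μ ^ n) x y := by
  set j : Matrix ι ι ℝ := Matrix.of fun z w => (if near z w then b else 0) * μ w with hj
  have hj0 : ∀ z w, 0 ≤ j z w := fun z w => by
    refine mul_nonneg ?_ (H.pos w).le
    split_ifs <;> simp [hb]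
  refine le_trans ?_ (H.sum_pow_mul_jump_mul_pow_le H' hj0 (fun z w => ?_) n x y)
  · have hterm : ∀ i ∈ Finset.range n, b * a ^ 2 * μ y
        ≤ (kernelMatrix k' μ ^ i * j * kernelMatrix k' μ ^ (n - 1 - i)) x y := by
      intro i hi
      have hi' := Finset.mem_range.1 hi
      set m := n - 1 - i with hm
      calc b * a ^ 2 * μ y = b * μ y * (a * a) := by ring
        -- The part of the path after the jump is read backwards from y, by symmetry, so both
        -- factors are probabilities of being found near the starting point.
        _ ≤ b * μ y * ((∑ z, (kernelMatrix k' μ ^ i) x z * g z) *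
            ∑ w, (kernelMatrix k' μ ^ m) y w * h w) := by
            have := (H.pos y).le
            refine mul_le_mul_of_nonneg_left (mul_le_mul (hx i hi') (hy m (by omega)) ha
              (ha.trans (hx i hi'))) (by positivity)
        _ = ∑ w, ∑ z, (kernelMatrix k' μ ^ i) x z * (b * (g z * h w) * μ w) *
            (kernelMatrix k' μ ^ m) w y := by
            rw [Finset.sum_mul_sum, Finset.sum_comm, Finset.mul_sum]
            refine Finset.sum_congr rfl fun w _ => ?_
            rw [Finset.mul_sum]
            refine Finset.sum_congr rfl fun z _ => ?_
            have := H'.pow_symm m y w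
            linear_combination b * ((kernelMatrix k' μ ^ i) x z * g z * h w) * this
        _ ≤ ∑ w, ∑ z, (kernelMatrix k' μ ^ i) x z * j z w * (kernelMatrix k' μ ^ m) w y := by
            refine Finset.sum_le_sum fun w _ => Finset.sum_le_sum fun z _ => ?_
            refine mul_le_mul_of_nonneg_right (mul_le_mul_of_nonneg_left ?_
              (H'.pow_nonneg i x z)) (H'.pow_nonneg m w y)
            refine mul_le_mul_of_nonneg_right ?_ (H.pos w).le
            refine (mul_le_mul_of_nonneg_left (hgh z w) hb).trans (le_of_eq ?_)
            split_ifs <;> simp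
        _ = _ := by
            rw [Matrix.mul_apply]
            refine Finset.sum_congr rfl fun w _ => ?_
            rw [Matrix.mul_apply, Finset.sum_mul]
    calc _ = ∑ i ∈ Finset.range n, b * a ^ 2 * μ y := by simp; ring
      _ ≤ _ := Finset.sum_le_sum hterm
  · rw [kernelMatrix_apply, kernelMatrix_apply, hj, Matrix.of_apply, ← add_mul]
    exact mul_le_mul_of_nonneg_right (hk z w) (H.pos w).le

end IsSubMarkov

namespace WeightedGraph

namespace SymmMarkovOperator

variable {X : Type*} {W : WeightedGraph X} {K : W.SymmMarkovOperator}

/-- Lower bound for the `n`-step transition probabilities. -/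
lemma J.le_nStep {df dw β : ℝ} (hμ : W.ComparableToCounting)
    (hV : W.VolumeGrowth df) (hU : W.USG df dw) (hL : W.LSG df dw) (hdf : 0 < df) (hβ : 2 ≤ β)
    (hβw : β < dw) (hJ : K.J df β) :
    ∃ c : ℝ, 0 < c ∧ ∀ (n : ℕ) (x y : X), 1 ≤ n →
      c * (n * (max ((n : ℝ) ^ (1 / β)) (W.d x y)) ^ (-(df + β))) * W.vol y
        ≤ nStep (fun u v => K.kernel u v * W.vol v) n x y := by
  classical
  have hβ0 : 0 < β := by linarith
  obtain ⟨Ct, hCt0, hCt⟩ := hJ.tail_le hμ hV hU hL hdf hβ hβw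
  obtain ⟨Cs, hCs0, hCs⟩ := hV.sum_le hμ
  obtain ⟨B, hB1, hB⟩ := hJ.bounds
  have hB0 : 0 < B := by linarith
  have hP := K.isTransition hμ
  set P : X → X → ℝ := fun u v => K.kernel u v * W.vol v with hPdef
  -- R = A m gives n R^{-β} ≤ 1/(1 + 4Cs + 16Ct). The term 4Cs makes the removed jumps cost at most
  -- 1/4, and 16Ct makes the escape probability at most 1/4, since the tail bound carries a square
  -- root.
  set A : ℝ := (1 + 4 * Cs + 16 * Ct) ^ (1 / β) with hA
  have hAβ : A ^ β = 1 + 4 * Cs + 16 * Ct := by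
    rw [hA, ← Real.rpow_mul (by positivity)]; simp [hβ0.ne']
  have hA1 : 1 ≤ A := Real.one_le_rpow (by linarith) (by positivity)
  have hA0 : 0 < A := by linarith
  refine ⟨B⁻¹ * (4 * A) ^ (-(df + β)) / 16, by positivity, fun n x y hn => ?_⟩
  have hn1 : (1 : ℝ) ≤ n := by exact_mod_cast hn
  have hn0 : (0 : ℝ) < n := by linarith
  set m : ℝ := max ((n : ℝ) ^ (1 / β)) (W.d x y) with hm
  have hm1 : 1 ≤ m := (Real.one_le_rpow hn1 (by positivity)).trans (le_max_left _ _)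
  have hm0 : 0 < m := by linarith
  have hmβ : (n : ℝ) ≤ m ^ β := by
    calc (n : ℝ) = ((n : ℝ) ^ (1 / β)) ^ β := by
          rw [← Real.rpow_mul hn0.le]; simp [hβ0.ne']
      _ ≤ m ^ β := Real.rpow_le_rpow (by positivity) (le_max_left _ _) hβ0.le
  set R : ℝ := A * m with hR
  have hR1 : 1 ≤ R := one_le_mul_of_one_le_of_one_le hA1 hm1
  have hR0 : 0 < R := by linarith
  have hdR : (W.d x y : ℝ) ≤ R := (le_max_right _ _).trans (le_mul_of_one_le_left hm0.le hA1)
  have hRβ : (n : ℝ) * R ^ (-β) ≤ (1 + 4 * Cs + 16 * Ct)⁻¹ := by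
    rw [hR, Real.mul_rpow hA0.le hm0.le, Real.rpow_neg hA0.le, hAβ, Real.rpow_neg hm0.le]
    have h1 : (n : ℝ) * (m ^ β)⁻¹ ≤ 1 := by
      rw [← div_eq_mul_inv, div_le_one (by positivity)]; exact hmβ
    calc _ = (1 + 4 * Cs + 16 * Ct)⁻¹ * ((n : ℝ) * (m ^ β)⁻¹) := by ring
      _ ≤ _ := mul_le_of_le_one_right (by positivity) h1
  set b : ℝ := B⁻¹ * (1 + 3 * R) ^ (-(df + β)) with hb
  have hb0 : 0 < b := by positivity
  have hbk : ∀ u v, (W.d u v : ℝ) ≤ 3 * R → b ≤ K.kernel u v := by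
    intro u v huv
    rw [hb, inv_mul_le_iff₀ hB0]
    exact (Real.rpow_le_rpow_of_nonpos (by positivity) (by linarith) (by linarith)).trans
      (hB u v).1
  set ζ : ℝ := b * (Cs * (3 * R) ^ df) with hζ
  have hζ0 : 0 ≤ ζ := by positivity
  have hnζ : n * ζ ≤ 1 / 4 := by
    have h1 : (1 + 3 * R) ^ (-(df + β)) ≤ (3 * R) ^ (-(df + β)) :=
      Real.rpow_le_rpow_of_nonpos (by positivity) (by linarith) (by linarith)
    have h2 : (3 * R) ^ (-(df + β)) * (3 * R) ^ df = (3 * R) ^ (-β) := by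
      rw [← Real.rpow_add (by positivity)]; congr 1; ring
    have h3 : (3 * R) ^ (-β) ≤ R ^ (-β) :=
      Real.rpow_le_rpow_of_nonpos hR0 (by linarith) (by linarith)
    have hBi : B⁻¹ ≤ 1 := inv_le_one_of_one_le₀ hB1
    calc n * ζ ≤ n * (1 * (3 * R) ^ (-(df + β)) * (Cs * (3 * R) ^ df)) := by
          rw [hζ, hb]; gcongr
      _ = Cs * (n * ((3 * R) ^ (-(df + β)) * (3 * R) ^ df)) := by ring
      _ ≤ Cs * (n * R ^ (-β)) := by rw [h2]; gcongr
      _ ≤ Cs * (1 + 4 * Cs + 16 * Ct)⁻¹ := by gcongr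
      _ ≤ 1 / 4 := by
          rw [← div_eq_mul_inv, div_le_div_iff₀ (by positivity) (by norm_num)]; linarith
  have hmass : ∀ u : X, ∀ i < n,
      1 / 2 < (transitionOp P)^[i] (Set.indicator (W.ball u R) 1) u := by
    intro u i hi
    have h1 := (hP.hasSum_nStep_mul (IsTransition.abs_indicator_le (W.ball u R)) i u).add
      (hP.hasSum_nStep_mul (IsTransition.abs_indicator_le {w | R < (W.d u w : ℝ)}) i u)
    have h2 := hasSum_le (fun w => ?_) (hP.hasSum_nStep i u) h1
    · have h3 : √(Ct * ((i : ℝ) + 1) * (1 + R) ^ (-β)) ≤ 1 / 4 := by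
        rw [Real.sqrt_le_left (by norm_num)]
        have h4 : (i : ℝ) + 1 ≤ n := by exact_mod_cast hi
        have h5 : (1 + R) ^ (-β) ≤ R ^ (-β) :=
          Real.rpow_le_rpow_of_nonpos hR0 (by linarith) (by linarith)
        calc _ ≤ Ct * (n : ℝ) * R ^ (-β) := by gcongr
          _ = Ct * (n * R ^ (-β)) := by ring
          _ ≤ Ct * (1 + 4 * Cs + 16 * Ct)⁻¹ := by gcongr
          _ ≤ (1 / 4) ^ 2 := by
              rw [← div_eq_mul_inv, div_le_iff₀ (by positivity)]; linarith
      linarith [hCt u R i hR0.le]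
    · rw [← mul_add]
      refine le_mul_of_one_le_right (hP.nStep_nonneg i u w) (le_of_eq ?_)
      by_cases h : (W.d u w : ℝ) ≤ R
      · rw [Set.indicator_of_mem (show w ∈ W.ball u R from h),
          Set.indicator_of_notMem (show w ∉ {w | R < (W.d u w : ℝ)} from not_lt.2 h)]
        simp
      · rw [Set.indicator_of_notMem (show w ∉ W.ball u R from h),
          Set.indicator_of_mem (show w ∈ {w | R < (W.d u w : ℝ)} from not_le.1 h)]
        simp
  -- The strict bound above 1/2, where 3/4 is available, survives for all large Ω; subtracting nζ ≤
  -- 1/4 leaves 1/4.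
  have hev : ∀ u : X, ∀ᶠ Ω : Finset X in Filter.atTop, ∀ i < n,
      1 / 2 < (finiteOp P Ω)^[i] (Set.indicator (W.ball u R) 1) u := by
    intro u
    have h1 : ∀ᶠ Ω : Finset X in Filter.atTop, ∀ i ∈ Finset.range n,
        1 / 2 < (finiteOp P Ω)^[i] (Set.indicator (W.ball u R) 1) u := by
      rw [Filter.eventually_all_finset]
      exact fun i hi => (hP.tendsto_finiteOp_iterate
        (IsTransition.abs_indicator_le (W.ball u R)) i u).eventually_const_lt
          (hmass u i (Finset.mem_range.1 hi))
    filter_upwards [h1] with Ω hΩ i hi using hΩ i (Finset.mem_range.2 hi)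
  have hlow : n * (b * (1 / 4) ^ 2) * W.vol y ≤ nStep P n x y := by
    refine ge_of_tendsto (hP.tendsto_finiteOp_iterate
      (IsTransition.abs_indicator_le {y}) n x) ?_
    filter_upwards [Filter.eventually_ge_atTop {x, y}, hev x, hev y] with Ω hΩ hΩx hΩy
    have hx : x ∈ Ω := hΩ (by simp)
    have hy : y ∈ Ω := hΩ (by simp)
    have H := K.isSubMarkov hμ Ω
    -- A constant jump rate b is split off between points at distance at most 3R, which covers any
    -- two points of B(x,R) and B(y,R). Paths using it exactly once are disjoint for different jump
    -- times, so they may be summed.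
    set k' : X → X → ℝ := fun u v => K.kernel u v - if (W.d u v : ℝ) ≤ 3 * R then b else 0
      with hk'
    have hk'0 : ∀ u v, 0 ≤ k' u v := fun u v => by
      simp only [hk']
      split_ifs with h
      · linarith [hbk u v h]
      · linarith [K.nonneg u v]
    have hk'k : ∀ u v, k' u v ≤ K.kernel u v := fun u v => by
      simp only [hk']
      split_ifs <;> linarith
    have H' : IsSubMarkov (fun u v : Ω => k' u v) (fun u : Ω => W.vol u) :=
      ⟨fun u v => hk'0 u v, fun u v => by simp only [hk', W.d_comm (v : X) u, K.symm (v : X) u],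
        H.pos, fun u => (Finset.sum_le_sum fun (v : Ω) _ =>
          mul_le_mul_of_nonneg_right (hk'k u v) (hμ.vol_pos v).le).trans (H.row u)⟩
    have hζrow : ∀ u : Ω, ∑ v : Ω, (K.kernel u v - k' u v) * W.vol v ≤ ζ := by
      intro u
      rw [Finset.sum_coe_sort Ω fun v => (K.kernel u v - k' u v) * W.vol v]
      calc _ = b * ∑ v ∈ Ω with (W.d u v : ℝ) ≤ 3 * R, W.vol v := by
            rw [Finset.mul_sum, Finset.sum_filter]
            refine Finset.sum_congr rfl fun v _ => ?_
            simp only [hk']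
            split_ifs <;> ring
        _ ≤ b * (Cs * (3 * R) ^ df) := by
            refine mul_le_mul_of_nonneg_left ?_ hb0.le
            exact hCs u (3 * R) (by linarith) _ fun v hv => (Finset.mem_filter.1 hv).2
    have hstay : ∀ u : Ω, (∀ i < n,
        1 / 2 < (finiteOp P Ω)^[i] (Set.indicator (W.ball u R) 1) u) → ∀ i < n,
        1 / 4 ≤ ∑ z : Ω, (kernelMatrix (fun u v : Ω => k' u v) (fun u : Ω => W.vol u) ^ i) u z *
          Set.indicator (W.ball u R) (1 : X → ℝ) z := by
      intro u hu i hi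
      have h1 := H.sum_pow_mul_le H' hζ0 (fun u v => hk'k u v) hζrow
        (g := fun z : Ω => Set.indicator (W.ball u R) (1 : X → ℝ) z)
        (fun z => Set.indicator_nonneg (fun _ _ => zero_le_one) _)
        (fun z => Set.indicator_le_self' (fun _ _ => zero_le_one) _) i u
      have h2 := hu i hi
      rw [hPdef, ← sum_kernelMatrix_pow_mul Ω K.kernel W.vol] at h2
      have h3 : (i : ℝ) * ζ ≤ n * ζ := by
        have : (i : ℝ) ≤ n := by exact_mod_cast hi.le
        gcongr
      linarith
    have hfin := H.le_pow_of_jump H' (near := fun u v : Ω => (W.d u v : ℝ) ≤ 3 * R)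
      (a := 1 / 4) hb0.le (by norm_num)
      (fun u v => by simp only [hk']; linarith) (x := ⟨x, hx⟩) (y := ⟨y, hy⟩)
      (g := fun z : Ω => Set.indicator (W.ball x R) (1 : X → ℝ) z)
      (h := fun z : Ω => Set.indicator (W.ball y R) (1 : X → ℝ) z)
      (fun z w => by
        by_cases hz : (z : X) ∈ W.ball x R
        · by_cases hw : (w : X) ∈ W.ball y R
          · have h1 : (W.d z w : ℝ) ≤ 3 * R := by
              have hz' : (W.d x z : ℝ) ≤ R := hz
              have hw' : (W.d y w : ℝ) ≤ R := hw
              have h2 := W.d_triangle_real z x w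
              have h3 := W.d_triangle_real x y w
              rw [W.d_comm (z : X) x] at h2
              linarith
            simp [hz, hw, h1]
          · rw [Set.indicator_of_notMem hw, mul_zero]; split_ifs <;> norm_num
        · rw [Set.indicator_of_notMem hz, zero_mul]; split_ifs <;> norm_num)
      (hstay ⟨x, hx⟩ hΩx) (hstay ⟨y, hy⟩ hΩy)
    refine hfin.trans (le_of_eq ?_)
    exact killed_pow_apply (K := K) Ω n ⟨x, hx⟩ ⟨y, hy⟩
  refine le_trans ?_ hlow
  refine mul_le_mul_of_nonneg_right ?_ (hμ.vol_pos y).le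
  have h1 : (4 * A) ^ (-(df + β)) * m ^ (-(df + β)) ≤ (1 + 3 * R) ^ (-(df + β)) := by
    rw [← Real.mul_rpow (by positivity) hm0.le]
    exact Real.rpow_le_rpow_of_nonpos (by positivity) (by rw [mul_assoc, ← hR]; linarith)
      (by linarith)
  calc _ = n * (B⁻¹ * ((4 * A) ^ (-(df + β)) * m ^ (-(df + β))) * (1 / 4) ^ 2) := by ring
    _ ≤ _ := by rw [hb]; gcongr

end SymmMarkovOperator

end WeightedGraph

/-! ### The two-sided bound. -/

theorem theorem1p1 {X : Type*} [Infinite X] (W : WeightedGraph X)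
    (hμ : W.ComparableToCounting) (hp : W.UniformlyElliptic)
    (df dw : ℝ) (hdf : 0 < df) (hV : W.VolumeGrowth df)
    (hU : W.USG df dw) (hL : W.LSG df dw)
    (K : W.SymmMarkovOperator) (β : ℝ) (hβ : 2 ≤ β) (hβw : β < dw)
    (hJ : K.J df β) :
    K.HKP df β := by
  have hβ0 : 0 < β := by linarith
  obtain ⟨C₁, hC₁, h₁⟩ := hJ.nStep_le hμ hV hdf hβ0
  obtain ⟨C₂, hC₂, h₂⟩ := hJ.nStep_le_of_ne hμ hV hU hL hdf hβ hβw
  obtain ⟨c, hc, h₃⟩ := hJ.le_nStep hμ hV hU hL hdf hβ hβw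
  refine ⟨C₁ + C₂ + c⁻¹, by positivity, fun n x y hn => ?_⟩
  have hn1 : (1 : ℝ) ≤ n := by exact_mod_cast hn
  have hn0 : (0 : ℝ) < n := by linarith
  have hv := hμ.vol_pos y
  set D : ℝ := (W.d x y : ℝ) with hD
  set a : ℝ := 1 / (n : ℝ) ^ (df / β) with ha
  have ha0 : 0 < a := by positivity
  have hup : K.iterKernel n x y ≤ (C₁ + C₂ + c⁻¹) * a := by
    rw [WeightedGraph.SymmMarkovOperator.iterKernel, div_le_iff₀ hv]
    refine (h₁ n x y).trans (mul_le_mul_of_nonneg_right ?_ hv.le)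
    have h : ((n : ℝ) + 1) ^ (-(df / β)) ≤ a := by
      rw [ha, one_div, ← Real.rpow_neg hn0.le]
      exact Real.rpow_le_rpow_of_nonpos hn0 (by linarith) (by have := div_pos hdf hβ0; linarith)
    have : 0 < c⁻¹ := by positivity
    gcongr
    linarith
  have hlow : c * (n * (max ((n : ℝ) ^ (1 / β)) D) ^ (-(df + β))) ≤ K.iterKernel n x y := by
    rw [WeightedGraph.SymmMarkovOperator.iterKernel, le_div_iff₀ hv]
    exact h₃ n x y hn
  have hcinv : (C₁ + C₂ + c⁻¹)⁻¹ ≤ c := by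
    rw [inv_le_comm₀ (by positivity) hc]; linarith
  -- At distance n^{1/β} the two terms of the profile agree, so the maximum in the lower bound
  -- reproduces the minimum in the profile.
  have hnear : n * ((n : ℝ) ^ (1 / β)) ^ (-(df + β)) = a := by
    rw [ha, one_div ((n : ℝ) ^ (df / β)), ← Real.rpow_neg hn0.le, ← Real.rpow_mul hn0.le]
    nth_rewrite 1 [← Real.rpow_one (n : ℝ)]
    rw [← Real.rpow_add hn0]
    congr 1
    field_simp
    ring
  unfold hkpProfile
  split_ifs with h0
  · refine ⟨?_, hup⟩
    have hD0 : D = 0 := by rw [hD, h0, Nat.cast_zero]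
    rw [hD0, max_eq_left (by positivity), hnear] at hlow
    exact (mul_le_mul_of_nonneg_right hcinv ha0.le).trans hlow
  · have hD0 : 0 < D := by rw [hD]; exact_mod_cast Nat.pos_of_ne_zero h0
    have hne : x ≠ y := by rintro rfl; exact h0 (W.d_self x)
    have hfar : (n : ℝ) / D ^ (df + β) = n * D ^ (-(df + β)) := by
      rw [Real.rpow_neg hD0.le, div_eq_mul_inv]
    rw [hfar]
    constructor
    · refine le_trans ?_ hlow
      rcases le_total ((n : ℝ) ^ (1 / β)) D with h | h
      · rw [max_eq_right h]
        exact mul_le_mul hcinv (min_le_right _ _) (by positivity) hc.le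
      · rw [max_eq_left h, hnear]
        exact mul_le_mul hcinv (min_le_left _ _) (by positivity) hc.le
    · rw [mul_min_of_nonneg _ _ (by positivity)]
      refine le_min hup ?_
      rw [WeightedGraph.SymmMarkovOperator.iterKernel, div_le_iff₀ hv]
      refine (h₂ n x y hn hne).trans (mul_le_mul_of_nonneg_right ?_ hv.le)
      have : 0 < c⁻¹ := by positivity
      refine mul_le_mul_of_nonneg_right ?_ (by positivity)
      linarith
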